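/- \textbf{Setting.} Let $p,T,\Delta F,r$ be real-analytic functions of $(v,S,\lambda)$ on an open set $\mathcal D\subset\mathbb R^3$ with $T>0$, $r_\lambda<0$ on $\mathcal D$, and $r=r_v=r_S=0$ on $\mathcal D\cap\{\lambda=0\}$. Put $\Phi=-r\,\Delta F/T$ and $c_0=\sqrt{-v^2p_v}$. Let $(v,u,0,0,S,\lambda)(x)$, $x\in[0,\infty)$, be a real-analytic type D detonation profile in the reaction zone: $(v,S,\lambda)(x)\in\mathcal D$, $v>0$, $\lambda(0)>0$; for $x>0$ $$uv'-vu'=0,\qquad uu'+v\,p(v,S,\lambda)'=0,\qquad uS'=\Phi,\qquad u\lambda'=r;$$ there are constants with $0<C_1\le u/c_0\le C_2<1$ and $0<C_3\le u\le C_4$ on $[0,\infty)$; $(c_0^2-u^2)'<0$ on $[0,\infty)$; and $(v,u,S,\lambda)(x)\to(v_\infty,u_\infty,S_\infty,0)$ as $x\to+\infty$ with $(v_\infty,S_\infty,0)\in\mathcal D$. Let $\kappa=u/c_0$, $\eta=1-\kappa^2$, $m=u/v$, $s^2=\zeta^2+c_0^2\eta$, $\zeta_\infty=i\,c_0\eta^{1/2}(\infty)$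 and $\mu=-r_\lambda(\infty)/u_\infty$. With $$A_x=\begin{pmatrix}u&-v&0&0&0\\ vp_v&u&0&vp_S&vp_\lambda\\0&0&u&0&0\\0&0&0&u&0\\0&0&0&0&u\end{pmatrix},\quad A_y=\begin{pmatrix}0&0&-v&0&0\\0&0&0&0&0\\ vp_v&0&0&vp_S&vp_\lambda\\0&0&0&0&0\\0&0&0&0&0\end{pmatrix},$$ $$B=\begin{pmatrix}-u'&v'&0&0&0\\p'-v(c_0^2/v^2)'&u'&0&vp_S'&vp_\lambda'\\0&0&0&0&0\\-\Phi_v&S'&0&-\Phi_S&-\Phi_\lambda\\-r_v&\lambda'&0&-r_S&-r_\lambda\end{pmatrix},$$ let $\Phi_0(x,\zeta)=\{A_x^{-1}(\zeta I+iA_y)\}^t$, $\Phi_1(x)=\{A_x^{-1}B\}^t$, and consider the system $$(1)\qquad h\,\theta_x=(\Phi_0+h\Phi_1)\theta .$$ Put $$Y_1=\begin{pmatrix}0&\frac{m}{\kappa u}&-\frac{im}{1-\eta}&0&0\\ \frac{\zeta}{u}&0&i&0&0\\-i&0&\frac{\zeta}{u}&0&0\\0&-\frac{\kappa}{mu}p_S&0&1&0\\0&-\frac{\kappa}{mu}p_\lambda&0&0&1\end{pmatrix},\qquad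 A^0_{11}=\begin{pmatrix}-\frac{\kappa^2\zeta}{\eta u}&-\frac{\kappa}{\eta u}\\-\frac{s^2\kappa}{\eta u}&-\frac{\kappa^2\zeta}{\eta u}\end{pmatrix},\qquad A^0_{22}=\frac{\zeta}{u}I_3,$$ and let $d_{ij}$ ($i,j=1,2$) be the blocks (of sizes $2$ and $3$) of $Y_1^{-1}\Phi_1Y_1-Y_1^{-1}\partial_xY_1$; the substitution $\theta=Y_1\theta^a$ turns (1) into $$(2)\qquad h\,\theta^a_x=\left[\begin{pmatrix}A^0_{11}&0\\0&A^0_{22}\end{pmatrix}+h\begin{pmatrix}d_{11}&d_{12}\\d_{21}&d_{22}\end{pmatrix}\right]\theta^a .$$ For $M_0>0$ and $0<\vartheta<\pi/2$ let $\mathbb W(M_0)=\{x\in\mathbb C:\Re x>M_0\}$ and $\mathbb W(M_0,\vartheta)=\{x\in\mathbb C: x\ne M_0,\ |\arg(x-M_0)|<\vartheta\}$. \textbf{Proposition.} One has $\mu>0$. Let $0<\vartheta<\pi/2$. There exist $M_0>0$, $h_0>0$ and an open neighborhood $\omega\subset\mathbb C$ of $\zeta_\infty$ such that the following hold. (i)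 The functions of $x$ from which the matrices above are built ($v,u,S,\lambda$, and $p,p_v,p_S,p_\lambda,c_0,\Phi_v,\Phi_S,\Phi_\lambda,r_v,r_S,r_\lambda$ evaluated along the profile) extend analytically from $(M_0,\infty)$ to $\mathbb W(M_0)$, and with these (unique) extensions $A_x(x)$ and $Y_1(x,\zeta)$ are invertible for $x\in\mathbb W(M_0,\vartheta)$, $\zeta\in\omega$. (ii) There are $\alpha_{12}(x,\zeta,h)\in\mathbb C^{2\times3}$ and $\alpha_{21}(x,\zeta,h)\in\mathbb C^{3\times2}$, bounded and (jointly) analytic in $(x,\zeta,h)\in\mathbb W(M_0,\vartheta)\times\omega\times(0,h_0)$, such that, for all $\zeta\in\omega$ and $0<h<h_0$, the matrix $$Y_2=\begin{pmatrix}I&h\alpha_{12}\\h\alpha_{21}&I\end{pmatrix}$$ is invertible on $\mathbb W(M_0,\vartheta)$, and for every $\phi$ the function $\theta^a=Y_2\phi$ solves (2) on $\mathbb W(M_0,\vartheta)$ (equivalently, $\theta=Y_1Y_2\phi$ solves (1) there) if and only if $\phi$ solves there the block-diagonal system $$h\,\phi_x=\begin{pmatrix}A^0_{11}+hd_{11}+h^2d_{12}\alpha_{21}&0\\0&A^0_{22}+hd_{22}+h^2d_{21}\alpha_{12}\end{pmatrix}\phi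 .$$ (iii) For $\zeta\in\omega$, $0<h<h_0$ the limit $\alpha_{21}(\infty,\zeta,h)=\lim\alpha_{21}(x,\zeta,h)$ as $\Re x\to\infty$ in $\mathbb W(M_0,\vartheta)$ exists, and for each $k=0,1,2,\dots$ there is a constant $C_k$, independent of $x,\zeta,h$, such that $$\left|\partial_x^k\big(\alpha_{21}(x,\zeta,h)-\alpha_{21}(\infty,\zeta,h)\big)\right|\le C_k\,h^{-k}e^{-\mu\Re x}\qquad(x\in\mathbb W(M_0,\vartheta),\ \zeta\in\omega,\ 0<h<h_0).$$ -/

import Mathlib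

open scoped Topology Matrix

noncomputable section

namespace ZND

/-! ### Thermodynamics and detonation profiles -/

/-- Thermodynamic arguments `(v, S, lam)`: specific volume, entropy, mass fraction of reactant. -/
abbrev State : Type := ℝ × ℝ × ℝ

/-- Partial derivative in `v`. -/
def dv (f : State → ℝ) (w : State) : ℝ := fderiv ℝ f w (1, 0, 0)

/-- Partial derivative in `S`. -/
def dS (f : State → ℝ) (w : State) : ℝ := fderiv ℝ f w (0, 1, 0)

/-- Partial derivative in `lam`. -/
def dlam (f : State → ℝ) (w : State) : ℝ := fderiv ℝ f w (0, 0, 1)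

/-- The thermodynamic functions of the ZND system: pressure `p`, temperature `T`, free energy
increment `dF` and reaction rate `r`, real analytic on an open set `dom` of states, with the
assumptions on the rate. -/
structure Thermo where
  dom : Set State
  isOpen_dom : IsOpen dom
  p : State → ℝ
  T : State → ℝ
  dF : State → ℝ
  r : State → ℝ
  analytic_p : AnalyticOnNhd ℝ p dom
  analytic_T : AnalyticOnNhd ℝ T dom
  analytic_dF : AnalyticOnNhd ℝ dF dom
  analytic_r : AnalyticOnNhd ℝ r dom
  T_pos : ∀ w ∈ dom, 0 < T w
  r_eq_zero : ∀ w ∈ dom, w.2.2 = 0 → r w = 0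
  dlam_r_neg : ∀ w ∈ dom, dlam r w < 0
  dv_r_eq_zero : ∀ w ∈ dom, w.2.2 = 0 → dv r w = 0
  dS_r_eq_zero : ∀ w ∈ dom, w.2.2 = 0 → dS r w = 0

/-- The entropy source `Φ = - r ΔF / T`. -/
def Thermo.source (Θ : Thermo) (w : State) : ℝ := -(Θ.r w * Θ.dF w) / Θ.T w

/-- The sound speed `c₀`, with `c₀² = - v² p_v`. -/
def Thermo.soundSpeed (Θ : Thermo) (w : State) : ℝ := Real.sqrt (-(w.1 ^ 2 * dv Θ.p w))

/-- The reaction zone `x ≥ 0` of a steady strong detonation profile `(v, u, 0, 0, S, lam)` of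
type D: an analytic solution of the steady ZND equations, uniformly subsonic, converging to a
completely burned end state, along which `c₀² - u²` is strictly decreasing. -/
structure Profile (Θ : Thermo) where
  v : ℝ → ℝ
  u : ℝ → ℝ
  S : ℝ → ℝ
  lam : ℝ → ℝ
  vInf : ℝ
  uInf : ℝ
  SInf : ℝ
  mem_dom : ∀ x, 0 ≤ x → (v x, S x, lam x) ∈ Θ.dom
  memInf_dom : (vInf, SInf, 0) ∈ Θ.dom
  analytic_v : AnalyticOn ℝ v (Set.Ici 0)
  analytic_u : AnalyticOn ℝ u (Set.Ici 0)
  analytic_S : AnalyticOn ℝ S (Set.Ici 0)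
  analytic_lam : AnalyticOn ℝ lam (Set.Ici 0)
  v_pos : ∀ x, 0 ≤ x → 0 < v x
  lam_pos : 0 < lam 0
  mass : ∀ x, 0 < x → u x * deriv v x - v x * deriv u x = 0
  momentum : ∀ x, 0 < x →
    u x * deriv u x + v x * deriv (fun y => Θ.p (v y, S y, lam y)) x = 0
  entropy : ∀ x, 0 < x → u x * deriv S x = Θ.source (v x, S x, lam x)
  reaction : ∀ x, 0 < x → u x * deriv lam x = Θ.r (v x, S x, lam x)
  subsonic : ∃ C₁ C₂ C₃ C₄ : ℝ, 0 < C₁ ∧ C₂ < 1 ∧ 0 < C₃ ∧ ∀ x, 0 ≤ x →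
    (C₁ ≤ u x / Θ.soundSpeed (v x, S x, lam x) ∧
      u x / Θ.soundSpeed (v x, S x, lam x) ≤ C₂) ∧ C₃ ≤ u x ∧ u x ≤ C₄
  typeD : ∀ x, 0 ≤ x →
    derivWithin (fun y => Θ.soundSpeed (v y, S y, lam y) ^ 2 - u y ^ 2) (Set.Ici 0) x < 0
  tendsto_v : Filter.Tendsto v Filter.atTop (𝓝 vInf)
  tendsto_u : Filter.Tendsto u Filter.atTop (𝓝 uInf)
  tendsto_S : Filter.Tendsto S Filter.atTop (𝓝 SInf)
  tendsto_lam : Filter.Tendsto lam Filter.atTop (𝓝 0)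

namespace Profile

variable {Θ : Thermo} (P : Profile Θ)

/-- The thermodynamic state at `x`. -/
def state (x : ℝ) : State := (P.v x, P.S x, P.lam x)

/-- The limiting thermodynamic state. -/
def stateInf : State := (P.vInf, P.SInf, 0)

/-- The decay rate `μ = - r_lam / u` at the end state. -/
def mu : ℝ := -(dlam Θ.r P.stateInf) / P.uInf

/-- `η = 1 - (u / c₀)²` at the end state. -/
def etaInf : ℝ := 1 - (P.uInf / Θ.soundSpeed P.stateInf) ^ 2

/-- The turning point frequency at infinity, `ζ_∞ = i c₀ η^{1/2} (∞)`. -/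
def zetaInf : ℂ := Complex.I * ((Θ.soundSpeed P.stateInf * Real.sqrt P.etaInf : ℝ) : ℂ)

end Profile

/-! ### The scalar functions of `x` entering the linearized system, and their extension -/

/-- The scalar functions of position from which all coefficient matrices are built
(`Phiv` etc. are the partial derivatives of the entropy source `Φ`). -/
structure Coeffs (X K : Type) where
  v : X → K
  u : X → K
  S : X → K
  lam : X → K
  p : X → K
  pv : X → K
  pS : X → K
  plam : X → K
  c0 : X → K
  Phiv : X → K
  PhiS : X → K
  Philam : X → K
  rv : X → K
  rS : X → K
  rlam : X → K

/-- The scalar functions along a profile. -/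
def Profile.coeffs {Θ : Thermo} (P : Profile Θ) : Coeffs ℝ ℝ where
  v := P.v
  u := P.u
  S := P.S
  lam := P.lam
  p := fun x => Θ.p (P.state x)
  pv := fun x => dv Θ.p (P.state x)
  pS := fun x => dS Θ.p (P.state x)
  plam := fun x => dlam Θ.p (P.state x)
  c0 := fun x => Θ.soundSpeed (P.state x)
  Phiv := fun x => dv Θ.source (P.state x)
  PhiS := fun x => dS Θ.source (P.state x)
  Philam := fun x => dlam Θ.source (P.state x)
  rv := fun x => dv Θ.r (P.state x)
  rS := fun x => dS Θ.r (P.state x)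
  rlam := fun x => dlam Θ.r (P.state x)

/-- The half-plane `{Re x > M₀}`. -/
def halfPlane (M₀ : ℝ) : Set ℂ := {x | M₀ < x.re}

/-- The infinite wedge `{|arg (x - M₀)| < θ}` (its vertex, where `arg` is undefined, excluded). -/
def wedge (M₀ θ : ℝ) : Set ℂ := {x | x ≠ (M₀ : ℂ) ∧ |Complex.arg (x - (M₀ : ℂ))| < θ}

/-- `F` is the analytic extension of `f` from `(M₀, ∞)` to the half-plane `{Re x > M₀}`. -/
def IsExtension (M₀ : ℝ) (f : ℝ → ℝ) (F : ℂ → ℂ) : Prop :=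
  DifferentiableOn ℂ F (halfPlane M₀) ∧ ∀ x : ℝ, M₀ < x → F (x : ℂ) = (f x : ℂ)

/-- All the scalar functions are extended analytically to the half-plane. -/
structure Coeffs.Extends (F : Coeffs ℂ ℂ) (f : Coeffs ℝ ℝ) (M₀ : ℝ) : Prop where
  v : IsExtension M₀ f.v F.v
  u : IsExtension M₀ f.u F.u
  S : IsExtension M₀ f.S F.S
  lam : IsExtension M₀ f.lam F.lam
  p : IsExtension M₀ f.p F.p
  pv : IsExtension M₀ f.pv F.pv
  pS : IsExtension M₀ f.pS F.pS
  plam : IsExtension M₀ f.plam F.plam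
  c0 : IsExtension M₀ f.c0 F.c0
  Phiv : IsExtension M₀ f.Phiv F.Phiv
  PhiS : IsExtension M₀ f.PhiS F.PhiS
  Philam : IsExtension M₀ f.Philam F.Philam
  rv : IsExtension M₀ f.rv F.rv
  rS : IsExtension M₀ f.rS F.rS
  rlam : IsExtension M₀ f.rlam F.rlam

/-! ### Blocks of `5 × 5` matrices -/

/-- The `5 × 5` matrix with blocks of sizes `2` and `3`. -/
def block5 (A : Matrix (Fin 2) (Fin 2) ℂ) (B : Matrix (Fin 2) (Fin 3) ℂ)
    (C : Matrix (Fin 3) (Fin 2) ℂ) (D : Matrix (Fin 3) (Fin 3) ℂ) :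
    Matrix (Fin 5) (Fin 5) ℂ :=
  (Matrix.fromBlocks A B C D).submatrix (finSumFinEquiv (m := 2) (n := 3)).symm
    (finSumFinEquiv (m := 2) (n := 3)).symm

/-- Upper left `2 × 2` block. -/
def b11 (X : Matrix (Fin 5) (Fin 5) ℂ) : Matrix (Fin 2) (Fin 2) ℂ :=
  X.submatrix (Fin.castAdd 3) (Fin.castAdd 3)

/-- Upper right `2 × 3` block. -/
def b12 (X : Matrix (Fin 5) (Fin 5) ℂ) : Matrix (Fin 2) (Fin 3) ℂ :=
  X.submatrix (Fin.castAdd 3) (Fin.natAdd 2)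

/-- Lower left `3 × 2` block. -/
def b21 (X : Matrix (Fin 5) (Fin 5) ℂ) : Matrix (Fin 3) (Fin 2) ℂ :=
  X.submatrix (Fin.natAdd 2) (Fin.castAdd 3)

/-- Lower right `3 × 3` block. -/
def b22 (X : Matrix (Fin 5) (Fin 5) ℂ) : Matrix (Fin 3) (Fin 3) ℂ :=
  X.submatrix (Fin.natAdd 2) (Fin.natAdd 2)

/-! ### The linearized system and its coefficient matrices -/

namespace Coeffs

variable (F : Coeffs ℂ ℂ)

/-- The coefficient matrix `A_x`. -/
def Ax (x : ℂ) : Matrix (Fin 5) (Fin 5) ℂ :=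
  !![F.u x, -F.v x, 0, 0, 0;
     F.v x * F.pv x, F.u x, 0, F.v x * F.pS x, F.v x * F.plam x;
     0, 0, F.u x, 0, 0;
     0, 0, 0, F.u x, 0;
     0, 0, 0, 0, F.u x]

/-- The coefficient matrix `A_y`. -/
def Ay (x : ℂ) : Matrix (Fin 5) (Fin 5) ℂ :=
  !![0, 0, -F.v x, 0, 0;
     0, 0, 0, 0, 0;
     F.v x * F.pv x, 0, 0, F.v x * F.pS x, F.v x * F.plam x;
     0, 0, 0, 0, 0;
     0, 0, 0, 0, 0]

/-- The coefficient matrix `B`. -/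
def B (x : ℂ) : Matrix (Fin 5) (Fin 5) ℂ :=
  !![-deriv F.u x, deriv F.v x, 0, 0, 0;
     deriv F.p x - F.v x * deriv (fun y => F.c0 y ^ 2 / F.v y ^ 2) x, deriv F.u x, 0,
       F.v x * deriv F.pS x, F.v x * deriv F.plam x;
     0, 0, 0, 0, 0;
     -F.Phiv x, deriv F.S x, 0, -F.PhiS x, -F.Philam x;
     -F.rv x, deriv F.lam x, 0, -F.rS x, -F.rlam x]

/-- `Φ₀ = {A_x⁻¹ (ζ I + i A_y)}ᵗ`. -/
def Phi0 (ζ x : ℂ) : Matrix (Fin 5) (Fin 5) ℂ :=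
  ((F.Ax x)⁻¹ * (ζ • (1 : Matrix (Fin 5) (Fin 5) ℂ) + Complex.I • F.Ay x))ᵀ

/-- `Φ₁ = {A_x⁻¹ B}ᵗ`. -/
def Phi1 (x : ℂ) : Matrix (Fin 5) (Fin 5) ℂ := ((F.Ax x)⁻¹ * F.B x)ᵀ

/-- The matrix `G = Φ₀ + h Φ₁` of the system `h θ_x = G θ`. -/
def G (ζ : ℂ) (h : ℝ) (x : ℂ) : Matrix (Fin 5) (Fin 5) ℂ :=
  F.Phi0 ζ x + (h : ℂ) • F.Phi1 x

/-- `κ = u / c₀`. -/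
def kappa (x : ℂ) : ℂ := F.u x / F.c0 x

/-- `η = 1 - κ²`. -/
def eta (x : ℂ) : ℂ := 1 - F.kappa x ^ 2

/-- The mass flux `m = u / v`. -/
def m (x : ℂ) : ℂ := F.u x / F.v x

/-- `s² = ζ² + c₀² η`. -/
def sSq (ζ x : ℂ) : ℂ := ζ ^ 2 + F.c0 x ^ 2 * F.eta x

/-- The approximate conjugator `Y₁ = (P₀, Q₀, T₃, T₄, T₅)`. -/
def Y1 (ζ x : ℂ) : Matrix (Fin 5) (Fin 5) ℂ :=
  !![0, F.m x / (F.kappa x * F.u x), -(Complex.I * F.m x) / (1 - F.eta x), 0, 0;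
     ζ / F.u x, 0, Complex.I, 0, 0;
     -Complex.I, 0, ζ / F.u x, 0, 0;
     0, -(F.kappa x / (F.m x * F.u x)) * F.pS x, 0, 1, 0;
     0, -(F.kappa x / (F.m x * F.u x)) * F.plam x, 0, 0, 1]

/-- The entrywise derivative `d_x Y₁`. -/
def dY1 (ζ x : ℂ) : Matrix (Fin 5) (Fin 5) ℂ :=
  Matrix.of fun i j => deriv (fun y => F.Y1 ζ y i j) x

/-- The block `A⁰₁₁`. -/
def A11 (ζ x : ℂ) : Matrix (Fin 2) (Fin 2) ℂ :=
  !![-(F.kappa x ^ 2 * ζ) / (F.eta x * F.u x), -F.kappa x / (F.eta x * F.u x);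
     -(F.sSq ζ x * F.kappa x) / (F.eta x * F.u x), -(F.kappa x ^ 2 * ζ) / (F.eta x * F.u x)]

/-- The block `A⁰₂₂`. -/
def A22 (ζ x : ℂ) : Matrix (Fin 3) (Fin 3) ℂ := (ζ / F.u x) • 1

/-- The matrix `(d_ij) = Y₁⁻¹ Φ₁ Y₁ - Y₁⁻¹ d_x Y₁`. -/
def D (ζ x : ℂ) : Matrix (Fin 5) (Fin 5) ℂ :=
  (F.Y1 ζ x)⁻¹ * F.Phi1 x * F.Y1 ζ x - (F.Y1 ζ x)⁻¹ * F.dY1 ζ x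

/-- The matrix of the approximately block-diagonal system, `diag (A⁰₁₁, A⁰₂₂) + h (d_ij)`. -/
def preBlock (ζ : ℂ) (h : ℝ) (x : ℂ) : Matrix (Fin 5) (Fin 5) ℂ :=
  block5 (F.A11 ζ x) 0 0 (F.A22 ζ x) + (h : ℂ) • F.D ζ x

/-- The matrix of the exactly block-diagonal system, with diagonal blocks
`A⁰₁₁ + h d₁₁ + h² d₁₂ α₂₁` and `A⁰₂₂ + h d₂₂ + h² d₂₁ α₁₂`. -/
def blockDiag (α₁₂ : Matrix (Fin 2) (Fin 3) ℂ) (α₂₁ : Matrix (Fin 3) (Fin 2) ℂ)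
    (ζ : ℂ) (h : ℝ) (x : ℂ) : Matrix (Fin 5) (Fin 5) ℂ :=
  block5
    (F.A11 ζ x + (h : ℂ) • b11 (F.D ζ x) + ((h : ℂ) ^ 2) • (b12 (F.D ζ x) * α₂₁)) 0 0
    (F.A22 ζ x + (h : ℂ) • b22 (F.D ζ x) + ((h : ℂ) ^ 2) • (b21 (F.D ζ x) * α₁₂))

end Coeffs

/-- `Y₂ = [[I, h α₁₂], [h α₂₁, I]]`. -/
def Y2 (h : ℝ) (α₁₂ : Matrix (Fin 2) (Fin 3) ℂ) (α₂₁ : Matrix (Fin 3) (Fin 2) ℂ) :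
    Matrix (Fin 5) (Fin 5) ℂ :=
  block5 1 ((h : ℂ) • α₁₂) ((h : ℂ) • α₂₁) 1

/-- `φ` solves `h φ_x = A φ` on `W` (`x`-derivatives being complex derivatives). -/
def SolvesOn (W : Set ℂ) (h : ℝ) (A : ℂ → Matrix (Fin 5) (Fin 5) ℂ)
    (φ : ℂ → Fin 5 → ℂ) : Prop :=
  ∀ x ∈ W, DifferentiableAt ℂ φ x ∧ (h : ℂ) • deriv φ x = A x *ᵥ φ x

/-- The substitution `θ = Y φ` conjugates `h θ_x = A θ` on `W` to `h φ_x = B φ`. -/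
def Conjugates (W : Set ℂ) (h : ℝ) (Y A B : ℂ → Matrix (Fin 5) (Fin 5) ℂ) : Prop :=
  (∀ x ∈ W, IsUnit (Y x).det) ∧
    ∀ φ : ℂ → Fin 5 → ℂ, SolvesOn W h A (fun x => Y x *ᵥ φ x) ↔ SolvesOn W h B φ

end ZND

end

noncomputable section

namespace ZND

/-! The substitution `Y2` is exact as soon as its off-diagonal blocks solve two decoupled matrix
Riccati equations, for instance h α₂₁' = (A₂₂ + h d₂₂) α₂₁ + d₂₁ − α₂₁ (A₁₁ + h d₁₁ + h² d₁₂ α₂₁).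
What has to be found is a solution bounded uniformly in h up to x = ∞, analytic in all variables,
with a limit approached at rate exp (−μ x).

The key is the variable z = exp (−μ x). Along the profile the state is an analytic function of z
near z = 0 (`exists_state_eq_comp_exp`). Indeed, mass conservation and the momentum and entropy
equations make every derivative a multiple of λ', so the orbit follows an analytic integral curve
parametrized by λ; a backward uniqueness argument at infinity shows that it lies exactly on this
curve. There remains a scalar analytic equation for λ with linear part −μ, which an analytic change
of variable linearizes. All coefficients are then convergent power series in z. This gives the
extension to a half-plane, and `HasExpLimit` records it in a form stable under algebra and
differentiation.

In z the operator h d/dx is −μ h z d/dz, which multiplies the k-th coefficient by −μ k h. Near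
infinity the principal part of the Riccati equation is the scalar gap l between the eigenvalues of
the two blocks, up to small terms. The equation becomes (l + μ k h) αₖ = (small linear terms +
forcing + h² quadratic term)ₖ. At the turning point frequency l is imaginary and nonzero, while μ k
h ≥ 0, so |l + μ k h| is bounded below uniformly in k and h (`le_norm_add_of_sector`): there are no
small divisors. In the Banach algebra ℓ¹ of absolutely summable power series this is a uniform
contraction (`exists_riccati`), and its fixed point depends analytically on (ζ, h) by the implicit
function theorem. The limit at infinity is the constant coefficient, and the rest is O(z).

At infinity the 2 × 2 block is not scalar at the turning point but a Jordan block; a fixed diagonal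
rescaling makes its nilpotent part as small as required (`exists_block_conjugators`). The derivative
bounds are Cauchy estimates on discs of radius one. -/

lemma analyticAt_clm_apply {𝕜 P E F : Type*} [NontriviallyNormedField 𝕜] [NormedAddCommGroup P]
    [NormedSpace 𝕜 P] [NormedAddCommGroup E] [NormedSpace 𝕜 E] [NormedAddCommGroup F]
    [NormedSpace 𝕜 F] {T : P → E →L[𝕜] F} {g : P → E} {p : P} (hT : AnalyticAt 𝕜 T p)
    (hg : AnalyticAt 𝕜 g p) : AnalyticAt 𝕜 (fun q => T q (g q)) p :=
  AnalyticAt.comp (g := fun r : (E →L[𝕜] F) × E => r.1 r.2) (f := fun q => (T q, g q))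
    (ContinuousLinearMap.analyticAt_bilinear (ContinuousLinearMap.id 𝕜 (E →L[𝕜] F)) _)
    (hT.prod hg)

/-! ### The Banach algebra ℓ¹ of absolutely summable power series -/

/-- The algebra of power series with absolutely summable coefficients. -/
def absSubalgebra : Subalgebra ℂ (PowerSeries ℂ) where
  carrier := {f | Summable fun n => ‖PowerSeries.coeff n f‖}
  mul_mem' {f g} hf hg := by
    have := summable_norm_sum_mul_antidiagonal_of_summable_norm hf hg
    change Summable fun n => ‖PowerSeries.coeff n (f * g)‖
    simpa only [PowerSeries.coeff_mul] using this
  add_mem' {f g} hf hg := by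
    refine (hf.add hg).of_nonneg_of_le (fun _ => norm_nonneg _) fun n => ?_
    rw [map_add]
    exact norm_add_le _ _
  algebraMap_mem' c := by
    refine summable_of_ne_finset_zero (s := {0}) fun n hn => ?_
    rw [PowerSeries.algebraMap_apply, PowerSeries.coeff_C, if_neg (by simpa using hn), norm_zero]

/-- Power series with absolutely summable coefficients, seen as functions on the closed unit
disc. -/
def AbsSeries : Type := absSubalgebra

namespace AbsSeries

section Construction

/-- The ring structure. -/
abbrev commRing : CommRing AbsSeries := inferInstanceAs (CommRing absSubalgebra)

attribute [local instance] commRing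

/-- The algebra structure. -/
abbrev algebra : Algebra ℂ AbsSeries := inferInstanceAs (Algebra ℂ absSubalgebra)

attribute [local instance] algebra

/-- The series with a given absolutely summable sequence of coefficients. -/
def ofSummable (a : ℕ → ℂ) (h : Summable fun n => ‖a n‖) : AbsSeries :=
  ⟨PowerSeries.mk a, by
    change Summable fun n => ‖PowerSeries.coeff n (PowerSeries.mk a)‖
    simpa only [PowerSeries.coeff_mk] using h⟩

lemma summable_coeff_val (a : AbsSeries) : Summable fun n => ‖PowerSeries.coeff n a.1‖ := a.2

/-- The sequence of coefficients. -/
def toLp : AbsSeries →ₗ[ℂ] lp (fun _ : ℕ => ℂ) 1 where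
  toFun a := ⟨fun n => PowerSeries.coeff n a.1, memℓp_gen (by simpa using a.summable_coeff_val)⟩
  map_add' a b := by ext n; exact map_add (PowerSeries.coeff n) a.1 b.1
  map_smul' c a := by ext n; exact map_smul (PowerSeries.coeff n) c a.1

lemma toLp_injective : Function.Injective toLp := fun _ _ h =>
  Subtype.ext (PowerSeries.ext fun n => congrFun (congrArg Subtype.val h) n)

/-- The norm `∑ ‖aₙ‖`. -/
abbrev normedAddCommGroup : NormedAddCommGroup AbsSeries :=
  NormedAddCommGroup.induced AbsSeries (lp (fun _ : ℕ => ℂ) 1) toLp toLp_injective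

attribute [local instance] normedAddCommGroup

lemma norm_eq_norm_toLp (a : AbsSeries) : ‖a‖ = ‖toLp a‖ := rfl

lemma norm_eq_tsum_val (a : AbsSeries) : ‖a‖ = ∑' n, ‖PowerSeries.coeff n a.1‖ := by
  have := lp.norm_eq_tsum_rpow (p := 1) (by simp) (toLp a)
  simp only [ENNReal.toReal_one, Real.rpow_one, ne_eq, one_ne_zero, not_false_eq_true, div_self] at this
  exact this

lemma norm_mul_le' (a b : AbsSeries) : ‖a * b‖ ≤ ‖a‖ * ‖b‖ := by
  have ha := a.summable_coeff_val
  have hb := b.summable_coeff_val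
  have hprod := tsum_mul_tsum_eq_tsum_sum_antidiagonal_of_summable_norm
    (f := fun n => ‖PowerSeries.coeff n a.1‖) (g := fun n => ‖PowerSeries.coeff n b.1‖)
    (by simpa using ha) (by simpa using hb)
  rw [norm_eq_tsum_val, norm_eq_tsum_val a, norm_eq_tsum_val b, hprod]
  refine Summable.tsum_le_tsum (fun n => ?_) (a * b).summable_coeff_val ?_
  · change ‖PowerSeries.coeff n (a.1 * b.1)‖ ≤ _
    rw [PowerSeries.coeff_mul]
    refine (norm_sum_le _ _).trans (le_of_eq ?_)
    simp
  · have := summable_norm_sum_mul_antidiagonal_of_summable_norm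
      (f := fun n => ‖PowerSeries.coeff n a.1‖) (g := fun n => ‖PowerSeries.coeff n b.1‖)
      (by simpa using ha) (by simpa using hb)
    exact this.of_norm

instance : NormedCommRing AbsSeries where
  __ := commRing
  __ := normedAddCommGroup
  norm_mul_le := norm_mul_le'

instance : NormedAlgebra ℂ AbsSeries where
  __ := algebra
  norm_smul_le c a := by
    rw [norm_eq_norm_toLp, map_smul, norm_smul, norm_eq_norm_toLp]

end Construction

instance : CompleteSpace AbsSeries := by
  have hiso : Isometry toLp := AddMonoidHomClass.isometry_of_norm toLp fun _ => rfl
  have hsurj : Function.Surjective toLp := fun f => by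
    have hs : Summable fun n => ‖f n‖ := by simpa using (lp.memℓp f).summable (by simp)
    exact ⟨ofSummable f hs, by ext n; simp [toLp, ofSummable]⟩
  exact (completeSpace_congr (e := Equiv.ofBijective _ ⟨toLp_injective, hsurj⟩)
    hiso.isUniformEmbedding).2 inferInstance

/-- The `n`-th coefficient. -/
def coeff (n : ℕ) : AbsSeries →L[ℂ] ℂ :=
  LinearMap.mkContinuous
    { toFun := fun a => PowerSeries.coeff n a.1
      map_add' := fun a b => map_add (PowerSeries.coeff n) a.1 b.1
      map_smul' := fun c a => map_smul (PowerSeries.coeff n) c a.1 } 1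
    fun a => by
      rw [one_mul]
      exact lp.norm_apply_le_norm one_ne_zero (toLp a) n

@[ext] lemma ext {a b : AbsSeries} (h : ∀ n, coeff n a = coeff n b) : a = b :=
  Subtype.ext (PowerSeries.ext h)

lemma summable_coeff (a : AbsSeries) : Summable fun n => ‖coeff n a‖ := a.summable_coeff_val

lemma norm_eq_tsum (a : AbsSeries) : ‖a‖ = ∑' n, ‖coeff n a‖ := a.norm_eq_tsum_val

@[simp] lemma coeff_ofSummable (a : ℕ → ℂ) (h : Summable fun n => ‖a n‖) (n : ℕ) :
    coeff n (ofSummable a h) = a n := PowerSeries.coeff_mk n a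

lemma coeff_mul (n : ℕ) (a b : AbsSeries) :
    coeff n (a * b) =
      ∑ kl ∈ Finset.HasAntidiagonal.antidiagonal n, coeff kl.1 a * coeff kl.2 b :=
  PowerSeries.coeff_mul n a.1 b.1

lemma coeff_one (n : ℕ) : coeff n (1 : AbsSeries) = if n = 0 then 1 else 0 :=
  PowerSeries.coeff_one n

lemma coeff_algebraMap (c : ℂ) (n : ℕ) :
    coeff n (algebraMap ℂ AbsSeries c) = if n = 0 then c else 0 := by
  rw [Algebra.algebraMap_eq_smul_one, map_smul, coeff_one]; simp

/-- The value of the sum of the series at `z`. -/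
def eval (z : ℂ) (a : AbsSeries) : ℂ := ∑' n, coeff n a * z ^ n

lemma norm_term_le (a : AbsSeries) {z : ℂ} (hz : ‖z‖ ≤ 1) (n : ℕ) :
    ‖coeff n a * z ^ n‖ ≤ ‖coeff n a‖ := by
  rw [norm_mul, norm_pow]
  exact mul_le_of_le_one_right (norm_nonneg _) (pow_le_one₀ (norm_nonneg _) hz)

lemma summable_norm_term (a : AbsSeries) {z : ℂ} (hz : ‖z‖ ≤ 1) :
    Summable fun n => ‖coeff n a * z ^ n‖ :=
  a.summable_coeff.of_nonneg_of_le (fun _ => norm_nonneg _) (a.norm_term_le hz)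

lemma norm_eval_le (a : AbsSeries) {z : ℂ} (hz : ‖z‖ ≤ 1) : ‖eval z a‖ ≤ ‖a‖ := by
  rw [norm_eq_tsum]
  exact (norm_tsum_le_tsum_norm (a.summable_norm_term hz)).trans
    (Summable.tsum_le_tsum (a.norm_term_le hz) (a.summable_norm_term hz) a.summable_coeff)

/-- Every term beyond the first contains a factor z. With z = exp (−μ x) / ρ this is the source of
the decay rate exp (−μ Re x) towards the endstate. -/
lemma norm_tsum_mul_pow_sub_le {b : ℕ → ℂ} (hb : Summable fun n => ‖b n‖) {z : ℂ} (hz : ‖z‖ ≤ 1) :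
    ‖∑' n, b n * z ^ n - b 0‖ ≤ ‖z‖ * ∑' n, ‖b n‖ := by
  have hle : ∀ n, ‖b (n + 1) * z ^ (n + 1)‖ ≤ ‖z‖ * ‖b (n + 1)‖ := fun n => by
    rw [norm_mul, norm_pow, pow_succ', mul_comm, mul_assoc]
    exact mul_le_mul_of_nonneg_left (mul_le_of_le_one_left (norm_nonneg _)
      (pow_le_one₀ (norm_nonneg _) hz)) (norm_nonneg _)
  have hb1 : Summable fun n => ‖z‖ * ‖b (n + 1)‖ :=
    ((summable_nat_add_iff (f := fun n => ‖b n‖) 1).2 hb).mul_left _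
  have hs1 : Summable fun n => ‖b (n + 1) * z ^ (n + 1)‖ :=
    hb1.of_nonneg_of_le (fun _ => norm_nonneg _) hle
  have hs : Summable fun n => b n * z ^ n :=
    (summable_nat_add_iff (f := fun n => b n * z ^ n) 1).1 hs1.of_norm
  rw [hs.tsum_eq_zero_add, pow_zero, mul_one, add_sub_cancel_left, hb.tsum_eq_zero_add, mul_add,
    ← tsum_mul_left]
  refine (norm_tsum_le_tsum_norm hs1).trans ((Summable.tsum_le_tsum hle hs1 hb1).trans ?_)
  exact le_add_of_nonneg_left (by positivity)

lemma norm_eval_sub_coeff_zero_le (a : AbsSeries) {z : ℂ} (hz : ‖z‖ ≤ 1) :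
    ‖eval z a - coeff 0 a‖ ≤ ‖z‖ * ‖a‖ := by
  rw [norm_eq_tsum]
  exact norm_tsum_mul_pow_sub_le a.summable_coeff hz

/-- Evaluation at a point of the closed unit disc, as an algebra homomorphism. -/
def evalHom (z : ℂ) (hz : ‖z‖ ≤ 1) : AbsSeries →ₐ[ℂ] ℂ where
  toFun := eval z
  map_one' := by
    rw [eval, tsum_eq_single 0]
    · simp [coeff_one]
    · intro n hn; simp [coeff_one, hn]
  map_mul' a b := by
    have := tsum_mul_tsum_eq_tsum_sum_antidiagonal_of_summable_norm
      (a.summable_norm_term hz) (b.summable_norm_term hz)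
    rw [eval, eval, eval, this]
    congr 1; ext n
    rw [coeff_mul, Finset.sum_mul]
    refine Finset.sum_congr rfl fun kl hkl => ?_
    rw [← Finset.HasAntidiagonal.mem_antidiagonal.1 hkl, pow_add]; ring
  map_zero' := by simp [eval]
  map_add' a b := by
    rw [eval, eval, eval, ← (a.summable_norm_term hz).of_norm.tsum_add
      (b.summable_norm_term hz).of_norm]
    simp [add_mul]
  commutes' c := by
    rw [eval, tsum_eq_single 0]
    · simp [coeff_algebraMap]
    · intro n hn; simp [coeff_algebraMap, hn]

/-- Evaluation at z is itself the power series ∑ zⁿ `coeff n` with values in the dual, whose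
coefficients have norm at most 1. It is holomorphic on the open disc by the Weierstrass theorem, and
pairing it with the series gives joint analyticity. -/
lemma analyticAt_eval {z : ℂ} (hz : ‖z‖ < 1) (a : AbsSeries) :
    AnalyticAt ℂ (fun q : ℂ × AbsSeries => eval q.1 q.2) (z, a) := by
  have hc : ∀ n, ‖coeff n‖ ≤ 1 := fun n => LinearMap.mkContinuous_norm_le _ zero_le_one _
  let T : ℂ → AbsSeries →L[ℂ] ℂ := fun z => ∑' n, z ^ n • coeff n
  have hd : DifferentiableOn ℂ T (Metric.ball 0 1) := by
    intro w hw
    obtain ⟨r, hr1, hr2⟩ := exists_between (mem_ball_zero_iff.1 hw)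
    have : DifferentiableOn ℂ T (Metric.ball 0 r) := by
      refine Complex.differentiableOn_tsum_of_summable_norm (u := fun n : ℕ => r ^ n)
        (summable_geometric_of_lt_one ((norm_nonneg w).trans hr1.le) hr2)
        (fun n => ((differentiable_pow n).smul_const (coeff n)).differentiableOn) Metric.isOpen_ball ?_
      intro n y hy
      rw [norm_smul, norm_pow]
      have h1 : ‖y‖ ^ n ≤ r ^ n :=
        pow_le_pow_left₀ (norm_nonneg _) (mem_ball_zero_iff.1 hy).le n
      calc ‖y‖ ^ n * ‖coeff n‖ ≤ ‖y‖ ^ n * 1 := by gcongr; exact hc n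
        _ ≤ r ^ n := by rw [mul_one]; exact h1
    exact (this.differentiableAt (Metric.isOpen_ball.mem_nhds
      (mem_ball_zero_iff.2 hr1))).differentiableWithinAt
  have hT : ∀ w : ℂ, ‖w‖ < 1 → ∀ b, T w b = eval w b := by
    intro w hw b
    have hs : Summable fun n => w ^ n • coeff n := by
      refine Summable.of_norm_bounded (summable_geometric_of_lt_one (norm_nonneg w) hw) fun n => ?_
      rw [norm_smul, norm_pow]
      exact mul_le_of_le_one_right (by positivity) (hc n)
    have := hs.hasSum.mapL (ContinuousLinearMap.apply ℂ ℂ b)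
    simp only [ContinuousLinearMap.apply_apply, smul_apply, smul_eq_mul] at this
    rw [eval, ← this.tsum_eq]
    simp [mul_comm]
  have hTa : AnalyticAt ℂ T z :=
    hd.analyticAt (Metric.isOpen_ball.mem_nhds (mem_ball_zero_iff.2 hz))
  have hTq : AnalyticAt ℂ (fun q : ℂ × AbsSeries => T q.1) (z, a) :=
    AnalyticAt.comp (g := T) (f := Prod.fst) hTa analyticAt_fst
  have h1 : AnalyticAt ℂ (fun q : ℂ × AbsSeries => T q.1 q.2) (z, a) :=
    analyticAt_clm_apply hTq analyticAt_snd
  refine h1.congr ?_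
  have : ∀ᶠ q : ℂ × AbsSeries in 𝓝 (z, a), ‖q.1‖ < 1 :=
    (continuous_fst.norm.tendsto (z, a)).eventually_lt_const hz
  filter_upwards [this] with q hq using hT _ hq _

end AbsSeries

/-! ### Analytic dependence of fixed points and of inverse operators -/

section FixedPoint

variable {P Y : Type*} [NormedAddCommGroup P] [NormedSpace ℂ P] [CompleteSpace P]
  [NormedAddCommGroup Y] [NormedSpace ℂ Y] [CompleteSpace Y]

/-- A family of uniform contractions that depends analytically on parameters has a bounded fixed
point that depends analytically on the parameters. -/
theorem exists_analyticOnNhd_fixedPoint (G : P × Y → Y) {U : Set P} (hU : IsOpen U) {R : ℝ}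
    (hR : 0 < R) (hG : ∀ p ∈ U, ∀ y, AnalyticAt ℂ G (p, y))
    (hlip : ∀ p ∈ U, ∀ y y', ‖y‖ ≤ R → ‖y'‖ ≤ R → ‖G (p, y) - G (p, y')‖ ≤ 1 / 2 * ‖y - y'‖)
    (h0 : ∀ p ∈ U, ‖G (p, 0)‖ ≤ R / 4) :
    ∃ y : P → Y, AnalyticOnNhd ℂ y U ∧ ∀ p ∈ U, G (p, y p) = y p ∧ ‖y p‖ ≤ R / 2 := by
  have hex : ∀ p ∈ U, ∃ y, G (p, y) = y ∧ ‖y‖ ≤ R / 2 := by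
    intro p hp
    -- The ball of radius R/2 is preserved since R/4 + (1/2)(R/2) = R/2. The Lipschitz bound holds
    -- on the larger radius R, so fixed points are interior and can be compared with nearby ones.
    have hmaps : Set.MapsTo (fun y => G (p, y)) (Metric.closedBall 0 (R / 2))
        (Metric.closedBall 0 (R / 2)) := by
      intro y hy
      rw [mem_closedBall_zero_iff] at hy ⊢
      have h1 := hlip p hp y 0 (hy.trans (by linarith)) (by simpa using hR.le)
      rw [sub_zero] at h1
      have h2 := norm_le_norm_add_norm_sub' (G (p, y)) (G (p, 0))
      linarith [h0 p hp]
    have hcon : ContractingWith (1 / 2) (hmaps.restrict _ _ _) := by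
      refine ⟨by norm_num, LipschitzWith.of_dist_le_mul fun a b => ?_⟩
      have ha := mem_closedBall_zero_iff.1 a.2
      have hb := mem_closedBall_zero_iff.1 b.2
      have := hlip p hp a b (by linarith) (by linarith)
      simpa [Subtype.dist_eq, dist_eq_norm] using this
    obtain ⟨y, hy, hfix, -⟩ := hcon.exists_fixedPoint'
      Metric.isClosed_closedBall.isComplete hmaps (x := 0) (by simp; linarith) (edist_ne_top _ _)
    exact ⟨y, hfix, mem_closedBall_zero_iff.1 hy⟩
  choose! y hfix hbd using hex
  refine ⟨y, fun p hp => ?_, fun p hp => ⟨hfix p hp, hbd p hp⟩⟩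
  have hlt : ‖y p‖ < R := (hbd p hp).trans_lt (by linarith)
  set f : P × Y → Y := fun q => q.2 - G q with hf
  have hfa : AnalyticAt ℂ f (p, y p) := analyticAt_snd.sub (hG p hp _)
  have hder : fderiv ℂ f (p, y p) ∘L .inr ℂ P Y =
      1 - fderiv ℂ G (p, y p) ∘L .inr ℂ P Y := by
    rw [hf, fderiv_fun_sub differentiableAt_snd (hG p hp _).differentiableAt, fderiv_snd,
      ContinuousLinearMap.sub_comp]
    congr 1
  have hGy : HasFDerivAt (fun z => G (p, z)) (fderiv ℂ G (p, y p) ∘L .inr ℂ P Y) (y p) :=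
    (hG p hp _).differentiableAt.hasFDerivAt.comp (y p) (hasFDerivAt_prodMk_right p (y p))
  -- The derivative of a 1/2-contraction has norm at most 1/2, so 1 − ∂G/∂y is invertible by a
  -- Neumann series and the implicit function theorem applies to y − G.
  have hnorm : ‖fderiv ℂ G (p, y p) ∘L .inr ℂ P Y‖ ≤ 1 / 2 := by
    refine hGy.le_of_lip' (by norm_num) ?_
    filter_upwards [(continuous_norm.tendsto (y p)).eventually_lt_const hlt] with z hz
    exact hlip p hp z (y p) hz.le hlt.le
  have hinv : (fderiv ℂ f (p, y p) ∘L .inr ℂ P Y).IsInvertible := by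
    rw [hder]
    have hu : IsUnit (1 - fderiv ℂ G (p, y p) ∘L .inr ℂ P Y) :=
      isUnit_one_sub_of_norm_lt_one (hnorm.trans_lt (by norm_num))
    obtain ⟨w, hw⟩ := hu
    exact ContinuousLinearMap.IsInvertible.of_inverse (g := (↑w⁻¹ : Y →L[ℂ] Y))
      (by rw [← hw]; exact w.mul_inv) (by rw [← hw]; exact w.inv_mul)
  have hc : ContDiffAt ℂ ⊤ f (p, y p) := hfa.contDiffAt
  have hne : (⊤ : WithTop ℕ∞) ≠ 0 := by simp
  have hψ : AnalyticAt ℂ (hc.implicitFunction hne hinv) p :=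
    (hc.contDiffAt_implicitFunction hne hinv).analyticAt
  have hψ0 := hc.implicitFunction_apply_self hne hinv
  have hψe := hc.eventually_apply_implicitFunction hne hinv
  refine hψ.congr ?_
  have hlt' : ∀ᶠ q in 𝓝 p, ‖hc.implicitFunction hne hinv q‖ < R :=
    hψ.continuousAt.norm.eventually_lt_const (by simpa [hψ0] using hlt)
  filter_upwards [hψe, hlt', hU.mem_nhds hp] with q hq hqR hqU
  have h1 : G (q, hc.implicitFunction hne hinv q) = hc.implicitFunction hne hinv q := by
    have : f (p, y p) = 0 := by simp [hf, hfix p hp]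
    rw [this] at hq
    exact (sub_eq_zero.1 hq).symm
  -- The implicit function and the chosen fixed point are both fixed by the same 1/2-contraction on
  -- the R-ball: their distance is at most half of itself.
  have h2 := hlip q hqU _ (y q) hqR.le ((hbd q hqU).trans (by linarith))
  rw [h1, hfix q hqU] at h2
  exact sub_eq_zero.1 (norm_le_zero_iff.1 (by linarith [norm_nonneg (hc.implicitFunction hne hinv q - y q)]))

end FixedPoint

/-- The model is T = (l + h N)⁻¹ with N unbounded, R = T p and S = N T p. The resolvent identity
says T q (1 + (l q − l p) R + (h q − h p) S) = R, and the factor in brackets is an analytic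
perturbation of the identity by bounded operators, hence invertible near p. -/
lemma analyticAt_of_resolvent {P E : Type*} [NormedAddCommGroup P] [NormedSpace ℂ P]
    [NormedAddCommGroup E] [NormedSpace ℂ E] [CompleteSpace E] {T : P → E →L[ℂ] E} (R S : E →L[ℂ] E)
    {U : Set P} (hU : IsOpen U) {l h : P → ℂ} {p : P} (hp : p ∈ U) (hl : AnalyticAt ℂ l p)
    (hh : AnalyticAt ℂ h p)
    (hT : ∀ q ∈ U, ∀ a, T q (a + (l q - l p) • R a + (h q - h p) • S a) = R a) :
    AnalyticAt ℂ T p := by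
  set A : P → E →L[ℂ] E := fun q => 1 + (l q - l p) • R + (h q - h p) • S with hA
  have hAa : AnalyticAt ℂ A p :=
    (analyticAt_const.add ((hl.sub analyticAt_const).smul analyticAt_const)).add
      ((hh.sub analyticAt_const).smul analyticAt_const)
  have hAp : A p = 1 := by simp [hA]
  have hev : ∀ᶠ q in 𝓝 p, IsUnit (A q) :=
    hAa.continuousAt.eventually (Units.isOpen.mem_nhds (x := A p) (by
      rw [Set.mem_ofPred_eq, hAp]; exact isUnit_one))
  have hR : AnalyticAt ℂ (fun q => R * Ring.inverse (A q)) p := by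
    refine analyticAt_const.mul (AnalyticAt.comp (g := Ring.inverse) ?_ hAa)
    rw [hAp]
    exact analyticAt_inverse (1 : (E →L[ℂ] E)ˣ)
  refine hR.congr ?_
  filter_upwards [hev, hU.mem_nhds hp] with q hq hqU
  have : T q * A q = R := by
    ext a
    rw [← hT q hqU a]
    rfl
  rw [← this, mul_assoc, Ring.mul_inverse_cancel _ hq, mul_one]

namespace AbsSeries

/-- The multiplier operator with a bounded symbol (and `0` if the symbol is unbounded). -/
def diag (t : ℕ → ℂ) : AbsSeries →L[ℂ] AbsSeries :=
  open scoped Classical in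
  if h : ∃ C, ∀ n, ‖t n‖ ≤ C then
    LinearMap.mkContinuous
      { toFun := fun a => ofSummable (fun n => t n * coeff n a)
          ((a.summable_coeff.mul_left h.choose).of_nonneg_of_le (fun _ => norm_nonneg _) fun n => by
            rw [norm_mul]
            exact mul_le_mul_of_nonneg_right (h.choose_spec n) (norm_nonneg _))
        map_add' := fun a b => by ext n; simp [mul_add]
        map_smul' := fun c a => by ext n; simp [mul_left_comm] } h.choose fun a => by
      rw [norm_eq_tsum, norm_eq_tsum a, ← tsum_mul_left]
      refine Summable.tsum_le_tsum (fun n => ?_) (summable_coeff _) (a.summable_coeff.mul_left _)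
      simp only [LinearMap.coe_mk, AddHom.coe_mk, coeff_ofSummable, norm_mul]
      exact mul_le_mul_of_nonneg_right (h.choose_spec n) (norm_nonneg _)
  else 0

lemma coeff_diag {t : ℕ → ℂ} {C : ℝ} (h : ∀ n, ‖t n‖ ≤ C) (n : ℕ) (a : AbsSeries) :
    coeff n (diag t a) = t n * coeff n a := by
  rw [diag, dif_pos ⟨C, h⟩]
  exact coeff_ofSummable (fun n => t n * coeff n a)
    ((a.summable_coeff.mul_left C).of_nonneg_of_le (fun _ => norm_nonneg _) fun n => by
      rw [norm_mul]
      exact mul_le_mul_of_nonneg_right (h n) (norm_nonneg _)) n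

lemma norm_diag_apply_le {t : ℕ → ℂ} {C : ℝ} (h : ∀ n, ‖t n‖ ≤ C) (a : AbsSeries) :
    ‖diag t a‖ ≤ C * ‖a‖ := by
  rw [norm_eq_tsum, norm_eq_tsum a, ← tsum_mul_left]
  refine Summable.tsum_le_tsum (fun n => ?_) (summable_coeff _) (a.summable_coeff.mul_left _)
  rw [coeff_diag h, norm_mul]
  exact mul_le_mul_of_nonneg_right (h n) (norm_nonneg _)

/-- The operators `(l + ν n h)⁻¹` depend analytically on parameters. -/
lemma analyticAt_diag_inv {P : Type*} [NormedAddCommGroup P] [NormedSpace ℂ P] {U : Set P}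
    (hU : IsOpen U) {l h : P → ℂ} {ν : ℂ} {c : ℝ} (hc : 0 < c)
    (hbd : ∀ p ∈ U, ∀ k : ℕ, c ≤ ‖l p + ν * k * h p‖) (hh : ∀ p ∈ U, h p ≠ 0)
    (hl : AnalyticOnNhd ℂ l U) (hha : AnalyticOnNhd ℂ h U) {p : P} (hp : p ∈ U) :
    AnalyticAt ℂ (fun q => diag fun k => (l q + ν * k * h q)⁻¹) p := by
  have hne : ∀ q ∈ U, ∀ k : ℕ, l q + ν * k * h q ≠ 0 := fun q hq k h0 => by
    have := hbd q hq k
    rw [h0, norm_zero] at this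
    linarith
  have hinv : ∀ q ∈ U, ∀ k : ℕ, ‖(l q + ν * k * h q)⁻¹‖ ≤ c⁻¹ := fun q hq k => by
    rw [norm_inv]; exact inv_anti₀ hc (hbd q hq k)
  set r : ℕ → ℂ := fun k => (l p + ν * k * h p)⁻¹ with hr
  set s : ℕ → ℂ := fun k => ν * k * (l p + ν * k * h p)⁻¹ with hs
  -- The symbol ν k (l + ν k h)⁻¹ is bounded only after division by h. The bound degenerates as h →
  -- 0, which is harmless: it serves analyticity at a fixed p with h p ≠ 0 and enters no uniform
  -- estimate.
  have hsb : ∀ k, ‖s k‖ ≤ ‖(h p)⁻¹‖ * (1 + ‖l p‖ * c⁻¹) := fun k => by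
    have : s k = (h p)⁻¹ * (1 - l p * (l p + ν * k * h p)⁻¹) := by
      have h1 := hne p hp k
      have h2 := hh p hp
      simp only [hs]
      field_simp
      ring
    rw [this, norm_mul]
    refine mul_le_mul_of_nonneg_left ((norm_sub_le _ _).trans ?_) (norm_nonneg _)
    rw [norm_one, norm_mul]
    gcongr
    exact hinv p hp k
  refine analyticAt_of_resolvent (diag r) (diag s) hU hp (hl p hp) (hha p hp) fun q hq a => ?_
  ext n
  have h1 := hne p hp n
  have h2 := hne q hq n
  rw [coeff_diag (hinv q hq), coeff_diag (hinv p hp), map_add, map_add, map_smul, map_smul,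
    coeff_diag (hinv p hp), coeff_diag hsb]
  simp only [hs, smul_eq_mul]
  field_simp
  ring

end AbsSeries

/-! ### Riccati equations in the algebra of power series -/

lemma norm_matrix_mul_apply_le {R : Type*} [NormedRing R] {l m n : Type*} [Fintype m]
    {A : Matrix l m R} {B : Matrix m n R} {a b : ℝ} (ha : 0 ≤ a) (hA : ∀ i j, ‖A i j‖ ≤ a)
    (hB : ∀ i j, ‖B i j‖ ≤ b) (i : l) (j : n) : ‖(A * B) i j‖ ≤ Fintype.card m * (a * b) := by
  rw [Matrix.mul_apply]
  refine (norm_sum_le _ _).trans ((Finset.sum_le_sum (g := fun _ => a * b) fun k _ => ?_).trans_eq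
    (by simp))
  exact (norm_mul_le _ _).trans (mul_le_mul (hA i k) (hB k j) (norm_nonneg _) ha)

section Riccati

variable {P : Type*} [NormedAddCommGroup P] [NormedSpace ℂ P]

lemma analyticAt_matrix_mul {R : Type*} [NormedRing R] [NormedAlgebra ℂ R] {l m n : Type*}
    [Fintype m] {A : P → Matrix l m R} {B : P → Matrix m n R} {p : P}
    (hA : ∀ i j, AnalyticAt ℂ (fun q => A q i j) p) (hB : ∀ i j, AnalyticAt ℂ (fun q => B q i j) p)
    (i : l) (j : n) : AnalyticAt ℂ (fun q => (A q * B q) i j) p := by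
  simp only [Matrix.mul_apply]
  exact Finset.analyticAt_fun_sum _ fun k _ => (hA i k).mul (hB k j)

variable [CompleteSpace P]

/-- Solvability of singular Riccati equations in the algebra of absolutely convergent power series:
`(l + ν k h) αₖ = (P α + α Q + f + α S α)ₖ` for all `k`. -/
theorem exists_riccati {m n : Type*} [Fintype m] [Fintype n] {U : Set P} (hU : IsOpen U)
    {l h : P → ℂ} {ν : ℂ} {c : ℝ} (hc : 0 < c)
    (hbd : ∀ p ∈ U, ∀ k : ℕ, c ≤ ‖l p + ν * k * h p‖) (hh : ∀ p ∈ U, h p ≠ 0)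
    (hl : AnalyticOnNhd ℂ l U) (hha : AnalyticOnNhd ℂ h U)
    {A : P → Matrix m m AbsSeries} {Q : P → Matrix n n AbsSeries} {f : P → Matrix m n AbsSeries}
    {S : P → Matrix n m AbsSeries}
    (hA : ∀ p ∈ U, ∀ i j, AnalyticAt ℂ (fun q => A q i j) p)
    (hQ : ∀ p ∈ U, ∀ i j, AnalyticAt ℂ (fun q => Q q i j) p)
    (hf : ∀ p ∈ U, ∀ i j, AnalyticAt ℂ (fun q => f q i j) p)
    (hS : ∀ p ∈ U, ∀ i j, AnalyticAt ℂ (fun q => S q i j) p)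
    {ε δ R : ℝ} (hε : 0 ≤ ε) (hδ : 0 ≤ δ) (hR : 0 < R)
    (hAb : ∀ p ∈ U, ∀ i j, ‖A p i j‖ ≤ ε) (hQb : ∀ p ∈ U, ∀ i j, ‖Q p i j‖ ≤ ε)
    (hSb : ∀ p ∈ U, ∀ i j, ‖S p i j‖ ≤ δ) (hfb : ∀ p ∈ U, ∀ i j, ‖f p i j‖ ≤ c * R / 4)
    (hsmall : (Fintype.card m + Fintype.card n) * ε
      + 2 * (Fintype.card m * Fintype.card n * R * δ) ≤ c / 2) :
    ∃ α : P → Matrix m n AbsSeries, (∀ p ∈ U, ∀ i j, AnalyticAt ℂ (fun q => α q i j) p) ∧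
      ∀ p ∈ U, (∀ i j, ‖α p i j‖ ≤ R / 2) ∧ ∀ i j, ∀ k : ℕ,
        (l p + ν * k * h p) * AbsSeries.coeff k (α p i j) =
          AbsSeries.coeff k ((A p * α p + α p * Q p + f p + α p * S p * α p) i j) := by
  have hne : ∀ q ∈ U, ∀ k : ℕ, l q + ν * k * h q ≠ 0 := fun q hq k h0 => by
    have := hbd q hq k
    rw [h0, norm_zero] at this
    linarith
  have hinv : ∀ q ∈ U, ∀ k : ℕ, ‖(l q + ν * k * h q)⁻¹‖ ≤ c⁻¹ := fun q hq k => by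
    rw [norm_inv]; exact inv_anti₀ hc (hbd q hq k)
  let F : P → (m → n → AbsSeries) → Matrix m n AbsSeries := fun p y =>
    A p * Matrix.of y + Matrix.of y * Q p + f p + Matrix.of y * S p * Matrix.of y
  let T : P → AbsSeries →L[ℂ] AbsSeries := fun p =>
    AbsSeries.diag fun k => (l p + ν * k * h p)⁻¹
  let G : P × (m → n → AbsSeries) → m → n → AbsSeries := fun q i j => T q.1 (F q.1 q.2 i j)
  have hent : ∀ (y : m → n → AbsSeries) i j, ‖y i j‖ ≤ ‖y‖ := fun y i j =>
    (norm_le_pi_norm (y i) j).trans (norm_le_pi_norm y i)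
  have hT : ∀ p ∈ U, ∀ a, ‖T p a‖ ≤ c⁻¹ * ‖a‖ := fun p hp a =>
    AbsSeries.norm_diag_apply_le (hinv p hp) a
  have hTa : ∀ p ∈ U, AnalyticAt ℂ T p := fun p hp =>
    AbsSeries.analyticAt_diag_inv hU hc hbd hh hl hha hp
  have hGa : ∀ p ∈ U, ∀ y, AnalyticAt ℂ G (p, y) := by
    intro p hp y
    refine analyticAt_pi_iff.2 fun i => analyticAt_pi_iff.2 fun j => ?_
    have hfst : ∀ {β : P → AbsSeries}, AnalyticAt ℂ β p →
        AnalyticAt ℂ (fun q : P × (m → n → AbsSeries) => β q.1) (p, y) := fun hβ =>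
      AnalyticAt.comp (f := Prod.fst) hβ analyticAt_fst
    have hy : ∀ i j, AnalyticAt ℂ
        (fun q : P × (m → n → AbsSeries) => (Matrix.of q.2 : Matrix m n AbsSeries) i j) (p, y) :=
      fun i j => by
        have := (analyticAt_snd (𝕜 := ℂ) (p := (p, y)))
        exact analyticAt_pi_iff.1 (analyticAt_pi_iff.1 this i) j
    have hF : AnalyticAt ℂ (fun q : P × (m → n → AbsSeries) => F q.1 q.2 i j) (p, y) := by
      refine (((analyticAt_matrix_mul (fun i j => hfst (hA p hp i j)) hy i j).add
        (analyticAt_matrix_mul hy (fun i j => hfst (hQ p hp i j)) i j)).add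
        (hfst (hf p hp i j))).add ?_
      exact analyticAt_matrix_mul (analyticAt_matrix_mul hy fun i j => hfst (hS p hp i j)) hy i j
    have hTq : AnalyticAt ℂ (fun q : P × (m → n → AbsSeries) => T q.1) (p, y) :=
      AnalyticAt.comp (g := T) (f := Prod.fst) (hTa p hp) analyticAt_fst
    exact analyticAt_clm_apply hTq hF
  have hGl : ∀ p ∈ U, ∀ y y', ‖y‖ ≤ R → ‖y'‖ ≤ R →
      ‖G (p, y) - G (p, y')‖ ≤ 1 / 2 * ‖y - y'‖ := by
    intro p hp y y' hy hy'
    have hD : F p y - F p y' = A p * Matrix.of (y - y') + Matrix.of (y - y') * Q p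
        + (Matrix.of (y - y') * S p * Matrix.of y + Matrix.of y' * S p * Matrix.of (y - y')) := by
      have : (Matrix.of (y - y') : Matrix m n AbsSeries) = Matrix.of y - Matrix.of y' := rfl
      simp only [F, this, Matrix.mul_sub, Matrix.sub_mul]
      abel
    have hb : ∀ i j, ‖(F p y - F p y') i j‖ ≤ c / 2 * ‖y - y'‖ := by
      intro i j
      have e1 := norm_matrix_mul_apply_le hε (hAb p hp) (B := Matrix.of (y - y')) (hent (y - y')) i j
      have e2 := norm_matrix_mul_apply_le (norm_nonneg _) (A := Matrix.of (y - y'))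
        (hent (y - y')) (hQb p hp) i j
      have e3 := norm_matrix_mul_apply_le (by positivity) (norm_matrix_mul_apply_le (norm_nonneg _)
        (A := Matrix.of (y - y')) (hent (y - y')) (hSb p hp)) (B := Matrix.of y)
        (fun i j => (hent y i j).trans hy) i j
      have e4 := norm_matrix_mul_apply_le (by positivity) (norm_matrix_mul_apply_le hR.le
        (A := Matrix.of y') (fun i j => (hent y' i j).trans hy') (hSb p hp))
        (B := Matrix.of (y - y')) (hent (y - y')) i j
      rw [hD]
      have := (norm_add₃_le (a := (A p * Matrix.of (y - y')) i j)
        (b := (Matrix.of (y - y') * Q p) i j)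
        (c := (Matrix.of (y - y') * S p * Matrix.of y + Matrix.of y' * S p * Matrix.of (y - y')) i j)).trans
        (add_le_add_right (norm_add_le _ _) _)
      refine this.trans ?_
      have := mul_le_mul_of_nonneg_right hsmall (norm_nonneg (y - y'))
      nlinarith
    refine (pi_norm_le_iff_of_nonneg (by positivity)).2 fun i =>
      (pi_norm_le_iff_of_nonneg (by positivity)).2 fun j => ?_
    have : (G (p, y) - G (p, y')) i j = T p ((F p y - F p y') i j) := by
      simp [G, Matrix.sub_apply]
    rw [this]
    refine (hT p hp _).trans ?_
    calc c⁻¹ * ‖(F p y - F p y') i j‖ ≤ c⁻¹ * (c / 2 * ‖y - y'‖) := by gcongr; exact hb i j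
      _ = 1 / 2 * ‖y - y'‖ := by field_simp
  have hG0 : ∀ p ∈ U, ‖G (p, 0)‖ ≤ R / 4 := by
    intro p hp
    refine (pi_norm_le_iff_of_nonneg (by positivity)).2 fun i =>
      (pi_norm_le_iff_of_nonneg (by positivity)).2 fun j => ?_
    have : G (p, 0) i j = T p (f p i j) := by
      have h0 : (Matrix.of (0 : m → n → AbsSeries) : Matrix m n AbsSeries) = 0 := rfl
      simp only [G, F, h0, Matrix.mul_zero, Matrix.zero_mul, zero_add, add_zero]
    rw [this]
    refine (hT p hp _).trans ?_
    calc c⁻¹ * ‖f p i j‖ ≤ c⁻¹ * (c * R / 4) := by gcongr; exact hfb p hp i j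
      _ = R / 4 := by field_simp
  obtain ⟨α, hα, hα'⟩ := exists_analyticOnNhd_fixedPoint G hU hR hGa hGl hG0
  · refine ⟨fun p => Matrix.of (α p), fun p hp i j => ?_, fun p hp => ⟨fun i j => ?_, fun i j k => ?_⟩⟩
    · exact (analyticAt_pi_iff.1 (analyticAt_pi_iff.1 (hα p hp) i) j)
    · exact (hent _ i j).trans (hα' p hp).2
    · have h1 : α p i j = T p (F p (α p) i j) := (congrFun (congrFun (hα' p hp).1 i) j).symm
      have h2 := congrArg (AbsSeries.coeff k) h1
      rw [AbsSeries.coeff_diag (hinv p hp)] at h2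
      change (l p + ν * k * h p) * AbsSeries.coeff k (α p i j) = AbsSeries.coeff k (F p (α p) i j)
      rw [h2, mul_inv_cancel_left₀ (hne p hp k)]

end Riccati

/-! ### Superposition operators on spaces of continuous functions -/

section Nemytskii

variable {K E F : Type*} [TopologicalSpace K] [CompactSpace K] [NormedAddCommGroup E]
  [NormedSpace ℝ E] [NormedAddCommGroup F] [NormedSpace ℝ F]

/-- The multilinear map induced pointwise on continuous functions. -/
def pointwiseMultilinear {n : ℕ} (p : E [×n]→L[ℝ] F) : C(K, E) [×n]→L[ℝ] C(K, F) :=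
  MultilinearMap.mkContinuous
    { toFun := fun m => ⟨fun t => p fun i => m i t,
        p.cont.comp (continuous_pi fun i => (m i).continuous)⟩
      map_update_add' := fun {_} m i x y => by
        ext t
        have : ∀ z : C(K, E), (fun j => Function.update m i z j t) =
            Function.update (fun j => m j t) i (z t) := fun z => by
          funext j
          by_cases h : j = i
          · subst h; simp
          · simp [h]
        simp only [ContinuousMap.coe_mk, ContinuousMap.add_apply, this]
        exact p.map_update_add _ _ _ _
      map_update_smul' := fun {_} m i c x => by
        ext t
        have : ∀ z : C(K, E), (fun j => Function.update m i z j t) =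
            Function.update (fun j => m j t) i (z t) := fun z => by
          funext j
          by_cases h : j = i
          · subst h; simp
          · simp [h]
        simp only [ContinuousMap.coe_mk, ContinuousMap.smul_apply, this]
        exact p.map_update_smul _ _ _ _ } ‖p‖ fun m => by
    refine (ContinuousMap.norm_le _ (by positivity)).2 fun t => (p.le_opNorm _).trans ?_
    refine mul_le_mul_of_nonneg_left ?_ (norm_nonneg _)
    exact Finset.prod_le_prod (fun _ _ => norm_nonneg _) fun i _ => (m i).norm_coe_le_norm t

lemma norm_pointwiseMultilinear_le {n : ℕ} (p : E [×n]→L[ℝ] F) :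
    ‖(pointwiseMultilinear p : C(K, E) [×n]→L[ℝ] C(K, F))‖ ≤ ‖p‖ :=
  MultilinearMap.mkContinuous_norm_le _ (norm_nonneg _) _

/-- Superposition with an analytic function is analytic on spaces of continuous functions. -/
lemma exists_analyticAt_superposition [CompleteSpace F] {H : E → F} {y₀ : E}
    (hH : AnalyticAt ℝ H y₀) :
    ∃ N : C(K, E) → C(K, F), AnalyticAt ℝ N (ContinuousMap.const K y₀) ∧
      ∀ᶠ y in 𝓝 (ContinuousMap.const K y₀), ∀ t, N y t = H (y t) := by
  obtain ⟨p, r, hp⟩ := hH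
  -- The Taylor series of `H` acts pointwise on functions. Its terms do not grow in norm, so the
  -- radius of convergence is not smaller than that of `H`.
  let q : FormalMultilinearSeries ℝ C(K, E) C(K, F) := fun n => pointwiseMultilinear (p n)
  have hrad : r ≤ q.radius := hp.r_le.trans
    (FormalMultilinearSeries.radius_le_of_le fun n => norm_pointwiseMultilinear_le (p n))
  have hq := (q.hasFPowerSeriesOnBall (hp.r_pos.trans_le hrad)).mono hp.r_pos hrad
  have hq' := hq.comp_sub (ContinuousMap.const K y₀)
  rw [zero_add] at hq'
  refine ⟨_, hq'.analyticAt, ?_⟩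
  filter_upwards [Metric.eball_mem_nhds _ hp.r_pos] with y hy t
  have hy' : y - ContinuousMap.const K y₀ ∈ Metric.eball (0 : C(K, E)) r := by
    rw [Metric.mem_eball, edist_eq_enorm_sub] at hy ⊢
    simpa using hy
  have h1 := hq.hasSum hy'
  rw [zero_add] at h1
  have h2 := h1.mapL (ContinuousMap.evalCLM ℝ t)
  have hyt : y t - y₀ ∈ Metric.eball (0 : E) r := by
    rw [Metric.mem_eball, edist_zero_right] at hy' ⊢
    refine lt_of_le_of_lt ?_ hy'
    rw [enorm_le_iff_norm_le]
    exact (y - ContinuousMap.const K y₀).norm_coe_le_norm t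
  have h3 := hp.hasSum hyt
  rw [add_sub_cancel] at h3
  exact h2.unique h3

end Nemytskii

/-! ### Analytic solutions of analytic differential equations -/

section ODE

variable {E : Type*} [NormedAddCommGroup E] [NormedSpace ℝ E]

/-- Integration from `0` on the unit interval. -/
def volterra : C(unitInterval, E) →L[ℝ] C(unitInterval, E) :=
  LinearMap.mkContinuous
    { toFun := fun f => ⟨fun t => ∫ s in (0 : ℝ)..t, Set.IccExtend zero_le_one f s,
        (intervalIntegral.continuous_primitive
          (fun _ _ => (f.continuous.Icc_extend').intervalIntegrable _ _) 0).comp continuous_subtype_val⟩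
      map_add' := fun f g => by
        ext t
        simp only [ContinuousMap.coe_mk, ContinuousMap.add_apply]
        rw [← intervalIntegral.integral_add (f.continuous.Icc_extend'.intervalIntegrable _ _)
          (g.continuous.Icc_extend'.intervalIntegrable _ _)]
        rfl
      map_smul' := fun c f => by
        ext t
        simp only [ContinuousMap.coe_mk, ContinuousMap.smul_apply, RingHom.id_apply]
        rw [← intervalIntegral.integral_smul]
        rfl } 1 fun f => by
    refine (ContinuousMap.norm_le _ (by positivity)).2 fun t => ?_
    have := intervalIntegral.norm_integral_le_of_norm_le_const (a := (0 : ℝ)) (b := t)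
      (f := Set.IccExtend zero_le_one f) (C := ‖f‖) fun s _ => f.norm_coe_le_norm _
    refine this.trans ?_
    rw [sub_zero, abs_of_nonneg t.2.1, one_mul]
    exact mul_le_of_le_one_right (norm_nonneg _) t.2.2

lemma volterra_apply (f : C(unitInterval, E)) (t : unitInterval) :
    volterra f t = ∫ s in (0 : ℝ)..t, Set.IccExtend zero_le_one f s := rfl

/-- Analytic autonomous differential equations have analytic solutions. -/
theorem exists_analyticAt_hasDerivAt [CompleteSpace E] {H : E → E} {y₀ : E}
    (hH : AnalyticAt ℝ H y₀) :
    ∃ Γ : ℝ → E, AnalyticAt ℝ Γ 0 ∧ Γ 0 = y₀ ∧ ∀ᶠ s in 𝓝 0, HasDerivAt Γ (H (Γ s)) s := by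
  obtain ⟨Γ, hΓ0, ε, hε, hΓ⟩ :=
    (hH.contDiffAt (n := 1)).exists_forall_mem_closedBall_exists_eq_forall_mem_Ioo_hasDerivAt₀ 0
  rw [zero_sub, zero_add] at hΓ
  refine ⟨Γ, ?_, hΓ0, by filter_upwards [Ioo_mem_nhds (neg_lt_zero.2 hε) hε] with s hs using hΓ s hs⟩
  obtain ⟨N, hN, hN'⟩ := exists_analyticAt_superposition (K := unitInterval) hH
  set c : C(unitInterval, E) := ContinuousMap.const _ y₀ with hc
  -- a globally continuous modification of the solution
  set G : ℝ → E := fun s => Γ (max (-(ε / 2)) (min s (ε / 2))) with hG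
  have hclamp : ∀ s, max (-(ε / 2)) (min s (ε / 2)) ∈ Set.Ioo (-ε) ε := fun s =>
    ⟨by linarith [le_max_left (-(ε / 2)) (min s (ε / 2))],
      max_lt (by linarith) ((min_le_right _ _).trans_lt (by linarith))⟩
  have hGc : Continuous G := by
    refine continuous_iff_continuousAt.2 fun s => ?_
    exact ContinuousAt.comp (g := Γ) (hΓ _ (hclamp s)).continuousAt
      (continuous_const.max (continuous_id.min continuous_const)).continuousAt
  have hGeq : ∀ s ∈ Set.Icc (-(ε / 2)) (ε / 2), G s = Γ s := fun s hs => by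
    simp only [hG]; rw [min_eq_left hs.2, max_eq_right hs.1]
  -- With g a t = Γ (a t), the differential equation becomes g a = y₀ + a ∫ H (g a) on the fixed
  -- interval [0, 1]: time has turned into the parameter a. The analytic implicit function theorem
  -- then gives analyticity in a, and evaluation at t = 1 returns Γ a.
  let g : C(ℝ, C(unitInterval, E)) :=
    ContinuousMap.curry ⟨fun q : ℝ × unitInterval => G (q.1 * q.2), by fun_prop⟩
  have hg : ∀ a t, g a t = G (a * t) := fun a t => rfl
  have hg0 : g 0 = c := by
    ext t
    rw [hg, zero_mul, hGeq 0 ⟨by linarith, by linarith⟩, hΓ0]; rfl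
  have hgt : Filter.Tendsto g (𝓝 0) (𝓝 c) := hg0 ▸ g.continuous.tendsto 0
  set f : ℝ × C(unitInterval, E) → C(unitInterval, E) :=
    fun q => q.2 - q.1 • volterra (N q.2) - c with hf
  have hNq : AnalyticAt ℝ (fun q : ℝ × C(unitInterval, E) => N q.2) (0, c) :=
    AnalyticAt.comp (g := N) (f := Prod.snd) hN analyticAt_snd
  have hfa : AnalyticAt ℝ f (0, c) :=
    (analyticAt_snd.sub (analyticAt_fst.smul (analyticAt_clm_apply analyticAt_const hNq))).sub
      analyticAt_const
  -- The integral term carries the factor a and disappears at a = 0.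
  have hder : fderiv ℝ f (0, c) ∘L .inr ℝ ℝ C(unitInterval, E) = .id ℝ _ := by
    have h1 : HasFDerivAt (fun y => f (0, y)) (fderiv ℝ f (0, c) ∘L .inr ℝ ℝ C(unitInterval, E)) c :=
      hfa.differentiableAt.hasFDerivAt.comp c (hasFDerivAt_prodMk_right 0 c)
    have h2 : HasFDerivAt (fun y => f (0, y)) (.id ℝ _) c := by
      simp only [hf, zero_smul, sub_zero]
      exact (hasFDerivAt_id c).sub_const c
    exact h1.unique h2
  have hinv : (fderiv ℝ f (0, c) ∘L .inr ℝ ℝ C(unitInterval, E)).IsInvertible := by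
    rw [hder]; exact ⟨.refl ℝ _, rfl⟩
  have hcd : ContDiffAt ℝ ⊤ f (0, c) := hfa.contDiffAt
  have hne : (⊤ : WithTop ℕ∞) ≠ 0 := by simp
  have hψ : AnalyticAt ℝ (hcd.implicitFunction hne hinv) 0 :=
    (hcd.contDiffAt_implicitFunction hne hinv).analyticAt
  have hiff := hcd.eventually_apply_eq_iff_implicitFunction hne hinv
  -- As g a tends uniformly to the constant y₀, the pairs (a, g a) enter the neighbourhood where the
  -- zeros of f are exactly the graph of the implicit function.
  have hpair : Filter.Tendsto (fun a : ℝ => (a, g a)) (𝓝 0) (𝓝 (0, c)) :=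
    Filter.tendsto_id.prodMk_nhds hgt
  have heq : ∀ᶠ a in 𝓝 (0 : ℝ), hcd.implicitFunction hne hinv a 1 = Γ a := by
    filter_upwards [hpair.eventually hiff, hgt.eventually hN',
      Icc_mem_nhds (show -(ε / 2) < 0 by linarith) (show (0 : ℝ) < ε / 2 by linarith)] with a ha hNa haε
    have hmem : ∀ t ∈ Set.Icc (0 : ℝ) 1, a * t ∈ Set.Icc (-(ε / 2)) (ε / 2) := fun t ht => by
      rw [Set.mem_Icc, ← abs_le] at haε ⊢
      rw [abs_mul, abs_of_nonneg ht.1]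
      exact (mul_le_of_le_one_right (abs_nonneg a) ht.2).trans haε
    have h0 : f (0, c) = 0 := by simp [hf]
    have hfga : f (a, g a) = 0 := by
      ext t
      have hint : ∫ s in (0 : ℝ)..t, a • H (Γ (a * s)) = Γ (a * t) - Γ (a * 0) := by
        have hsub : Set.uIcc (0 : ℝ) t ⊆ Set.Icc 0 1 := by
          rw [Set.uIcc_of_le t.2.1]; exact Set.Icc_subset_Icc_right t.2.2
        have hdd : ∀ s ∈ Set.uIcc (0 : ℝ) t, HasDerivAt (fun s => Γ (a * s)) (a • H (Γ (a * s))) s := by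
          intro s hs
          have h1 := hmem s (hsub hs)
          have h2 := hΓ (a * s) ⟨by linarith [h1.1], by linarith [h1.2]⟩
          have h3 : HasDerivAt (fun s : ℝ => a * s) a s := by
            simpa using (hasDerivAt_id s).const_mul a
          exact h2.scomp s h3
        refine intervalIntegral.integral_eq_sub_of_hasDerivAt hdd ?_
        have hcont : Continuous fun s => a • Set.IccExtend zero_le_one (N (g a)) s :=
          ((N (g a)).continuous.Icc_extend').const_smul a
        refine (hcont.intervalIntegrable 0 t).congr ?_
        intro s hs
        have hs' := hsub (Set.uIoc_subset_uIcc hs)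
        simp only [Set.IccExtend_of_mem zero_le_one _ hs', hNa, hg]
        rw [hGeq _ (hmem s hs')]
      have hv : a • volterra (N (g a)) t = ∫ s in (0 : ℝ)..t, a • H (Γ (a * s)) := by
        rw [volterra_apply, ← intervalIntegral.integral_smul]
        refine intervalIntegral.integral_congr fun s hs => ?_
        have hs' : s ∈ Set.Icc (0 : ℝ) 1 := by
          rw [Set.uIcc_of_le t.2.1] at hs; exact ⟨hs.1, hs.2.trans t.2.2⟩
        simp only [Set.IccExtend_of_mem zero_le_one _ hs', hNa, hg]
        rw [hGeq _ (hmem s hs')]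
      simp only [hf, ContinuousMap.sub_apply, ContinuousMap.smul_apply, ContinuousMap.zero_apply]
      rw [hv, hint, hg, hGeq _ (hmem t t.2), mul_zero, hΓ0]
      simp [hc]
    have h1 := ha.1 (by rw [hfga, h0])
    rw [h1, hg, Set.Icc.coe_one, mul_one, hGeq a haε]
  have hev := analyticAt_clm_apply
    (analyticAt_const (v := ContinuousMap.evalCLM (M := E) ℝ (1 : unitInterval))) hψ
  exact hev.congr heq

end ODE

/-! ### Behaviour at infinity: decay, backward uniqueness and linearization -/

lemma hasDerivAt_fst {E F : Type*} [NormedAddCommGroup E] [NormedSpace ℝ E] [NormedAddCommGroup F]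
    [NormedSpace ℝ F] {f : ℝ → E × F} {f' : E × F} {x : ℝ} (hf : HasDerivAt f f' x) :
    HasDerivAt (fun x => (f x).1) f'.1 x :=
  (ContinuousLinearMap.fst ℝ E F).hasFDerivAt.comp_hasDerivAt x hf

lemma hasDerivAt_snd {E F : Type*} [NormedAddCommGroup E] [NormedSpace ℝ E] [NormedAddCommGroup F]
    [NormedSpace ℝ F] {f : ℝ → E × F} {f' : E × F} {x : ℝ} (hf : HasDerivAt f f' x) :
    HasDerivAt (fun x => (f x).2) f'.2 x :=
  (ContinuousLinearMap.snd ℝ E F).hasFDerivAt.comp_hasDerivAt x hf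

lemma eq_of_hasDerivAt_zero_of_gt {E : Type*} [NormedAddCommGroup E] [NormedSpace ℝ E] {M : ℝ}
    {f : ℝ → E} (hf : ∀ x, M < x → HasDerivAt f 0 x) {x y : ℝ} (hx : M < x) (hy : M < y) :
    f x = f y :=
  (convex_Ioi M).is_const_of_fderivWithin_eq_zero (𝕜 := ℝ)
    (fun z hz => (hf z hz).differentiableAt.differentiableWithinAt)
    (fun z hz => by
      rw [fderivWithin_of_isOpen isOpen_Ioi hz, ← toSpanSingleton_deriv, (hf z hz).deriv]
      simp) hx hy

/-- Exponential decay from a differential inequality. -/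
lemma exists_abs_le_exp_of_deriv {l l' : ℝ → ℝ} {M a : ℝ} (hd : ∀ x, M < x → HasDerivAt l (l' x) x)
    (hl : ∀ x, M < x → l x * l' x ≤ -a * l x ^ 2) :
    ∃ C, 0 ≤ C ∧ ∀ x, M + 1 ≤ x → |l x| ≤ C * Real.exp (-a * x) := by
  have hder : ∀ x, M < x → HasDerivAt (fun x => l x ^ 2 * Real.exp (2 * a * x))
      ((2 * (l x * l' x) + 2 * a * l x ^ 2) * Real.exp (2 * a * x)) x := fun x hx => by
    have h1 := (hd x hx).pow 2
    have h2 : HasDerivAt (fun x => Real.exp (2 * a * x)) (Real.exp (2 * a * x) * (2 * a)) x := by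
      simpa using ((hasDerivAt_id x).const_mul (2 * a)).exp
    refine (h1.mul h2).congr_deriv ?_
    simp only [Pi.pow_apply]
    ring
  have hanti : AntitoneOn (fun x => l x ^ 2 * Real.exp (2 * a * x)) (Set.Ioi M) := by
    refine antitoneOn_of_deriv_nonpos (convex_Ioi M)
      (fun x hx => (hder x hx).continuousAt.continuousWithinAt) ?_ ?_
    · rw [interior_Ioi]
      exact fun x hx => (hder x hx).differentiableAt.differentiableWithinAt
    · rw [interior_Ioi]
      intro x hx
      rw [(hder x hx).deriv]
      exact mul_nonpos_of_nonpos_of_nonneg (by linarith [hl x hx]) (Real.exp_pos _).le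
  refine ⟨Real.sqrt (l (M + 1) ^ 2 * Real.exp (2 * a * (M + 1))), Real.sqrt_nonneg _, fun x hx => ?_⟩
  have h := hanti (show M + 1 ∈ Set.Ioi M by simp) (show x ∈ Set.Ioi M from by
    simp only [Set.mem_Ioi]; linarith) hx
  have h1 : |l x| * Real.exp (a * x) ≤ Real.sqrt (l (M + 1) ^ 2 * Real.exp (2 * a * (M + 1))) := by
    refine Real.le_sqrt_of_sq_le ?_
    rw [mul_pow, sq_abs, ← Real.exp_nat_mul]
    simpa [mul_assoc] using h
  calc |l x| = |l x| * Real.exp (a * x) * Real.exp (-a * x) := by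
        rw [mul_assoc, ← Real.exp_add]; simp
    _ ≤ _ := by gcongr

/-- A backward uniqueness statement at `+∞`. -/
lemma eq_zero_of_norm_deriv_le_exp {e e' : ℝ → ℝ × ℝ × ℝ} {M C b : ℝ} (hC : 0 ≤ C) (hb : 0 < b)
    (hd : ∀ x, M < x → HasDerivAt e (e' x) x)
    (hle : ∀ x, M < x → ‖e' x‖ ≤ C * Real.exp (-b * x) * ‖e x‖)
    (hlim : Filter.Tendsto e Filter.atTop (𝓝 0)) : ∀ x, M < x → e x = 0 := by
  set q : ℝ → ℝ := fun x => (e x).1 ^ 2 + (e x).2.1 ^ 2 + (e x).2.2 ^ 2 with hq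
  -- The inequality on e' gives q' ≥ −6 C exp (−b x) q, from three products in the derivative of the
  -- sum of squares, each with factor 2. The weight has w'/w = 6 C exp (−b x), so q w is
  -- nondecreasing. The exponent is integrable at infinity, so w stays bounded; thus q w is
  -- nonnegative, nondecreasing and tends to 0.
  set w : ℝ → ℝ := fun x => Real.exp (-(6 * C / b) * Real.exp (-b * x)) with hw
  have hn1 : ∀ z : ℝ × ℝ × ℝ, |z.1| ≤ ‖z‖ := fun z => norm_fst_le z
  have hn2 : ∀ z : ℝ × ℝ × ℝ, |z.2.1| ≤ ‖z‖ := fun z => (norm_fst_le z.2).trans (norm_snd_le z)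
  have hn3 : ∀ z : ℝ × ℝ × ℝ, |z.2.2| ≤ ‖z‖ := fun z => (norm_snd_le z.2).trans (norm_snd_le z)
  have hqn : ∀ x, ‖e x‖ ^ 2 ≤ q x := fun x => by
    have : ‖e x‖ = max |(e x).1| (max |(e x).2.1| |(e x).2.2|) := rfl
    rw [this]
    rcases max_cases |(e x).1| (max |(e x).2.1| |(e x).2.2|) with ⟨h, -⟩ | ⟨h, -⟩
    · rw [h, sq_abs]; simp only [hq]; nlinarith [sq_nonneg (e x).2.1, sq_nonneg (e x).2.2]
    · rw [h]
      rcases max_cases |(e x).2.1| |(e x).2.2| with ⟨h, -⟩ | ⟨h, -⟩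
      · rw [h, sq_abs]; simp only [hq]; nlinarith [sq_nonneg (e x).1, sq_nonneg (e x).2.2]
      · rw [h, sq_abs]; simp only [hq]; nlinarith [sq_nonneg (e x).1, sq_nonneg (e x).2.1]
  have hqd : ∀ x, M < x → HasDerivAt q
      (2 * ((e x).1 * (e' x).1 + (e x).2.1 * (e' x).2.1 + (e x).2.2 * (e' x).2.2)) x := fun x hx => by
    have h1 : HasDerivAt (fun x => (e x).1) (e' x).1 x := hasDerivAt_fst (hd x hx)
    have h2' : HasDerivAt (fun x => (e x).2) (e' x).2 x := hasDerivAt_snd (hd x hx)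
    have h2 : HasDerivAt (fun x => (e x).2.1) (e' x).2.1 x := hasDerivAt_fst h2'
    have h3 : HasDerivAt (fun x => (e x).2.2) (e' x).2.2 x := hasDerivAt_snd h2'
    refine (((h1.pow 2).add (h2.pow 2)).add (h3.pow 2)).congr_deriv ?_
    push_cast
    ring
  have hqlow : ∀ x, M < x →
      0 ≤ 2 * ((e x).1 * (e' x).1 + (e x).2.1 * (e' x).2.1 + (e x).2.2 * (e' x).2.2)
        + 6 * C * Real.exp (-b * x) * q x := fun x hx => by
    have hterm : ∀ s t : ℝ, |s| ≤ ‖e x‖ → |t| ≤ ‖e' x‖ → -(C * Real.exp (-b * x) * q x) ≤ s * t := by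
      intro s t hs ht
      have h1 : |s * t| ≤ ‖e x‖ * (C * Real.exp (-b * x) * ‖e x‖) := by
        rw [abs_mul]
        exact mul_le_mul hs (ht.trans (hle x hx)) (abs_nonneg _) (norm_nonneg _)
      have h2 : ‖e x‖ * (C * Real.exp (-b * x) * ‖e x‖) ≤ C * Real.exp (-b * x) * q x := by
        calc _ = C * Real.exp (-b * x) * ‖e x‖ ^ 2 := by ring
          _ ≤ _ := by gcongr; exact hqn x
      linarith [neg_abs_le (s * t)]
    have a1 := hterm _ _ (hn1 (e x)) (hn1 (e' x))
    have a2 := hterm _ _ (hn2 (e x)) (hn2 (e' x))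
    have a3 := hterm _ _ (hn3 (e x)) (hn3 (e' x))
    linarith
  have hwd : ∀ x, HasDerivAt w (w x * (6 * C * Real.exp (-b * x))) x := fun x => by
    have h1 : HasDerivAt (fun x => Real.exp (-b * x)) (Real.exp (-b * x) * (-b)) x := by
      simpa using ((hasDerivAt_id x).const_mul (-b)).exp
    refine (h1.const_mul (-(6 * C / b))).exp.congr_deriv ?_
    simp only [hw]
    field_simp
  have hmono : MonotoneOn (fun x => q x * w x) (Set.Ioi M) := by
    have hder := fun x (hx : M < x) => (hqd x hx).mul (hwd x)
    refine monotoneOn_of_deriv_nonneg (convex_Ioi M)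
      (fun x hx => (hder x hx).continuousAt.continuousWithinAt) ?_ ?_
    · rw [interior_Ioi]
      exact fun x hx => (hder x hx).differentiableAt.differentiableWithinAt
    · rw [interior_Ioi]
      intro x hx
      have := (hder x hx).deriv
      change 0 ≤ deriv (q * w) x
      rw [this]
      have hwp : 0 < w x := Real.exp_pos _
      calc 0 ≤ (2 * ((e x).1 * (e' x).1 + (e x).2.1 * (e' x).2.1 + (e x).2.2 * (e' x).2.2)
        + 6 * C * Real.exp (-b * x) * q x) * w x := mul_nonneg (hqlow x hx) hwp.le
        _ = _ := by ring
  have hqlim : Filter.Tendsto q Filter.atTop (𝓝 0) := by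
    have hc : Continuous fun z : ℝ × ℝ × ℝ => z.1 ^ 2 + z.2.1 ^ 2 + z.2.2 ^ 2 := by fun_prop
    simpa [hq, Function.comp_def] using (hc.tendsto 0).comp hlim
  have hwle : ∀ x, w x ≤ 1 := fun x => Real.exp_le_one_iff.2 (by
    have : 0 ≤ 6 * C / b * Real.exp (-b * x) := by positivity
    linarith)
  have hq0 : ∀ x, 0 ≤ q x := fun x => by simp only [hq]; positivity
  intro x hx
  have h1 : q x * w x ≤ 0 := by
    refine ge_of_tendsto hqlim ?_
    filter_upwards [Filter.eventually_ge_atTop x] with y hy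
    exact (hmono hx (hx.trans_le hy) hy).trans (mul_le_of_le_one_right (hq0 y) (hwle y))
  have h2 : q x ≤ 0 := nonpos_of_mul_nonpos_left h1 (Real.exp_pos _)
  have h3 := (hqn x).trans h2
  exact norm_le_zero_iff.1 (by nlinarith [norm_nonneg (e x)])

/-- Analytic linearization of a scalar analytic differential equation at a nondegenerate zero. -/
lemma exists_linearization {f : ℝ → ℝ} {μ : ℝ} (hμ : μ ≠ 0) (hf : AnalyticAt ℝ f 0) (hf0 : f 0 = 0)
    (hf1 : HasDerivAt f (-μ) 0) :
    ∃ φ : ℝ → ℝ, AnalyticAt ℝ φ 0 ∧ φ 0 = 0 ∧ HasDerivAt φ 1 0 ∧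
      ∀ᶠ s in 𝓝 0, deriv φ s * f s = -μ * φ s := by
  have hds : ∀ {g : ℝ → ℝ}, AnalyticAt ℝ g 0 → AnalyticAt ℝ (dslope g 0) 0 := fun {g} hg => by
    obtain ⟨p, hp⟩ := hg
    exact ⟨_, hp.has_fpower_series_dslope_fslope⟩
  have h1 := hds hf
  have h10 : dslope f 0 0 = -μ := by rw [dslope_same, hf1.deriv]
  have hf1' : ∀ s, f s = s * dslope f 0 s := fun s => by
    have := sub_smul_dslope f 0 s
    rw [hf0, sub_zero, sub_zero, smul_eq_mul] at this
    exact this.symm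
  have h2 := hds h1
  have hf2' : ∀ s, dslope f 0 s + μ = s * dslope (dslope f 0) 0 s := fun s => by
    have := sub_smul_dslope (dslope f 0) 0 s
    rw [h10, sub_zero, smul_eq_mul] at this
    rw [this]; ring
  -- The linearizing map is sought as φ s = s χ s. With f s = s g s and g s + μ = s k s, the
  -- equation φ' f = −μ φ reduces to χ' = −(k / g) χ, which is regular at 0 because g 0 = −μ ≠ 0.
  -- The first component is time, added to make the system autonomous.
  let H : ℝ × ℝ → ℝ × ℝ := fun z => (1, -(dslope (dslope f 0) 0 z.1 / dslope f 0 z.1) * z.2)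
  have hH : AnalyticAt ℝ H (0, 1) := by
    have e1 : AnalyticAt ℝ (fun z : ℝ × ℝ => dslope f 0 z.1) (0, 1) :=
      AnalyticAt.comp (g := dslope f 0) (f := Prod.fst) h1 analyticAt_fst
    have e2 : AnalyticAt ℝ (fun z : ℝ × ℝ => dslope (dslope f 0) 0 z.1) (0, 1) :=
      AnalyticAt.comp (g := dslope (dslope f 0) 0) (f := Prod.fst) h2 analyticAt_fst
    exact analyticAt_const.prod (((e2.div e1 (by rw [h10]; exact neg_ne_zero.2 hμ)).neg).mul analyticAt_snd)
  obtain ⟨Γ, hΓa, hΓ0, hΓ⟩ := exists_analyticAt_hasDerivAt hH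
  have hd1 : ∀ᶠ s in 𝓝 0, HasDerivAt (fun s => (Γ s).1) 1 s := by
    filter_upwards [hΓ] with s hs using hasFDerivAt_fst.comp_hasDerivAt s hs
  have hfst : ∀ᶠ s in 𝓝 0, (Γ s).1 = s := by
    obtain ⟨ε, hε, hball⟩ := Metric.eventually_nhds_iff_ball.1 hd1
    filter_upwards [Metric.ball_mem_nhds 0 hε] with s hs
    have hc : (Γ s).1 - s = (Γ 0).1 - 0 := by
      refine (convex_ball (0 : ℝ) ε).is_const_of_fderivWithin_eq_zero (𝕜 := ℝ)
        (f := fun s => (Γ s).1 - s) (fun z hz => ?_) (fun z hz => ?_) hs (Metric.mem_ball_self hε)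
      · exact ((hball z hz).sub (hasDerivAt_id z)).differentiableAt.differentiableWithinAt
      · rw [fderivWithin_of_isOpen Metric.isOpen_ball hz, ← toSpanSingleton_deriv]
        have := ((hball z hz).sub (hasDerivAt_id z)).deriv
        change ContinuousLinearMap.toSpanSingleton ℝ (deriv ((fun s => (Γ s).1) - id) z) = 0
        rw [this]; simp
    rw [hΓ0] at hc
    simp only [sub_self] at hc
    linarith
  set χ : ℝ → ℝ := fun s => (Γ s).2 with hχ
  have hχa : AnalyticAt ℝ χ 0 := AnalyticAt.comp (g := Prod.snd) analyticAt_snd hΓa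
  have hχ0 : χ 0 = 1 := by simp [hχ, hΓ0]
  have hχd : ∀ᶠ s in 𝓝 0,
      HasDerivAt χ (-(dslope (dslope f 0) 0 s / dslope f 0 s) * χ s) s := by
    filter_upwards [hΓ, hfst] with s hs hs1
    have := hasFDerivAt_snd.comp_hasDerivAt s hs
    simp only [H, hs1] at this
    exact this
  have hne : ∀ᶠ s in 𝓝 0, dslope f 0 s ≠ 0 :=
    h1.continuousAt.eventually_ne (by rw [h10]; exact neg_ne_zero.2 hμ)
  have hφd : ∀ᶠ s in 𝓝 0, HasDerivAt (fun s => s * χ s)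
      (χ s + s * (-(dslope (dslope f 0) 0 s / dslope f 0 s) * χ s)) s := by
    filter_upwards [hχd] with s hs
    exact ((hasDerivAt_id s).mul hs).congr_deriv (by simp)
  refine ⟨fun s => s * χ s, analyticAt_id.mul hχa, by simp, ?_, ?_⟩
  · simpa [hχ0] using hφd.self_of_nhds
  · filter_upwards [hφd, hne] with s hs hn
    rw [hs.deriv, hf1' s]
    have e := hf2' s
    field_simp
    linear_combination (s * χ s) * e

/-- Decaying solutions of scalar analytic differential equations are analytic functions of the
decaying exponential. -/
lemma exists_eventually_eq_comp_exp {f l : ℝ → ℝ} {μ : ℝ} (hμ : μ ≠ 0) (hf : AnalyticAt ℝ f 0)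
    (hf0 : f 0 = 0) (hf1 : HasDerivAt f (-μ) 0) (hl : Filter.Tendsto l Filter.atTop (𝓝 0))
    (hd : ∀ᶠ x in Filter.atTop, HasDerivAt l (f (l x)) x) :
    ∃ ψ : ℝ → ℝ, AnalyticAt ℝ ψ 0 ∧ ψ 0 = 0 ∧
      ∀ᶠ x in Filter.atTop, l x = ψ (Real.exp (-μ * x)) := by
  obtain ⟨φ, hφa, hφ0, hφ1, hφ⟩ := exists_linearization hμ hf hf0 hf1
  -- The implicit function of this equation is the local inverse of φ.
  set F : ℝ × ℝ → ℝ := fun q => φ q.2 - q.1 with hF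
  have hFa : AnalyticAt ℝ F (0, 0) :=
    (AnalyticAt.comp (g := φ) (f := Prod.snd) hφa analyticAt_snd).sub analyticAt_fst
  have hder : fderiv ℝ F (0, 0) ∘L .inr ℝ ℝ ℝ = .id ℝ ℝ := by
    have h1 : HasFDerivAt (fun y => F (0, y)) (fderiv ℝ F (0, 0) ∘L .inr ℝ ℝ ℝ) 0 :=
      hFa.differentiableAt.hasFDerivAt.comp (0 : ℝ) (hasFDerivAt_prodMk_right (0 : ℝ) (0 : ℝ))
    have h2 : HasFDerivAt (fun y => F (0, y)) (.id ℝ ℝ) 0 := by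
      simp only [hF, sub_zero]
      exact hφ1.hasFDerivAt.congr_fderiv (by ext; simp)
    exact h1.unique h2
  have hinv : (fderiv ℝ F (0, 0) ∘L .inr ℝ ℝ ℝ).IsInvertible := by
    rw [hder]; exact ⟨.refl ℝ _, rfl⟩
  have hcd : ContDiffAt ℝ ⊤ F (0, 0) := hFa.contDiffAt
  have hne : (⊤ : WithTop ℕ∞) ≠ 0 := by simp
  have hψ : AnalyticAt ℝ (hcd.implicitFunction hne hinv) 0 :=
    (hcd.contDiffAt_implicitFunction hne hinv).analyticAt
  have hψ0 : hcd.implicitFunction hne hinv 0 = 0 := hcd.implicitFunction_apply_self hne hinv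
  have hiff := hcd.eventually_apply_eq_iff_implicitFunction hne hinv
  have hk : Filter.Tendsto (fun x => φ (l x)) Filter.atTop (𝓝 0) := by
    have := hφa.continuousAt.tendsto.comp hl
    rwa [hφ0] at this
  have hinvx : ∀ᶠ x in Filter.atTop, hcd.implicitFunction hne hinv (φ (l x)) = l x := by
    filter_upwards [(hk.prodMk_nhds hl).eventually hiff] with x hx
    exact hx.1 (by simp [hF, hφ0])
  -- In the coordinate φ the equation is linear, so φ (l x) exp (μ x) is eventually a constant c,
  -- and l is the inverse of φ evaluated at c exp (−μ x).
  have hkd : ∀ᶠ x in Filter.atTop, HasDerivAt (fun x => φ (l x) * Real.exp (μ * x)) 0 x := by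
    have hφdiff := hφa.eventually_analyticAt
    filter_upwards [hd, hl.eventually hφ, hl.eventually hφdiff] with x hx1 hx2 hx3
    have e1 := hx3.differentiableAt.hasDerivAt.comp x hx1
    have e2 : HasDerivAt (fun x => Real.exp (μ * x)) (Real.exp (μ * x) * μ) x := by
      simpa using ((hasDerivAt_id x).const_mul μ).exp
    refine (e1.mul e2).congr_deriv ?_
    rw [hx2]
    simp only [Function.comp_apply]
    ring
  obtain ⟨M, hM⟩ := Filter.eventually_atTop.1 hkd
  set c : ℝ := φ (l (M + 1)) * Real.exp (μ * (M + 1)) with hc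
  have hkc : ∀ x, M < x → φ (l x) = c * Real.exp (-μ * x) := fun x hx => by
    have := eq_of_hasDerivAt_zero_of_gt (f := fun x => φ (l x) * Real.exp (μ * x))
      (fun y hy => hM y (le_of_lt hy)) hx (show M < M + 1 by linarith)
    rw [hc, ← this, mul_assoc, ← Real.exp_add]
    simp
  refine ⟨fun z => hcd.implicitFunction hne hinv (c * z), ?_, by simpa using hψ0, ?_⟩
  · refine AnalyticAt.comp (g := hcd.implicitFunction hne hinv) (f := fun z => c * z) ?_
      (analyticAt_const.mul analyticAt_id)
    simpa using hψ
  · filter_upwards [hinvx, Filter.eventually_gt_atTop M] with x hx hxM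
    rw [← hkc x hxM, hx]


/-! ### The profile as an analytic function of exp (−μ x) -/

lemma fderiv_state_apply (f : State → ℝ) (w : State) (a b c : ℝ) :
    fderiv ℝ f w (a, b, c) = dv f w * a + dS f w * b + dlam f w * c := by
  have : ((a, b, c) : State) = a • ((1, 0, 0) : State) + b • ((0, 1, 0) : State)
      + c • ((0, 0, 1) : State) := by simp
  rw [this, map_add, map_add, map_smul, map_smul, map_smul]
  simp only [dv, dS, dlam, smul_eq_mul]
  ring

lemma analyticAt_dv {f : State → ℝ} {w : State} (hf : AnalyticAt ℝ f w) : AnalyticAt ℝ (dv f) w :=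
  (ContinuousLinearMap.apply ℝ ℝ ((1, 0, 0) : State)).analyticAt _ |>.comp hf.fderiv

lemma analyticAt_dS {f : State → ℝ} {w : State} (hf : AnalyticAt ℝ f w) : AnalyticAt ℝ (dS f) w :=
  (ContinuousLinearMap.apply ℝ ℝ ((0, 1, 0) : State)).analyticAt _ |>.comp hf.fderiv

lemma analyticAt_dlam {f : State → ℝ} {w : State} (hf : AnalyticAt ℝ f w) :
    AnalyticAt ℝ (dlam f) w :=
  (ContinuousLinearMap.apply ℝ ℝ ((0, 0, 1) : State)).analyticAt _ |>.comp hf.fderiv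

namespace Profile

variable {Θ : Thermo} (P : Profile Θ)

lemma state_mem_dom {x : ℝ} (hx : 0 ≤ x) : P.state x ∈ Θ.dom := P.mem_dom x hx

lemma stateInf_mem_dom : P.stateInf ∈ Θ.dom := P.memInf_dom

lemma hasDerivAt_of_analyticOn_Ici {f : ℝ → ℝ} (hf : AnalyticOn ℝ f (Set.Ici 0)) {x : ℝ}
    (hx : 0 < x) : HasDerivAt f (deriv f x) x :=
  ((hf.differentiableOn x hx.le).differentiableAt (Ici_mem_nhds hx)).hasDerivAt

lemma hasDerivAt_state {x : ℝ} (hx : 0 < x) :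
    HasDerivAt P.state (deriv P.v x, deriv P.S x, deriv P.lam x) x :=
  (hasDerivAt_of_analyticOn_Ici P.analytic_v hx).prodMk
    ((hasDerivAt_of_analyticOn_Ici P.analytic_S hx).prodMk
      (hasDerivAt_of_analyticOn_Ici P.analytic_lam hx))

lemma tendsto_state : Filter.Tendsto P.state Filter.atTop (𝓝 P.stateInf) :=
  P.tendsto_v.prodMk_nhds (P.tendsto_S.prodMk_nhds P.tendsto_lam)

lemma u_pos {x : ℝ} (hx : 0 ≤ x) : 0 < P.u x := by
  obtain ⟨C₁, C₂, C₃, C₄, h1, h2, h3, h⟩ := P.subsonic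
  exact h3.trans_le (h x hx).2.1

/-- Conservation of mass. -/
lemma exists_massFlux : ∃ m, 0 < m ∧ (∀ x, 0 < x → P.u x = m * P.v x) ∧ P.uInf = m * P.vInf := by
  have hder : ∀ x, 0 < x → HasDerivAt (fun x => P.u x / P.v x) 0 x := fun x hx => by
    refine ((hasDerivAt_of_analyticOn_Ici P.analytic_u hx).div
      (hasDerivAt_of_analyticOn_Ici P.analytic_v hx) (P.v_pos x hx.le).ne').congr_deriv ?_
    have := P.mass x hx
    rw [show deriv P.u x * P.v x - P.u x * deriv P.v x = 0 by linarith]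
    simp
  have hm : ∀ x, 0 < x → P.u x = P.u 1 / P.v 1 * P.v x := fun x hx => by
    have : P.u x / P.v x = P.u 1 / P.v 1 := eq_of_hasDerivAt_zero_of_gt hder hx one_pos
    rw [← this, div_mul_cancel₀ _ (P.v_pos x hx.le).ne']
  refine ⟨P.u 1 / P.v 1, div_pos (P.u_pos zero_le_one) (P.v_pos 1 zero_le_one), hm, ?_⟩
  refine tendsto_nhds_unique P.tendsto_u ?_
  refine (P.tendsto_v.const_mul (P.u 1 / P.v 1)).congr' ?_
  filter_upwards [Filter.eventually_gt_atTop 0] with x hx using (hm x hx).symm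

lemma uInf_pos : 0 < P.uInf := by
  obtain ⟨C₁, C₂, C₃, C₄, h1, h2, h3, h⟩ := P.subsonic
  refine h3.trans_le (ge_of_tendsto P.tendsto_u ?_)
  filter_upwards [Filter.eventually_ge_atTop 0] with x hx using (h x hx).2.1

lemma vInf_pos : 0 < P.vInf := by
  obtain ⟨m, hm, -, h⟩ := P.exists_massFlux
  have := P.uInf_pos
  rw [h] at this
  exact pos_of_mul_pos_right this hm.le

lemma mu_pos : 0 < P.mu :=
  div_pos (neg_pos.2 (Θ.dlam_r_neg _ P.stateInf_mem_dom)) P.uInf_pos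

lemma continuousAt_soundSpeed {w : State} (hw : w ∈ Θ.dom) : ContinuousAt Θ.soundSpeed w := by
  have := (analyticAt_dv (Θ.analytic_p w hw)).continuousAt
  exact Real.continuous_sqrt.continuousAt.comp
    (((continuousAt_fst.pow 2).mul this).neg)

lemma uInf_lt_soundSpeed : P.uInf < Θ.soundSpeed P.stateInf := by
  obtain ⟨C₁, C₂, C₃, C₄, h1, h2, h3, h⟩ := P.subsonic
  have hC2 : 0 < C₂ := h1.trans_le ((h 0 le_rfl).1.1.trans (h 0 le_rfl).1.2)
  have hle : P.uInf ≤ C₂ * Θ.soundSpeed P.stateInf := by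
    refine le_of_tendsto_of_tendsto P.tendsto_u
      (((continuousAt_soundSpeed P.stateInf_mem_dom).tendsto.comp P.tendsto_state).const_mul C₂) ?_
    filter_upwards [Filter.eventually_ge_atTop 0] with x hx
    have hs : 0 ≤ Θ.soundSpeed (P.state x) := Real.sqrt_nonneg _
    rcases hs.eq_or_lt with h0 | h0
    · have := (h x hx).1.1
      change C₁ ≤ P.u x / Θ.soundSpeed (P.state x) at this
      rw [← h0, div_zero] at this
      linarith
    · exact (div_le_iff₀ h0).1 (h x hx).1.2
  have h0 : 0 < Θ.soundSpeed P.stateInf := by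
    by_contra! hn
    nlinarith [P.uInf_pos]
  nlinarith

lemma soundSpeed_pos : 0 < Θ.soundSpeed P.stateInf := P.uInf_pos.trans P.uInf_lt_soundSpeed

lemma soundSpeed_sq {w : State} (hw : 0 < Θ.soundSpeed w) :
    Θ.soundSpeed w ^ 2 = -(w.1 ^ 2 * dv Θ.p w) :=
  Real.sq_sqrt (Real.sqrt_pos.1 hw).le

/-- This is subsonicity at the end state, u² < c₀², after inserting u = m v and c₀² = −v² p_v and
dividing by v². It keeps the denominator of `direction` away from zero. -/
lemma massFlux_sq_add_dv_neg {m : ℝ} (hm : P.uInf = m * P.vInf) :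
    m ^ 2 + dv Θ.p P.stateInf < 0 := by
  have h1 := P.uInf_lt_soundSpeed
  have h2 := soundSpeed_sq P.soundSpeed_pos
  have h3 : P.uInf ^ 2 < Θ.soundSpeed P.stateInf ^ 2 := by
    have := P.uInf_pos
    gcongr
  have hv := P.vInf_pos
  rw [h2, hm] at h3
  have h4 : P.stateInf.1 = P.vInf := rfl
  rw [h4] at h3
  have h5 : P.vInf ^ 2 * (m ^ 2 + dv Θ.p P.stateInf) < 0 := by nlinarith
  exact (pos_iff_neg_of_mul_neg h5).1 (by positivity)

/-- The direction field of the profile, parametrized by the reactant. -/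
def direction (Θ : Thermo) (m : ℝ) (w : State) : State :=
  (-((dS Θ.p w * (-(Θ.dF w) / Θ.T w) + dlam Θ.p w) / (m ^ 2 + dv Θ.p w)), -(Θ.dF w) / Θ.T w, 1)

lemma analyticAt_direction {m : ℝ} {w : State} (hw : w ∈ Θ.dom) (hm : m ^ 2 + dv Θ.p w ≠ 0) :
    AnalyticAt ℝ (direction Θ m) w := by
  have hK : AnalyticAt ℝ (fun w => -(Θ.dF w) / Θ.T w) w :=
    (Θ.analytic_dF w hw).neg.div (Θ.analytic_T w hw) (Θ.T_pos w hw).ne'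
  have hp := Θ.analytic_p w hw
  exact (((((analyticAt_dS hp).mul hK).add (analyticAt_dlam hp)).div
    (analyticAt_const.add (analyticAt_dv hp)) hm).neg).prod (hK.prod analyticAt_const)

/-- With u = m v the momentum equation divided by v reads (m² + p_v) v' + p_S S' + p_λ λ' = 0. The
entropy and reaction equations share the factor r, whence S' = −(ΔF / T) λ'. So v' and S' are
multiples of λ', with coefficients depending on the state alone. -/
lemma hasDerivAt_state_direction {m : ℝ} (hm : ∀ x, 0 < x → P.u x = m * P.v x) {x : ℝ} (hx : 0 < x)
    (hne : m ^ 2 + dv Θ.p (P.state x) ≠ 0) :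
    HasDerivAt P.state (deriv P.lam x • direction Θ m (P.state x)) x := by
  refine (P.hasDerivAt_state hx).congr_deriv ?_
  have hu := P.u_pos hx.le
  have hv := P.v_pos x hx.le
  have hT := Θ.T_pos _ (P.state_mem_dom hx.le)
  have hS : deriv P.S x = deriv P.lam x * (-(Θ.dF (P.state x)) / Θ.T (P.state x)) := by
    have h1 := P.entropy x hx
    have h2 := P.reaction x hx
    change _ = Θ.source (P.state x) at h1
    change _ = Θ.r (P.state x) at h2
    rw [Thermo.source, ← h2] at h1
    apply mul_left_cancel₀ hu.ne'
    rw [h1]; field_simp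
  have hp : deriv (fun y => Θ.p (P.v y, P.S y, P.lam y)) x = dv Θ.p (P.state x) * deriv P.v x
      + dS Θ.p (P.state x) * deriv P.S x + dlam Θ.p (P.state x) * deriv P.lam x := by
    have := ((Θ.analytic_p _ (P.state_mem_dom hx.le)).differentiableAt.hasFDerivAt.comp_hasDerivAt x
      (P.hasDerivAt_state hx)).deriv
    rw [fderiv_state_apply] at this
    exact this
  have hud : deriv P.u x = m * deriv P.v x := by
    have h1 : P.u =ᶠ[𝓝 x] fun y => m * P.v y := by
      filter_upwards [lt_mem_nhds hx] with y hy using hm y hy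
    rw [h1.deriv_eq]
    exact ((hasDerivAt_of_analyticOn_Ici P.analytic_v hx).const_mul m).deriv
  have hmom := P.momentum x hx
  rw [hp, hm x hx, hud] at hmom
  have hmom' : (m ^ 2 + dv Θ.p (P.state x)) * deriv P.v x
      + dS Θ.p (P.state x) * deriv P.S x + dlam Θ.p (P.state x) * deriv P.lam x = 0 := by
    apply mul_left_cancel₀ hv.ne'
    linear_combination hmom
  refine Prod.ext ?_ (Prod.ext hS ?_)
  · simp only [direction, Prod.smul_mk, smul_eq_mul]
    rw [hS] at hmom'
    field_simp
    field_simp at hmom'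
    linear_combination hmom'
  · simp [direction]

/-- The state is compared with (v, S, 0), where r vanishes, and not with the end state: strict
differentiability allows both points to move, so the error is o(λ) rather than o of the distance to
the end state. -/
lemma eventually_abs_rate_add_le {ε : ℝ} (hε : 0 < ε) :
    ∀ᶠ x in Filter.atTop, |Θ.r (P.state x) - dlam Θ.r P.stateInf * P.lam x| ≤ ε * |P.lam x| := by
  have hs : HasStrictFDerivAt Θ.r (fderiv ℝ Θ.r P.stateInf) P.stateInf :=
    (Θ.analytic_r _ P.stateInf_mem_dom).hasStrictFDerivAt
  have h1 : Filter.Tendsto (fun x => (P.v x, P.S x, (0 : ℝ))) Filter.atTop (𝓝 P.stateInf) :=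
    P.tendsto_v.prodMk_nhds (P.tendsto_S.prodMk_nhds tendsto_const_nhds)
  have h2 := hs.isLittleO.def hε
  filter_upwards [(P.tendsto_state.prodMk_nhds h1).eventually h2,
    h1.eventually (Θ.isOpen_dom.mem_nhds P.stateInf_mem_dom)] with x hx hd
  have e1 : P.state x - (P.v x, P.S x, (0 : ℝ)) = (0, 0, P.lam x) := by simp [state]
  simp only [e1, Θ.r_eq_zero _ hd rfl, fderiv_state_apply] at hx
  simpa [Prod.norm_def] using hx

/-- Along a profile the state is an analytic function of the exponential `exp (-μ x)`. -/
lemma exists_state_eq_comp_exp : ∃ σ : ℝ → State, AnalyticAt ℝ σ 0 ∧ σ 0 = P.stateInf ∧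
    ∀ᶠ x in Filter.atTop, P.state x = σ (Real.exp (-P.mu * x)) := by
  obtain ⟨m, hm, hum, huInf⟩ := P.exists_massFlux
  obtain ⟨C₁, C₂, C₃, C₄, -, -, hC3, hsub⟩ := P.subsonic
  have hu3 : ∀ x, 0 ≤ x → C₃ ≤ P.u x := fun x hx => (hsub x hx).2.1
  have hu4 : ∀ x, 0 ≤ x → P.u x ≤ C₄ := fun x hx => (hsub x hx).2.2
  have hC4 : 0 < C₄ := hC3.trans_le ((hu3 0 le_rfl).trans (hu4 0 le_rfl))
  have hneg := P.massFlux_sq_add_dv_neg huInf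
  have hHa : AnalyticAt ℝ (direction Θ m) P.stateInf :=
    analyticAt_direction P.stateInf_mem_dom hneg.ne
  -- Γ is the integral curve of the direction field through the end state, with λ as time. It is the
  -- candidate for the image of the profile.
  obtain ⟨Γ, hΓa, hΓ0, hΓ⟩ := exists_analyticAt_hasDerivAt hHa
  set A : ℝ := -dlam Θ.r P.stateInf with hA
  have hA0 : 0 < A := neg_pos.2 (Θ.dlam_r_neg _ P.stateInf_mem_dom)
  have hΓlim : Filter.Tendsto (fun x => Γ (P.lam x)) Filter.atTop (𝓝 P.stateInf) := by
    have := hΓa.continuousAt.tendsto.comp P.tendsto_lam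
    rwa [hΓ0] at this
  obtain ⟨K, U, hU, hLip⟩ := hHa.hasStrictFDerivAt.exists_lipschitzOnWith
  have hnem : ∀ᶠ x in Filter.atTop, m ^ 2 + dv Θ.p (P.state x) ≠ 0 :=
    P.tendsto_state.eventually ((continuousAt_const.add
      (analyticAt_dv (Θ.analytic_p _ P.stateInf_mem_dom)).continuousAt).eventually_ne hneg.ne)
  have hall := ((P.eventually_abs_rate_add_le (half_pos hA0)).and hnem).and
    ((P.tendsto_state.eventually hU).and ((hΓlim.eventually hU).and (P.tendsto_lam.eventually hΓ)))
  obtain ⟨M₁, hM₁⟩ := Filter.eventually_atTop.1 hall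
  set M : ℝ := max M₁ 0 with hM
  have hM1 : ∀ x, M < x → M₁ ≤ x := fun x hx => (le_max_left _ _).trans hx.le
  have hM0 : ∀ x, M < x → 0 < x := fun x hx => (le_max_right _ _).trans_lt hx
  have hlamd : ∀ x, M < x → HasDerivAt P.lam (deriv P.lam x) x := fun x hx =>
    hasDerivAt_of_analyticOn_Ici P.analytic_lam (hM0 x hx)
  have hreact : ∀ x, M < x → deriv P.lam x = Θ.r (P.state x) / P.u x := fun x hx => by
    rw [eq_div_iff (P.u_pos (hM0 x hx).le).ne', mul_comm]
    exact P.reaction x (hM0 x hx)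
  have hrate : ∀ x, M < x → |Θ.r (P.state x) + A * P.lam x| ≤ A / 2 * |P.lam x| := fun x hx => by
    have := (hM₁ x (hM1 x hx)).1.1
    rwa [sub_eq_add_neg, ← neg_mul] at this
  -- A relative error of one half on r leaves the rate A/2, and u ≤ C₄. This crude rate only makes
  -- λ' integrable; the sharp rate μ comes from the linearized scalar equation.
  have hdecay : ∀ x, M < x →
      P.lam x * deriv P.lam x ≤ -(A / (2 * C₄)) * P.lam x ^ 2 := fun x hx => by
    have hu := P.u_pos (hM0 x hx).le
    have h1 : P.lam x * Θ.r (P.state x) ≤ -(A / 2 * P.lam x ^ 2) := by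
      have h2 : |P.lam x * (Θ.r (P.state x) + A * P.lam x)| ≤ A / 2 * P.lam x ^ 2 := by
        rw [abs_mul, ← sq_abs (P.lam x)]
        nlinarith [hrate x hx, abs_nonneg (P.lam x)]
      nlinarith [le_abs_self (P.lam x * (Θ.r (P.state x) + A * P.lam x))]
    rw [hreact x hx, ← mul_div_assoc, div_le_iff₀ hu]
    refine h1.trans ?_
    have h3 : A / (2 * C₄) * P.lam x ^ 2 * P.u x ≤ A / (2 * C₄) * P.lam x ^ 2 * C₄ := by
      have := hu4 x (hM0 x hx).le
      gcongr
    have h4 : A / (2 * C₄) * P.lam x ^ 2 * C₄ = A / 2 * P.lam x ^ 2 := by field_simp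
    linarith
  have hgrow : ∀ x, M < x → |deriv P.lam x| ≤ 3 / 2 * A / C₃ * |P.lam x| := fun x hx => by
    have hu := P.u_pos (hM0 x hx).le
    have h1 : |Θ.r (P.state x)| ≤ 3 / 2 * A * |P.lam x| := by
      have h2 : |A * P.lam x| = A * |P.lam x| := by rw [abs_mul, abs_of_pos hA0]
      have h3 := abs_sub (Θ.r (P.state x) + A * P.lam x) (A * P.lam x)
      rw [add_sub_cancel_right, h2] at h3
      linarith [hrate x hx]
    rw [hreact x hx, abs_div, abs_of_pos hu]
    calc _ ≤ 3 / 2 * A * |P.lam x| / C₃ := by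
          have := hu3 x (hM0 x hx).le
          gcongr
      _ = _ := by ring
  obtain ⟨C, hC, hexp⟩ := exists_abs_le_exp_of_deriv hlamd hdecay
  have hede : ∀ x, M < x → HasDerivAt (fun x => P.state x - Γ (P.lam x))
      (deriv P.lam x • (direction Θ m (P.state x) - direction Θ m (Γ (P.lam x)))) x := fun x hx => by
    have h1 := P.hasDerivAt_state_direction hum (hM0 x hx) (hM₁ x (hM1 x hx)).1.2
    have h2 := HasDerivAt.scomp x (hM₁ x (hM1 x hx)).2.2.2 (hlamd x hx)
    rw [smul_sub]
    exact h1.sub h2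
  -- Both curves follow the same Lipschitz field multiplied by λ', so their difference satisfies
  -- |e'| ≤ K |λ'| |e| with an exponentially small coefficient. Since e → 0 at infinity, it vanishes
  -- identically.
  have he0 : ∀ x, M + 1 < x → P.state x - Γ (P.lam x) = 0 := by
    refine eq_zero_of_norm_deriv_le_exp (C := 3 / 2 * A / C₃ * C * K) (b := A / (2 * C₄))
      (by positivity) (by positivity) (fun x hx => hede x (by linarith)) (fun x hx => ?_) ?_
    · have hxM : M < x := by linarith
      rw [norm_smul, Real.norm_eq_abs]
      have h1 := hLip.norm_sub_le (hM₁ x (hM1 x hxM)).2.1 (hM₁ x (hM1 x hxM)).2.2.1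
      calc |deriv P.lam x| * ‖direction Θ m (P.state x) - direction Θ m (Γ (P.lam x))‖
          ≤ (3 / 2 * A / C₃ * (C * Real.exp (-(A / (2 * C₄)) * x)))
              * (K * ‖P.state x - Γ (P.lam x)‖) := by
            refine mul_le_mul ((hgrow x hxM).trans ?_) h1 (norm_nonneg _) (by positivity)
            gcongr
            exact hexp x hx.le
        _ = _ := by ring
    · simpa using P.tendsto_state.sub hΓlim
  -- On the curve Γ, and with u = m v, the reaction equation becomes the scalar autonomous equation
  -- λ' = r (Γ λ) / (m v (Γ λ)).
  have hf : AnalyticAt ℝ (fun s => Θ.r (Γ s) / (m * (Γ s).1)) 0 := by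
    refine AnalyticAt.div ?_ (analyticAt_const.mul (AnalyticAt.comp (g := Prod.fst) analyticAt_fst hΓa))
      ?_
    · exact AnalyticAt.comp (g := Θ.r) (by rw [hΓ0]; exact Θ.analytic_r _ P.stateInf_mem_dom) hΓa
    · rw [hΓ0]; exact (mul_pos hm P.vInf_pos).ne'
  have hr0 : Θ.r P.stateInf = 0 := Θ.r_eq_zero _ P.stateInf_mem_dom rfl
  have hf1 : HasDerivAt (fun s => Θ.r (Γ s) / (m * (Γ s).1)) (-P.mu) 0 := by
    have h1 : HasDerivAt Γ (direction Θ m P.stateInf) 0 := by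
      simpa [hΓ0] using hΓ.self_of_nhds
    -- Since r_v and r_S vanish at the end state and the last component of `direction` is 1, only
    -- r_λ survives, whatever the slope of Γ in v and S.
    have h2 : HasDerivAt (fun s => Θ.r (Γ s)) (dlam Θ.r P.stateInf) 0 := by
      have h3 : HasFDerivAt Θ.r (fderiv ℝ Θ.r P.stateInf) (Γ 0) := by
        rw [hΓ0]; exact (Θ.analytic_r _ P.stateInf_mem_dom).differentiableAt.hasFDerivAt
      refine (h3.comp_hasDerivAt (0 : ℝ) h1).congr_deriv ?_
      rw [direction, fderiv_state_apply, Θ.dv_r_eq_zero _ P.stateInf_mem_dom rfl,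
        Θ.dS_r_eq_zero _ P.stateInf_mem_dom rfl]
      ring
    have h4 : m * (Γ 0).1 = P.uInf := by rw [hΓ0, huInf]; rfl
    refine (h2.div ((hasDerivAt_fst h1).const_mul m) (by rw [h4]; exact P.uInf_pos.ne')).congr_deriv ?_
    rw [h4, hΓ0, hr0, mu]
    have := P.uInf_pos
    field_simp
    ring
  have hM2 : ∀ᶠ x in Filter.atTop, M + 1 < x := Filter.eventually_gt_atTop _
  obtain ⟨ψ, hψa, hψ0, hψ⟩ := exists_eventually_eq_comp_exp P.mu_pos.ne' hf (by simp [hΓ0, hr0]) hf1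
    P.tendsto_lam (by
      filter_upwards [hM2] with x hx
      have hxM : M < x := by linarith
      rw [← sub_eq_zero.1 (he0 x hx)]
      change HasDerivAt _ (_ / (m * P.v x)) x
      rw [← hum x (hM0 x hxM), ← hreact x hxM]
      exact hlamd x hxM)
  refine ⟨Γ ∘ ψ, AnalyticAt.comp (by rwa [hψ0]) hψa, by simp [hψ0, hΓ0], ?_⟩
  filter_upwards [hψ, hM2] with x hx hx2
  rw [Function.comp_apply, ← hx]
  exact sub_eq_zero.1 (he0 x hx2)

end Profile

/-! ### Functions given by power series in exp (−μ x) -/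

namespace AbsSeries

/-- The Euler operator `z d/dz` applied to the sum of a series. -/
def euler (z : ℂ) (a : AbsSeries) : ℂ := ∑' n : ℕ, n * coeff n a * z ^ n

lemma summable_euler (a : AbsSeries) {z : ℂ} (hz : ‖z‖ < 1) :
    Summable fun n : ℕ => (n : ℂ) * coeff n a * z ^ n := by
  have h := summable_pow_mul_geometric_of_norm_lt_one 1 hz
  refine Summable.of_norm ((h.norm.mul_left ‖a‖).of_nonneg_of_le (fun _ => norm_nonneg _) fun n => ?_)
  have hn : ‖coeff n a‖ ≤ ‖a‖ := by
    rw [norm_eq_tsum]; exact a.summable_coeff.le_tsum n fun _ _ => norm_nonneg _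
  calc ‖(n : ℂ) * coeff n a * z ^ n‖ = ‖coeff n a‖ * ‖(n : ℂ) ^ 1 * z ^ n‖ := by
        simp only [norm_mul, pow_one]; ring
    _ ≤ _ := by gcongr

/-- For the variable z = exp (b x) / d one has d/dx = b z d/dz, which turns differential equations
in x into equations between coefficients. The strict inequality is needed because the differentiated
series may diverge on the unit circle. -/
lemma hasDerivAt_eval_exp (a : AbsSeries) (b d : ℂ) {x : ℂ} (hx : ‖Complex.exp (b * x) / d‖ < 1) :
    HasDerivAt (fun y => eval (Complex.exp (b * y) / d) a)
      (b * euler (Complex.exp (b * x) / d) a) x := by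
  have hev : AnalyticAt ℂ (fun z => eval z a) (Complex.exp (b * x) / d) :=
    AnalyticAt.comp (f := fun z : ℂ => (z, a)) (analyticAt_eval hx a)
      (analyticAt_id.prod analyticAt_const)
  obtain ⟨r, hr1, hr2⟩ := exists_between (max_lt hx zero_lt_one)
  have hr0 : 0 < r := (le_max_right _ _).trans_lt hr1
  have hxr : ‖Complex.exp (b * x) / d‖ < r := (le_max_left _ _).trans_lt hr1
  have hs : Summable fun n : ℕ => ‖a‖ * (n * r ^ (n - 1)) := by
    have h : Summable fun n : ℕ => (n : ℝ) ^ 1 * r ^ n :=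
      summable_pow_mul_geometric_of_norm_lt_one 1 (by rwa [Real.norm_of_nonneg hr0.le])
    refine Summable.mul_left _ ((h.mul_left r⁻¹).congr fun n => ?_)
    rcases n with _ | n
    · simp
    · simp only [Nat.add_sub_cancel, pow_succ]; field_simp
  have hcoef : ∀ n, ‖coeff n a‖ ≤ ‖a‖ := fun n => by
    rw [norm_eq_tsum]; exact a.summable_coeff.le_tsum n fun _ _ => norm_nonneg _
  have hd : HasDerivAt (fun z => eval z a)
      (∑' n, coeff n a * (n * (Complex.exp (b * x) / d) ^ (n - 1))) (Complex.exp (b * x) / d) := by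
    refine hasDerivAt_tsum_of_isPreconnected (t := Metric.ball 0 r) hs Metric.isOpen_ball
      (convex_ball _ _).isPreconnected
      (fun n y _ => (hasDerivAt_pow n y).const_mul (coeff n a)) (fun n y hy => ?_)
      (Metric.mem_ball_self hr0) (a.summable_norm_term (by simp)).of_norm
      (by simpa using hxr)
    rw [mem_ball_zero_iff] at hy
    rw [norm_mul, norm_mul, norm_pow, Complex.norm_natCast]
    have := hcoef n
    gcongr
  have he : HasDerivAt (fun y => Complex.exp (b * y) / d) (b * (Complex.exp (b * x) / d)) x := by
    refine (((hasDerivAt_id x).const_mul b).cexp.div_const d).congr_deriv ?_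
    simp only [id]; ring
  refine (hd.comp x he).congr_deriv ?_
  rw [mul_comm, mul_assoc]
  congr 1
  rw [euler, ← tsum_mul_left]
  refine tsum_congr fun n => ?_
  rcases n with _ | n
  · simp
  · simp only [Nat.add_sub_cancel, pow_succ]; ring

end AbsSeries

open AbsSeries in
/-- The function `f ζ x` is, for `ζ` near `ζ₀` and `Re x` large, the sum of a power series in
`exp (-μ x)` with constant term tending to `c`, depending analytically on `ζ`. -/
def HasExpLimit (μ : ℝ) (ζ₀ : ℂ) (f : ℂ → ℂ → ℂ) (c : ℂ) : Prop :=
  ∃ a : ℝ × ℂ → AbsSeries,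
    Filter.Tendsto a (𝓝[>] 0 ×ˢ 𝓝 ζ₀) (𝓝 (algebraMap ℂ AbsSeries c)) ∧
    ∀ᶠ q in 𝓝[>] (0 : ℝ) ×ˢ 𝓝 ζ₀, AnalyticAt ℂ (fun ζ => a (q.1, ζ)) q.2 ∧
      ∀ x : ℂ, ‖Complex.exp (-μ * x)‖ ≤ q.1 → f q.2 x = eval (Complex.exp (-μ * x) / q.1) (a q)

namespace HasExpLimit

open AbsSeries

variable {μ : ℝ} {ζ₀ : ℂ} {f g : ℂ → ℂ → ℂ} {c d : ℂ}

lemma eventually_pos : ∀ᶠ q in 𝓝[>] (0 : ℝ) ×ˢ 𝓝 ζ₀, 0 < q.1 :=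
  Filter.tendsto_fst.eventually self_mem_nhdsWithin

lemma norm_div_le_one {w : ℂ} {ρ : ℝ} (hρ : 0 < ρ) (hw : ‖w‖ ≤ ρ) : ‖w / (ρ : ℂ)‖ ≤ 1 := by
  rw [norm_div, Complex.norm_real, Real.norm_of_nonneg hρ.le]
  exact div_le_one_of_le₀ hw hρ.le

lemma congr_limit (hf : HasExpLimit μ ζ₀ f c) (h : c = d) : HasExpLimit μ ζ₀ f d := h ▸ hf

lemma congr_fun (hf : HasExpLimit μ ζ₀ f c) (h : ∀ ζ x, f ζ x = g ζ x) : HasExpLimit μ ζ₀ g c := by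
  obtain rfl : f = g := funext fun ζ => funext fun x => h ζ x
  exact hf

lemma of_analyticAt {φ : ℂ → ℂ} (hφ : AnalyticAt ℂ φ ζ₀) :
    HasExpLimit μ ζ₀ (fun ζ _ => φ ζ) (φ ζ₀) := by
  have hcont : Continuous (algebraMap ℂ AbsSeries) := algebraMapCLM ℂ AbsSeries |>.continuous
  refine ⟨fun q => algebraMap ℂ AbsSeries (φ q.2),
    (hcont.tendsto _).comp (hφ.continuousAt.tendsto.comp Filter.tendsto_snd), ?_⟩
  filter_upwards [eventually_pos, Filter.tendsto_snd.eventually hφ.eventually_analyticAt]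
    with q hq hqa
  refine ⟨((algebraMapCLM ℂ AbsSeries).analyticAt _).comp hqa, fun x hx => ?_⟩
  exact ((evalHom _ (norm_div_le_one hq hx)).commutes (φ q.2)).symm

lemma const (c : ℂ) : HasExpLimit μ ζ₀ (fun _ _ => c) c :=
  of_analyticAt (φ := fun _ => c) analyticAt_const

lemma param : HasExpLimit μ ζ₀ (fun ζ _ => ζ) ζ₀ := of_analyticAt (φ := fun ζ => ζ) analyticAt_id

lemma add (hf : HasExpLimit μ ζ₀ f c) (hg : HasExpLimit μ ζ₀ g d) :
    HasExpLimit μ ζ₀ (fun ζ x => f ζ x + g ζ x) (c + d) := by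
  obtain ⟨a, ha, hae⟩ := hf
  obtain ⟨b, hb, hbe⟩ := hg
  refine ⟨fun q => a q + b q, by rw [map_add]; exact ha.add hb, ?_⟩
  filter_upwards [eventually_pos, hae, hbe] with q hq hqa hqb
  refine ⟨hqa.1.add hqb.1, fun x hx => ?_⟩
  rw [hqa.2 x hx, hqb.2 x hx]
  exact (map_add (evalHom _ (norm_div_le_one hq hx)) _ _).symm

lemma mul (hf : HasExpLimit μ ζ₀ f c) (hg : HasExpLimit μ ζ₀ g d) :
    HasExpLimit μ ζ₀ (fun ζ x => f ζ x * g ζ x) (c * d) := by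
  obtain ⟨a, ha, hae⟩ := hf
  obtain ⟨b, hb, hbe⟩ := hg
  refine ⟨fun q => a q * b q, by rw [map_mul]; exact ha.mul hb, ?_⟩
  filter_upwards [eventually_pos, hae, hbe] with q hq hqa hqb
  refine ⟨hqa.1.mul hqb.1, fun x hx => ?_⟩
  rw [hqa.2 x hx, hqb.2 x hx]
  exact (map_mul (evalHom _ (norm_div_le_one hq hx)) _ _).symm

lemma neg (hf : HasExpLimit μ ζ₀ f c) : HasExpLimit μ ζ₀ (fun ζ x => -f ζ x) (-c) :=
  (((const (-1)).mul hf).congr_fun fun _ _ => by ring).congr_limit (by ring)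

lemma sub (hf : HasExpLimit μ ζ₀ f c) (hg : HasExpLimit μ ζ₀ g d) :
    HasExpLimit μ ζ₀ (fun ζ x => f ζ x - g ζ x) (c - d) :=
  ((hf.add hg.neg).congr_fun fun _ _ => by ring).congr_limit (by ring)

lemma pow (hf : HasExpLimit μ ζ₀ f c) (n : ℕ) :
    HasExpLimit μ ζ₀ (fun ζ x => f ζ x ^ n) (c ^ n) := by
  induction n with
  | zero => simpa using const 1
  | succ n ih => simpa only [pow_succ] using ih.mul hf

lemma isUnit_algebraMap (hc : c ≠ 0) : IsUnit (algebraMap ℂ AbsSeries c) :=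
  (IsUnit.mk0 c hc).map _

lemma inv (hf : HasExpLimit μ ζ₀ f c) (hc : c ≠ 0) : HasExpLimit μ ζ₀ (fun ζ x => (f ζ x)⁻¹) c⁻¹ := by
  obtain ⟨a, ha, hae⟩ := hf
  have hinv : Ring.inverse (algebraMap ℂ AbsSeries c) = algebraMap ℂ AbsSeries c⁻¹ := by
    have h1 : algebraMap ℂ AbsSeries c * algebraMap ℂ AbsSeries c⁻¹ = 1 := by
      rw [← map_mul, mul_inv_cancel₀ hc, map_one]
    have h2 := Ring.inverse_mul_cancel _ (isUnit_algebraMap hc)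
    calc _ = Ring.inverse (algebraMap ℂ AbsSeries c) *
          (algebraMap ℂ AbsSeries c * algebraMap ℂ AbsSeries c⁻¹) := by rw [h1, mul_one]
      _ = _ := by rw [← mul_assoc, h2, one_mul]
  have hcont : ContinuousAt Ring.inverse (algebraMap ℂ AbsSeries c) := by
    obtain ⟨w, hw⟩ := isUnit_algebraMap hc
    rw [← hw]; exact NormedRing.inverse_continuousAt w
  refine ⟨fun q => Ring.inverse (a q), by rw [← hinv]; exact hcont.tendsto.comp ha, ?_⟩
  filter_upwards [eventually_pos, hae,
    ha.eventually (Units.isOpen.mem_nhds (isUnit_algebraMap hc))] with q hq hqa hqu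
  have hqu' : IsUnit (a q) := hqu
  refine ⟨?_, fun x hx => ?_⟩
  · obtain ⟨w, hw⟩ := hqu'
    refine AnalyticAt.comp (g := Ring.inverse) (f := fun ζ => a (q.1, ζ)) ?_ hqa.1
    change AnalyticAt ℂ Ring.inverse (a q)
    rw [← hw]; exact analyticAt_inverse w
  · rw [hqa.2 x hx]
    refine inv_eq_of_mul_eq_one_right ?_
    have h1 := congrArg (evalHom _ (norm_div_le_one hq hx)) (Ring.mul_inverse_cancel _ hqu')
    rw [map_mul, map_one] at h1
    exact h1

lemma div (hf : HasExpLimit μ ζ₀ f c) (hg : HasExpLimit μ ζ₀ g d) (hd : d ≠ 0) :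
    HasExpLimit μ ζ₀ (fun ζ x => f ζ x / g ζ x) (c / d) := by
  simpa only [div_eq_mul_inv] using hf.mul (hg.inv hd)

lemma sum {ι : Type*} {s : Finset ι} {f : ι → ℂ → ℂ → ℂ} {c : ι → ℂ}
    (hf : ∀ i ∈ s, HasExpLimit μ ζ₀ (f i) (c i)) :
    HasExpLimit μ ζ₀ (fun ζ x => ∑ i ∈ s, f i ζ x) (∑ i ∈ s, c i) := by
  classical
  induction s using Finset.induction_on with
  | empty => simpa using const 0
  | insert i s hi ih =>
    simp only [Finset.sum_insert hi]
    exact (hf i (Finset.mem_insert_self i s)).add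
      (ih fun j hj => hf j (Finset.mem_insert_of_mem hj))

lemma prod {ι : Type*} {s : Finset ι} {f : ι → ℂ → ℂ → ℂ} {c : ι → ℂ}
    (hf : ∀ i ∈ s, HasExpLimit μ ζ₀ (f i) (c i)) :
    HasExpLimit μ ζ₀ (fun ζ x => ∏ i ∈ s, f i ζ x) (∏ i ∈ s, c i) := by
  classical
  induction s using Finset.induction_on with
  | empty => simpa using const 1
  | insert i s hi ih =>
    simp only [Finset.prod_insert hi]
    exact (hf i (Finset.mem_insert_self i s)).mul
      (ih fun j hj => hf j (Finset.mem_insert_of_mem hj))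

lemma tendsto_exp (hμ : 0 < μ) :
    Filter.Tendsto (fun M : ℝ => Real.exp (-μ * M)) Filter.atTop (𝓝[>] 0) := by
  refine tendsto_nhdsWithin_iff.2 ⟨?_, Filter.Eventually.of_forall fun M => Real.exp_pos _⟩
  refine Real.tendsto_exp_atBot.comp ?_
  exact Filter.tendsto_id.const_mul_atTop_of_neg (neg_lt_zero.2 hμ)

lemma norm_exp (μ : ℝ) (x : ℂ) : ‖Complex.exp (-μ * x)‖ = Real.exp (-μ * x.re) := by
  rw [Complex.norm_exp]; simp

lemma norm_exp_lt (hμ : 0 < μ) {M : ℝ} {x : ℂ} (hx : M < x.re) :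
    ‖Complex.exp (-μ * x)‖ < Real.exp (-μ * M) := by
  rw [norm_exp]
  exact Real.exp_lt_exp.2 (by nlinarith)

/-- Eventual properties, in terms of half-planes. -/
lemma eventually_atTop_of_prod (hμ : 0 < μ) {Pr : ℝ → ℂ → Prop}
    (h : ∀ᶠ q in 𝓝[>] (0 : ℝ) ×ˢ 𝓝 ζ₀, Pr q.1 q.2) :
    ∀ᶠ M in Filter.atTop, ∀ᶠ ζ in 𝓝 ζ₀, Pr (Real.exp (-μ * M)) ζ :=
  (tendsto_exp hμ).eventually h.curry

lemma eventually_differentiableAt (hμ : 0 < μ) (hf : HasExpLimit μ ζ₀ f c) :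
    ∀ᶠ M in Filter.atTop, ∀ᶠ ζ in 𝓝 ζ₀, ∀ x : ℂ, M < x.re → DifferentiableAt ℂ (f ζ) x := by
  obtain ⟨a, ha, hae⟩ := hf
  have h := eventually_atTop_of_prod (Pr := fun ρ ζ => ∀ x : ℂ, ‖Complex.exp (-μ * x)‖ ≤ ρ →
    f ζ x = eval (Complex.exp (-μ * x) / ρ) (a (ρ, ζ))) hμ (hae.mono fun q hq => hq.2)
  filter_upwards [h] with M hM
  filter_upwards [hM] with ζ hζ x hx
  have hw : ‖Complex.exp (-μ * x) / (Real.exp (-μ * M) : ℝ)‖ < 1 := by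
    rw [norm_div, Complex.norm_real, Real.norm_of_nonneg (Real.exp_pos _).le,
      div_lt_one (Real.exp_pos _)]
    exact norm_exp_lt hμ hx
  refine ((hasDerivAt_eval_exp (a (Real.exp (-μ * M), ζ)) (-μ) _ hw).differentiableAt).congr_of_eventuallyEq ?_
  filter_upwards [(isOpen_lt continuous_const Complex.continuous_re).mem_nhds hx] with y hy
  exact hζ y (norm_exp_lt hμ hy).le

/-- For small ρ the series is close to a nonzero constant, hence a unit of the Banach algebra.
Evaluation is a homomorphism and sends units to nonzero numbers, at all x of the half-plane
simultaneously. -/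
lemma eventually_ne_zero (hμ : 0 < μ) (hf : HasExpLimit μ ζ₀ f c) (hc : c ≠ 0) :
    ∀ᶠ M in Filter.atTop, ∀ᶠ ζ in 𝓝 ζ₀, ∀ x : ℂ, M < x.re → f ζ x ≠ 0 := by
  obtain ⟨a, ha, hae⟩ := hf
  have h := eventually_atTop_of_prod (Pr := fun ρ ζ => 0 < ρ ∧ (∀ x : ℂ, ‖Complex.exp (-μ * x)‖ ≤ ρ →
    f ζ x = eval (Complex.exp (-μ * x) / ρ) (a (ρ, ζ))) ∧ IsUnit (a (ρ, ζ))) hμ (by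
      filter_upwards [eventually_pos, hae,
        ha.eventually (Units.isOpen.mem_nhds (isUnit_algebraMap hc))] with q h1 h2 h3
      exact ⟨h1, h2.2, h3⟩)
  filter_upwards [h] with M hM
  filter_upwards [hM] with ζ hζ x hx
  have hle := (norm_exp_lt hμ hx).le
  rw [hζ.2.1 x hle]
  exact (hζ.2.2.map (evalHom _ (norm_div_le_one hζ.1 hle))).ne_zero

/-- The Euler operator is unbounded on ℓ¹. The derivative at scale ρ is therefore read off the
series at scale 2ρ: passing to the smaller disc multiplies the n-th coefficient by 2⁻ⁿ, and n 2⁻ⁿ is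
bounded. The constant term is killed, so the limit is 0. -/
lemma deriv (hf : HasExpLimit μ ζ₀ f c) :
    HasExpLimit μ ζ₀ (fun ζ x => deriv (f ζ) x) 0 := by
  obtain ⟨a, ha, hae⟩ := hf
  let t : ℕ → ℂ := fun n => -μ * (n * (1 / 2) ^ n)
  have ht : ∃ C, ∀ n, ‖t n‖ ≤ C := by
    have h : Summable fun n : ℕ => (n : ℂ) ^ 1 * (1 / 2 : ℂ) ^ n :=
      summable_pow_mul_geometric_of_norm_lt_one 1 (by norm_num)
    obtain ⟨C, hC⟩ := ((h.mul_left (-μ : ℂ)).tendsto_atTop_zero.norm).bddAbove_range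
    exact ⟨C, fun n => by simpa [t] using hC (Set.mem_range_self n)⟩
  obtain ⟨C, hC⟩ := ht
  have h2 : Filter.Tendsto (fun q : ℝ × ℂ => (2 * q.1, q.2)) (𝓝[>] 0 ×ˢ 𝓝 ζ₀) (𝓝[>] 0 ×ˢ 𝓝 ζ₀) := by
    refine Filter.Tendsto.prodMk ?_ Filter.tendsto_snd
    refine Filter.Tendsto.comp (g := fun ρ : ℝ => 2 * ρ) (tendsto_nhdsWithin_iff.2 ⟨?_, ?_⟩)
      Filter.tendsto_fst
    · exact ((continuous_const.mul continuous_id).tendsto' (0 : ℝ) 0 (by simp)).mono_left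
        nhdsWithin_le_nhds
    · filter_upwards [self_mem_nhdsWithin] with ρ hρ
      exact mul_pos two_pos (Set.mem_Ioi.1 hρ)
  refine ⟨fun q => diag t (a (2 * q.1, q.2)), ?_, ?_⟩
  · have h3 : diag t (algebraMap ℂ AbsSeries c) = algebraMap ℂ AbsSeries 0 := by
      ext n
      rw [coeff_diag hC, coeff_algebraMap, coeff_algebraMap]
      rcases n with _ | n <;> simp [t]
    rw [← h3]
    exact ((diag t).continuous.tendsto _).comp (ha.comp h2)
  · filter_upwards [eventually_pos, h2.eventually hae] with q hq hqa
    refine ⟨((diag t).analyticAt _).comp hqa.1, fun x hx => ?_⟩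
    have hw : ‖Complex.exp (-μ * x) / (2 * q.1 : ℝ)‖ < 1 := by
      rw [norm_div, Complex.norm_real, Real.norm_of_nonneg (by positivity), div_lt_one (by positivity)]
      linarith
    have hd := (hasDerivAt_eval_exp (a (2 * q.1, q.2)) (-μ) _ hw).congr_of_eventuallyEq
      (f₁ := f q.2) (by
        have hopen : IsOpen {y : ℂ | ‖Complex.exp (-μ * y)‖ < 2 * q.1} :=
          isOpen_lt (by fun_prop) continuous_const
        filter_upwards [hopen.mem_nhds (show ‖Complex.exp (-μ * x)‖ < 2 * q.1 by linarith)] with y hy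
        exact hqa.2 y (le_of_lt hy))
    rw [hd.deriv, euler, eval, ← tsum_mul_left]
    refine tsum_congr fun n => ?_
    rw [coeff_diag hC]
    have e : Complex.exp (-μ * x) / (q.1 : ℂ) = 2 * (Complex.exp (-μ * x) / (2 * q.1 : ℝ)) := by
      have : (q.1 : ℂ) ≠ 0 := Complex.ofReal_ne_zero.2 hq.ne'
      push_cast; field_simp
    rw [e, mul_pow]
    simp only [t, one_div, inv_pow]
    have : (2 : ℂ) ^ n ≠ 0 := pow_ne_zero _ two_ne_zero
    field_simp

end HasExpLimit

open AbsSeries in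
/-- Analytic functions of the real decaying exponential extend to a half-plane. -/
lemma exists_hasExpLimit_of_analyticAt {g : ℝ → ℝ} (hg : AnalyticAt ℝ g 0) {μ : ℝ} (hμ : 0 < μ) :
    ∃ f : ℂ → ℂ, (∀ᶠ x : ℝ in Filter.atTop, f x = (g (Real.exp (-μ * x)) : ℂ)) ∧
      ∀ ζ₀, HasExpLimit μ ζ₀ (fun _ => f) (g 0) := by
  obtain ⟨p, hp⟩ := hg
  obtain ⟨r, hr0, hrlt⟩ := ENNReal.lt_iff_exists_nnreal_btwn.1 hp.radius_pos
  have hr : (0 : ℝ) < r := by exact_mod_cast hr0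
  have hs : Summable fun n => ‖(p.coeff n : ℂ)‖ * (r : ℝ) ^ n := by
    refine (p.summable_norm_mul_pow hrlt).congr fun n => ?_
    rw [FormalMultilinearSeries.norm_apply_eq_norm_coef, Complex.norm_real]
  have hb : ∀ ρ : ℝ, 0 ≤ ρ → ρ ≤ r → Summable fun n => ‖(p.coeff n : ℂ) * (ρ : ℂ) ^ n‖ :=
    fun ρ h0 h1 => hs.of_nonneg_of_le (fun _ => norm_nonneg _) fun n => by
      rw [norm_mul, norm_pow, Complex.norm_real (ρ : ℝ), Real.norm_of_nonneg h0]
      gcongr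
  have hc0 : p.coeff 0 = g 0 := by
    rw [FormalMultilinearSeries.coeff]
    exact hp.coeff_zero _
  classical
  -- Rescaling the disc of radius ρ to the unit disc multiplies the n-th coefficient by ρⁿ. The
  -- value 0 for other ρ plays no role, since only ρ → 0⁺ matters.
  let a : ℝ × ℂ → AbsSeries := fun q =>
    if h : 0 ≤ q.1 ∧ q.1 ≤ (r : ℝ) then ofSummable (fun n => (p.coeff n : ℂ) * (q.1 : ℂ) ^ n) (hb q.1 h.1 h.2)
    else 0
  refine ⟨fun x => ∑' n, (p.coeff n : ℂ) * Complex.exp (-μ * x) ^ n, ?_, fun ζ₀ => ⟨a, ?_, ?_⟩⟩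
  · have h1 := hp.eventually_hasSum
    filter_upwards [((HasExpLimit.tendsto_exp hμ).mono_right nhdsWithin_le_nhds).eventually h1]
      with x hx
    rw [zero_add] at hx
    rw [← hx.tsum_eq, Complex.ofReal_tsum]
    refine tsum_congr fun n => ?_
    rw [FormalMultilinearSeries.apply_eq_pow_smul_coeff]
    rw [smul_eq_mul]
    push_cast
    ring
  · rw [tendsto_iff_norm_sub_tendsto_zero]
    have hmem : ∀ᶠ q in 𝓝[>] (0 : ℝ) ×ˢ 𝓝 ζ₀, 0 < q.1 ∧ q.1 ≤ (r : ℝ) := by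
      refine Filter.tendsto_fst.eventually (p := fun ρ : ℝ => 0 < ρ ∧ ρ ≤ (r : ℝ)) ?_
      filter_upwards [self_mem_nhdsWithin, nhdsWithin_le_nhds (Iic_mem_nhds hr)] with ρ h1 h2
      exact ⟨h1, h2⟩
    have hlim : Filter.Tendsto (fun q : ℝ × ℂ => q.1 / r * ∑' n, ‖(p.coeff n : ℂ) * (r : ℂ) ^ n‖)
        (𝓝[>] 0 ×ˢ 𝓝 ζ₀) (𝓝 0) := by
      have : Filter.Tendsto (fun q : ℝ × ℂ => q.1) (𝓝[>] 0 ×ˢ 𝓝 ζ₀) (𝓝 0) :=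
        Filter.tendsto_fst.mono_right nhdsWithin_le_nhds
      simpa using (this.div_const (r : ℝ)).mul_const (∑' n, ‖(p.coeff n : ℂ) * (r : ℂ) ^ n‖)
    refine squeeze_zero' (Filter.Eventually.of_forall fun _ => norm_nonneg _) ?_ hlim
    filter_upwards [hmem] with q hq
    rw [norm_eq_tsum, ← tsum_mul_left]
    refine Summable.tsum_le_tsum (fun n => ?_) (summable_coeff _)
      ((hb r hr.le le_rfl).mul_left _)
    simp only [a, dif_pos (show 0 ≤ q.1 ∧ q.1 ≤ (r : ℝ) from ⟨hq.1.le, hq.2⟩), map_sub, coeff_ofSummable,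
      coeff_algebraMap]
    rcases n with _ | n
    · simp only [pow_zero, mul_one, if_true, hc0, sub_self, norm_zero]
      have := hq.1
      positivity
    · simp only [Nat.add_eq_zero_iff, one_ne_zero, and_false, if_false, sub_zero, norm_mul, norm_pow,
        Complex.norm_real, Real.norm_of_nonneg hq.1.le, Real.norm_of_nonneg hr.le]
      -- From each term with positive index one factor ρ/r comes out, so the distance to the
      -- constant series is O(ρ).
      have hle : q.1 ^ (n + 1) ≤ q.1 / r * (r : ℝ) ^ (n + 1) := by
        have h1 := hq.1
        calc q.1 ^ (n + 1) = q.1 * q.1 ^ n := by ring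
          _ ≤ q.1 * (r : ℝ) ^ n := by gcongr; exact hq.2
          _ = _ := by field_simp; ring
      calc _ ≤ ‖p.coeff (n + 1)‖ * (q.1 / r * (r : ℝ) ^ (n + 1)) := by gcongr
        _ = _ := by ring
  · have hmem : ∀ᶠ q in 𝓝[>] (0 : ℝ) ×ˢ 𝓝 ζ₀, 0 < q.1 ∧ q.1 ≤ (r : ℝ) := by
      refine Filter.tendsto_fst.eventually (p := fun ρ : ℝ => 0 < ρ ∧ ρ ≤ (r : ℝ)) ?_
      filter_upwards [self_mem_nhdsWithin, nhdsWithin_le_nhds (Iic_mem_nhds hr)] with ρ h1 h2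
      exact ⟨h1, h2⟩
    filter_upwards [hmem] with q hq
    refine ⟨(analyticAt_const : AnalyticAt ℂ (fun _ => a (q.1, 0)) q.2), fun x hx => ?_⟩
    rw [eval]
    refine tsum_congr fun n => ?_
    simp only [a, dif_pos (show 0 ≤ q.1 ∧ q.1 ≤ (r : ℝ) from ⟨hq.1.le, hq.2⟩), coeff_ofSummable]
    have : (q.1 : ℂ) ≠ 0 := Complex.ofReal_ne_zero.2 hq.1.ne'
    rw [mul_assoc, ← mul_pow, mul_div_cancel₀ _ this]


/-! ### Bounded solutions of Riccati equations with exponentially converging coefficients -/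

namespace AbsSeries

lemma norm_algebraMap_eq (c : ℂ) : ‖algebraMap ℂ AbsSeries c‖ = ‖c‖ := by
  rw [norm_eq_tsum, tsum_eq_single 0]
  · simp [coeff_algebraMap]
  · intro n hn; simp [coeff_algebraMap, hn]

lemma eval_add_euler_eq {a b : AbsSeries} {l ν h : ℂ}
    (hab : ∀ k : ℕ, (l + ν * k * h) * coeff k a = coeff k b) {z : ℂ} (hz : ‖z‖ < 1) :
    l * eval z a + ν * h * euler z a = eval z b := by
  rw [eval, eval, euler, ← tsum_mul_left, ← tsum_mul_left, ← Summable.tsum_add]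
  · refine tsum_congr fun k => ?_
    rw [← hab k]; ring
  · exact (a.summable_norm_term hz.le).of_norm.mul_left l
  · exact (a.summable_euler hz).mul_left _

end AbsSeries

open AbsSeries in
-- As ρ → 0 the norm of the whole series tends to the modulus of its limit at infinity. Hence strict
-- bounds on the limits alone become bounds in ℓ¹; this is the reason for keeping the radius as a
-- parameter.
lemma HasExpLimit.exists_matrix {m n : Type*} [Fintype m] [Fintype n] {μ : ℝ} {ζ₀ : ℂ}
    {A : ℂ → ℂ → Matrix m n ℂ} {c : m → n → ℂ}
    (hA : ∀ i j, HasExpLimit μ ζ₀ (fun ζ x => A ζ x i j) (c i j)) :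
    ∃ a : ℝ × ℂ → Matrix m n AbsSeries,
      (∀ K, (∀ i j, ‖c i j‖ < K) → ∀ᶠ q in 𝓝[>] (0 : ℝ) ×ˢ 𝓝 ζ₀, ∀ i j, ‖a q i j‖ ≤ K) ∧
      ∀ᶠ q in 𝓝[>] (0 : ℝ) ×ˢ 𝓝 ζ₀, ∀ i j, AnalyticAt ℂ (fun ζ => a (q.1, ζ) i j) q.2 ∧
        ∀ x : ℂ, ‖Complex.exp (-μ * x)‖ ≤ q.1 →
          A q.2 x i j = eval (Complex.exp (-μ * x) / q.1) (a q i j) := by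
  unfold HasExpLimit at hA
  choose a ha hae using hA
  refine ⟨fun q => Matrix.of fun i j => a i j q, fun K hK => ?_, ?_⟩
  · refine Filter.eventually_all.2 fun i => Filter.eventually_all.2 fun j => ?_
    have h1 := (ha i j).norm
    rw [norm_algebraMap_eq] at h1
    exact (h1.eventually (gt_mem_nhds (hK i j))).mono fun q hq => le_of_lt hq
  · exact Filter.eventually_all.2 fun i => Filter.eventually_all.2 fun j => hae i j

lemma exists_norm_lt {m n : Type*} [Fintype m] [Fintype n] (c : m → n → ℂ) :
    ∃ K : ℝ, 0 < K ∧ ∀ i j, ‖c i j‖ < K := by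
  refine ⟨‖c‖ + 1, by positivity, fun i j => ?_⟩
  have := (norm_le_pi_norm (c i) j).trans (norm_le_pi_norm c i)
  linarith

/-- No small divisors: `l` close to the imaginary axis and away from `0`. -/
lemma le_norm_add_of_sector {l h : ℂ} {B t : ℝ} (him : 3 / 4 * B ≤ |l.im|) (hre : |l.re| ≤ B / 4)
    (hh : |h.im| ≤ h.re) (ht : 0 ≤ t) : B / 4 ≤ ‖l + t * h‖ := by
  -- As long as t Re h ≤ B/2, the imaginary part of l + t h keeps at least 3B/4 − B/2; beyond that,
  -- the real part is at least B/2 − B/4.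
  rcases le_total (t * h.re) (B / 2) with h1 | h1
  · have e : (l + t * h).im = l.im + t * h.im := by simp
    have h2 : |t * h.im| ≤ t * h.re := by
      rw [abs_mul, abs_of_nonneg ht]; gcongr
    have h3 := abs_sub_abs_le_abs_sub l.im (-(t * h.im))
    rw [abs_neg, sub_neg_eq_add, ← e] at h3
    linarith [Complex.abs_im_le_norm (l + t * h)]
  · have e : (l + t * h).re = l.re + t * h.re := by simp
    have h3 := Complex.re_le_norm (l + t * h)
    linarith [neg_abs_le l.re]

open AbsSeries in
/-- Solutions, bounded uniformly in `h`, of matrix Riccati equations with exponentially converging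
coefficients and a purely imaginary principal part. -/
lemma exists_bounded_riccati_solution {m n : Type*} [Fintype m] [Fintype n] {μ : ℝ} (hμ : 0 < μ)
    {ζ₀ : ℂ} {l : ℂ → ℂ} (hl : AnalyticAt ℂ l ζ₀) {B : ℝ} (hB : B ≠ 0) (hlB : l ζ₀ = B * Complex.I)
    {A₀ A₁ : ℂ → ℂ → Matrix m m ℂ} {Q₀ Q₁ : ℂ → ℂ → Matrix n n ℂ} {f : ℂ → ℂ → Matrix m n ℂ}
    {S : ℂ → ℂ → Matrix n m ℂ} {a₀ a₁ : m → m → ℂ} {q₀ q₁ : n → n → ℂ} {cf : m → n → ℂ}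
    {cS : n → m → ℂ} {ε : ℝ} (hε : 0 ≤ ε)
    (hεB : ((Fintype.card m : ℝ) + Fintype.card n) * ε ≤ |B| / 16)
    (hA₀ : ∀ i j, HasExpLimit μ ζ₀ (fun ζ x => A₀ ζ x i j) (a₀ i j)) (ha₀ : ∀ i j, ‖a₀ i j‖ < ε)
    (hA₁ : ∀ i j, HasExpLimit μ ζ₀ (fun ζ x => A₁ ζ x i j) (a₁ i j))
    (hQ₀ : ∀ i j, HasExpLimit μ ζ₀ (fun ζ x => Q₀ ζ x i j) (q₀ i j)) (hq₀ : ∀ i j, ‖q₀ i j‖ < ε)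
    (hQ₁ : ∀ i j, HasExpLimit μ ζ₀ (fun ζ x => Q₁ ζ x i j) (q₁ i j))
    (hf : ∀ i j, HasExpLimit μ ζ₀ (fun ζ x => f ζ x i j) (cf i j))
    (hS : ∀ i j, HasExpLimit μ ζ₀ (fun ζ x => S ζ x i j) (cS i j)) :
    ∃ M h₀ K : ℝ, 0 < h₀ ∧ ∃ ω : Set ℂ, IsOpen ω ∧ ζ₀ ∈ ω ∧
    ∃ (α : ℂ → ℂ → ℂ → Matrix m n ℂ) (αInf : ℂ → ℂ → Matrix m n ℂ),
      ∀ ζ ∈ ω, ∀ h : ℝ, 0 < h → h < h₀ → ∀ x : ℂ, M < x.re → ∀ i j,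
        AnalyticAt ℂ (fun q : ℂ × ℂ × ℂ => α q.1 q.2.1 q.2.2 i j) (x, ζ, h) ∧
        ‖α x ζ h i j‖ ≤ K ∧
        ‖α x ζ h i j - αInf ζ h i j‖ ≤ K * Real.exp (-μ * x.re) ∧
        (h : ℂ) * deriv (fun y => α y ζ h i j) x =
          (l ζ • α x ζ h - ((A₀ ζ x + (h : ℂ) • A₁ ζ x) * α x ζ h
            + α x ζ h * (Q₀ ζ x + (h : ℂ) • Q₁ ζ x) + f ζ x
            + α x ζ h * ((h : ℂ) ^ 2 • S ζ x) * α x ζ h)) i j := by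
  have hB0 : 0 < |B| := abs_pos.2 hB
  obtain ⟨sA₀, bA₀, eA₀⟩ := HasExpLimit.exists_matrix hA₀
  obtain ⟨sA₁, bA₁, eA₁⟩ := HasExpLimit.exists_matrix hA₁
  obtain ⟨sQ₀, bQ₀, eQ₀⟩ := HasExpLimit.exists_matrix hQ₀
  obtain ⟨sQ₁, bQ₁, eQ₁⟩ := HasExpLimit.exists_matrix hQ₁
  obtain ⟨sf, bf, ef⟩ := HasExpLimit.exists_matrix hf
  obtain ⟨sS, bS, eS⟩ := HasExpLimit.exists_matrix hS
  obtain ⟨K₁, hK₁, hK₁'⟩ := exists_norm_lt a₁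
  obtain ⟨K₂, hK₂, hK₂'⟩ := exists_norm_lt q₁
  obtain ⟨K₃, hK₃, hK₃'⟩ := exists_norm_lt cf
  obtain ⟨K₄, hK₄, hK₄'⟩ := exists_norm_lt cS
  set K : ℝ := K₁ + K₂ + K₃ + K₄ with hK
  have hK0 : 0 < K := by positivity
  set c : ℝ := |B| / 4 with hc
  have hc0 : 0 < c := by positivity
  -- With this radius the bound K on the forcing is exactly c R / 4.
  set R : ℝ := 4 * K / c with hR
  have hR0 : 0 < R := by positivity
  set N : ℝ := ((Fintype.card m : ℝ) + Fintype.card n)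
    + 2 * (Fintype.card m * Fintype.card n * R) with hN
  have hN0 : 0 ≤ N := by positivity
  -- All terms carrying a power of h contribute at most N h₀ K to the contraction constant. They get
  -- |B|/16, the order-zero terms get the other |B|/16, and together these are c/2. As h₀ ≤ 1, also
  -- |h|² ≤ h₀.
  set h₀ : ℝ := min 1 (|B| / 16 / (N * K + 1)) with hh₀
  have hh₀p : 0 < h₀ := lt_min one_pos (by positivity)
  have hh₀1 : h₀ ≤ 1 := min_le_left _ _
  have hh₀N : N * (h₀ * K) ≤ |B| / 16 := by
    have h1 : h₀ * (N * K + 1) ≤ |B| / 16 := (le_div_iff₀ (by positivity)).1 (min_le_right _ _)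
    nlinarith
  have hev := HasExpLimit.eventually_atTop_of_prod (ζ₀ := ζ₀) hμ (Pr := fun ρ ζ =>
    ((∀ i j, ‖sA₀ (ρ, ζ) i j‖ ≤ ε) ∧ (∀ i j, ‖sQ₀ (ρ, ζ) i j‖ ≤ ε)) ∧
    ((∀ i j, ‖sA₁ (ρ, ζ) i j‖ ≤ K) ∧ (∀ i j, ‖sQ₁ (ρ, ζ) i j‖ ≤ K)) ∧
    ((∀ i j, ‖sf (ρ, ζ) i j‖ ≤ K) ∧ (∀ i j, ‖sS (ρ, ζ) i j‖ ≤ K)) ∧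
    (∀ i j, AnalyticAt ℂ (fun ζ => sA₀ (ρ, ζ) i j) ζ ∧ ∀ x : ℂ, ‖Complex.exp (-μ * x)‖ ≤ ρ →
          A₀ ζ x i j = eval (Complex.exp (-μ * x) / ρ) (sA₀ (ρ, ζ) i j)) ∧
    (∀ i j, AnalyticAt ℂ (fun ζ => sA₁ (ρ, ζ) i j) ζ ∧ ∀ x : ℂ, ‖Complex.exp (-μ * x)‖ ≤ ρ →
          A₁ ζ x i j = eval (Complex.exp (-μ * x) / ρ) (sA₁ (ρ, ζ) i j)) ∧
    (∀ i j, AnalyticAt ℂ (fun ζ => sQ₀ (ρ, ζ) i j) ζ ∧ ∀ x : ℂ, ‖Complex.exp (-μ * x)‖ ≤ ρ →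
          Q₀ ζ x i j = eval (Complex.exp (-μ * x) / ρ) (sQ₀ (ρ, ζ) i j)) ∧
    (∀ i j, AnalyticAt ℂ (fun ζ => sQ₁ (ρ, ζ) i j) ζ ∧ ∀ x : ℂ, ‖Complex.exp (-μ * x)‖ ≤ ρ →
          Q₁ ζ x i j = eval (Complex.exp (-μ * x) / ρ) (sQ₁ (ρ, ζ) i j)) ∧
    (∀ i j, AnalyticAt ℂ (fun ζ => sf (ρ, ζ) i j) ζ ∧ ∀ x : ℂ, ‖Complex.exp (-μ * x)‖ ≤ ρ →
          f ζ x i j = eval (Complex.exp (-μ * x) / ρ) (sf (ρ, ζ) i j)) ∧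
    (∀ i j, AnalyticAt ℂ (fun ζ => sS (ρ, ζ) i j) ζ ∧ ∀ x : ℂ, ‖Complex.exp (-μ * x)‖ ≤ ρ →
          S ζ x i j = eval (Complex.exp (-μ * x) / ρ) (sS (ρ, ζ) i j))) (by
    filter_upwards [bA₀ ε ha₀, bQ₀ ε hq₀, bA₁ K fun i j => (hK₁' i j).trans (by linarith),
      bQ₁ K fun i j => (hK₂' i j).trans (by linarith), bf K fun i j => (hK₃' i j).trans (by linarith),
      bS K fun i j => (hK₄' i j).trans (by linarith), eA₀, eA₁, eQ₀, eQ₁, ef, eS]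
      with q h1 h2 h3 h4 h5 h6 h7 h8 h9 h10 h11 h12
    exact ⟨⟨h1, h2⟩, ⟨h3, h4⟩, ⟨h5, h6⟩, h7, h8, h9, h10, h11, h12⟩)
  obtain ⟨M, hM⟩ := hev.exists
  have hlim : ∀ᶠ ζ in 𝓝 ζ₀, 3 / 4 * |B| ≤ |(l ζ).im| ∧ |(l ζ).re| ≤ |B| / 4 := by
    have h1 : Filter.Tendsto (fun ζ => |(l ζ).im|) (𝓝 ζ₀) (𝓝 |B|) := by
      have := (Complex.continuous_im.continuousAt.comp hl.continuousAt).tendsto.abs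
      simpa [hlB] using this
    have h2 : Filter.Tendsto (fun ζ => |(l ζ).re|) (𝓝 ζ₀) (𝓝 0) := by
      have := (Complex.continuous_re.continuousAt.comp hl.continuousAt).tendsto.abs
      simpa [hlB] using this
    exact (h1.eventually (lt_mem_nhds (by linarith))).and
      (h2.eventually (gt_mem_nhds (show 0 < |B| / 4 by positivity))) |>.mono
      fun ζ h => ⟨h.1.le, h.2.le⟩
  obtain ⟨ω, hω, hωo, hζω⟩ := mem_nhds_iff.1 (hM.and (hlim.and hl.eventually_analyticAt))
  set ρ : ℝ := Real.exp (-μ * M) with hρ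
  have hρ0 : 0 < ρ := Real.exp_pos _
  -- Analyticity in h requires a complex neighbourhood of the real interval. In the sector |Im h| <
  -- Re h the divisors l + μ k h are still bounded below.
  let U : Set (ℂ × ℂ) := ω ×ˢ {h : ℂ | |h.im| < h.re ∧ ‖h‖ < h₀}
  have hU : IsOpen U := hωo.prod ((isOpen_lt (continuous_abs.comp Complex.continuous_im)
    Complex.continuous_re).inter (isOpen_lt continuous_norm continuous_const))
  have hre : ∀ p ∈ U, 0 < p.2.re := fun p hp => (abs_nonneg _).trans_lt hp.2.1
  have hfst : ∀ {s : ℝ × ℂ → AbsSeries} {p : ℂ × ℂ}, AnalyticAt ℂ (fun ζ => s (ρ, ζ)) p.1 →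
      AnalyticAt ℂ (fun q : ℂ × ℂ => s (ρ, q.1)) p := fun {s p} hs =>
    AnalyticAt.comp (g := fun ζ => s (ρ, ζ)) (f := Prod.fst) hs analyticAt_fst
  have hlinb : ∀ {s t : AbsSeries} {h : ℂ}, ‖h‖ < h₀ → ‖s‖ ≤ ε → ‖t‖ ≤ K →
      ‖s + h • t‖ ≤ ε + h₀ * K := fun {s t h} hh hs ht => by
    refine (norm_add_le _ _).trans (add_le_add hs ?_)
    rw [norm_smul]; gcongr
  -- On zᵏ the operator h d/dx is −μ k h; moved to the side of l it gives the divisor l + μ k h, so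
  -- ν = μ. The lower bound c = |B|/4 does not depend on h.
  obtain ⟨α, hαa, hα⟩ := exists_riccati (m := m) (n := n) hU (l := fun p => l p.1) (h := fun p => p.2)
    (ν := (μ : ℂ)) hc0
    (fun p hp k => by
      have := le_norm_add_of_sector (t := μ * k) (hω hp.1).2.1.1 (hω hp.1).2.1.2 hp.2.1.le (by positivity)
      push_cast at this
      exact this)
    (fun p hp h0 => by have := hre p hp; rw [h0] at this; simp at this)
    (fun p hp => AnalyticAt.comp (g := l) (f := Prod.fst) (hω hp.1).2.2 analyticAt_fst)
    (fun p _ => analyticAt_snd)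
    (A := fun p => Matrix.of fun i j => sA₀ (ρ, p.1) i j + p.2 • sA₁ (ρ, p.1) i j)
    (Q := fun p => Matrix.of fun i j => sQ₀ (ρ, p.1) i j + p.2 • sQ₁ (ρ, p.1) i j)
    (f := fun p => sf (ρ, p.1)) (S := fun p => Matrix.of fun i j => p.2 ^ 2 • sS (ρ, p.1) i j)
    (fun p hp i j => by
      obtain ⟨-, -, -, h1, h2, -⟩ := (hω hp.1).1
      exact (hfst (s := fun q => sA₀ q i j) (h1 i j).1).add
        (analyticAt_snd.smul (hfst (s := fun q => sA₁ q i j) (h2 i j).1)))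
    (fun p hp i j => by
      obtain ⟨-, -, -, -, -, h1, h2, -⟩ := (hω hp.1).1
      exact (hfst (s := fun q => sQ₀ q i j) (h1 i j).1).add
        (analyticAt_snd.smul (hfst (s := fun q => sQ₁ q i j) (h2 i j).1)))
    (fun p hp i j => by
      obtain ⟨-, -, -, -, -, -, -, h1, -⟩ := (hω hp.1).1
      exact hfst (s := fun q => sf q i j) (h1 i j).1)
    (fun p hp i j => by
      obtain ⟨-, -, -, -, -, -, -, -, h1⟩ := (hω hp.1).1
      exact (analyticAt_snd.pow 2).smul (hfst (s := fun q => sS q i j) (h1 i j).1))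
    (ε := ε + h₀ * K) (δ := h₀ * K) (R := R) (by positivity) (by positivity) hR0
    (fun p hp i j => by
      obtain ⟨⟨h1, -⟩, ⟨h2, -⟩, -⟩ := (hω hp.1).1
      exact hlinb hp.2.2 (h1 i j) (h2 i j))
    (fun p hp i j => by
      obtain ⟨⟨-, h1⟩, ⟨-, h2⟩, -⟩ := (hω hp.1).1
      exact hlinb hp.2.2 (h1 i j) (h2 i j))
    (fun p hp i j => by
      obtain ⟨-, -, ⟨-, h1⟩, -⟩ := (hω hp.1).1
      simp only [Matrix.of_apply, norm_smul, norm_pow]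
      have h2 := hp.2.2
      have h3 : ‖p.2‖ ^ 2 ≤ h₀ := by nlinarith [norm_nonneg p.2]
      have := h1 i j
      gcongr)
    (fun p hp i j => by
      obtain ⟨-, -, ⟨h1, -⟩, -⟩ := (hω hp.1).1
      refine (h1 i j).trans (le_of_eq ?_)
      rw [hR]; field_simp)
    (by
      calc _ = ((Fintype.card m : ℝ) + Fintype.card n) * ε + N * (h₀ * K) := by rw [hN]; ring
        _ ≤ |B| / 16 + |B| / 16 := add_le_add hεB hh₀N
        _ = c / 2 := by rw [hc]; ring)
  -- R/2 bounds the solution; R/(2ρ) bounds its distance to the constant coefficient, because that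
  -- estimate has the factor exp (−μ x) / ρ.
  refine ⟨M, h₀, max (R / 2) (R / 2 / ρ), hh₀p, ω, hωo, hζω,
    fun x ζ h => Matrix.of fun i j => eval (Complex.exp (-μ * x) / ρ) (α (ζ, h) i j),
    fun ζ h => Matrix.of fun i j => coeff 0 (α (ζ, h) i j), ?_⟩
  intro ζ hζ h hh hhh x hx i j
  have hp : ((ζ, (h : ℂ)) : ℂ × ℂ) ∈ U := by
    refine ⟨hζ, ?_, ?_⟩
    · simpa using hh
    · simpa [abs_of_pos hh] using hhh
  have hle := (HasExpLimit.norm_exp_lt hμ hx).le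
  have hw : ‖Complex.exp (-μ * x) / (ρ : ℂ)‖ < 1 := by
    rw [norm_div, Complex.norm_real, Real.norm_of_nonneg hρ0.le, div_lt_one hρ0]
    exact HasExpLimit.norm_exp_lt hμ hx
  obtain ⟨hαb, hαe⟩ := hα (ζ, h) hp
  refine ⟨?_, ?_, ?_, ?_⟩
  · refine AnalyticAt.comp (g := fun q : ℂ × AbsSeries => eval q.1 q.2)
      (f := fun q : ℂ × ℂ × ℂ => (Complex.exp (-μ * q.1) / ρ, α q.2 i j)) (analyticAt_eval hw _) ?_
    refine AnalyticAt.prod ?_ (AnalyticAt.comp (g := fun p => α p i j) (f := Prod.snd)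
      (hαa (ζ, h) hp i j) analyticAt_snd)
    exact (AnalyticAt.cexp (analyticAt_const.mul analyticAt_fst)).div_const
  · exact ((norm_eval_le _ hw.le).trans (hαb i j)).trans (le_max_left _ _)
  · refine (norm_eval_sub_coeff_zero_le _ hw.le).trans ?_
    rw [norm_div, Complex.norm_real, Real.norm_of_nonneg hρ0.le, HasExpLimit.norm_exp]
    calc Real.exp (-μ * x.re) / ρ * ‖α (ζ, h) i j‖ ≤ Real.exp (-μ * x.re) / ρ * (R / 2) := by
          have := hαb i j; gcongr
      _ = R / 2 / ρ * Real.exp (-μ * x.re) := by ring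
      _ ≤ _ := by gcongr; exact le_max_right _ _
  · have hd := (hasDerivAt_eval_exp (α (ζ, h) i j) (-μ) ρ hw).deriv
    have he := eval_add_euler_eq (fun k => hαe i j k) hw
    have hE : ∀ a, eval (Complex.exp (-μ * x) / ρ) a = (evalHom _ hw.le : AbsSeries →+* ℂ) a :=
      fun _ => rfl
    -- Evaluation is a ring homomorphism, so the matrix identity in the algebra passes entrywise to
    -- the functions of x.
    set E : AbsSeries →+* ℂ := (evalHom _ hw.le : AbsSeries →+* ℂ) with hEdef
    have hEs : ∀ (z : ℂ) (a : AbsSeries), E (z • a) = z * E a := fun z a =>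
      map_smul (evalHom _ hw.le) z a
    obtain ⟨-, -, -, g1, g2, g3, g4, g5, g6⟩ := (hω hζ).1
    have m1 : (Matrix.of fun i j => sA₀ (ρ, ζ) i j + (h : ℂ) • sA₁ (ρ, ζ) i j).map E
        = A₀ ζ x + (h : ℂ) • A₁ ζ x := by
      ext i j
      simp only [Matrix.map_apply, Matrix.of_apply, Matrix.add_apply, Matrix.smul_apply, map_add, hEs,
        smul_eq_mul, (g1 i j).2 x hle, (g2 i j).2 x hle, hE]
    have m2 : (Matrix.of fun i j => sQ₀ (ρ, ζ) i j + (h : ℂ) • sQ₁ (ρ, ζ) i j).map E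
        = Q₀ ζ x + (h : ℂ) • Q₁ ζ x := by
      ext i j
      simp only [Matrix.map_apply, Matrix.of_apply, Matrix.add_apply, Matrix.smul_apply, map_add, hEs,
        smul_eq_mul, (g3 i j).2 x hle, (g4 i j).2 x hle, hE]
    have m3 : (sf (ρ, ζ)).map E = f ζ x := by
      ext i j
      simp only [Matrix.map_apply, (g5 i j).2 x hle, hE]
    have m4 : (Matrix.of fun i j => (h : ℂ) ^ 2 • sS (ρ, ζ) i j).map E = (h : ℂ) ^ 2 • S ζ x := by
      ext i j
      simp only [Matrix.map_apply, Matrix.of_apply, Matrix.smul_apply, hEs,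
        smul_eq_mul, (g6 i j).2 x hle, hE]
    have m5 : (Matrix.of fun i j => eval (Complex.exp (-μ * x) / ρ) (α (ζ, h) i j))
        = (α (ζ, h)).map E := rfl
    have hder : deriv (fun y => eval (Complex.exp (-μ * y) / ρ) (α (ζ, h) i j)) x
        = -μ * euler (Complex.exp (-μ * x) / ρ) (α (ζ, h) i j) := hd
    simp only [Matrix.of_apply]
    rw [hder, m5, ← m1, ← m2, ← m3, ← m4, ← Matrix.map_mul, ← Matrix.map_mul, ← Matrix.map_mul,
      ← Matrix.map_mul, ← Matrix.map_add _ (map_add E), ← Matrix.map_add _ (map_add E),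
      ← Matrix.map_add _ (map_add E), Matrix.sub_apply, Matrix.map_apply, Matrix.smul_apply, Matrix.map_apply]
    rw [hE, hE] at he
    simp only at he
    rw [← he, smul_eq_mul]
    ring


/-- The limit of A₁₁ is a Jordan block, whose nilpotent part need not be small enough for the
contraction. The unknown is therefore X = α₂₁ W with W diagonal and V its inverse, for which A₁₁ is
replaced by V A₁₁ W; the identity returns from the equation for X to that for α₂₁ = X V. For α₁₂ = W
X, `riccati_conj_left` plays the same role. -/
lemma riccati_conj_right {m n : Type*} [Fintype m] [DecidableEq m] [Fintype n] [DecidableEq n]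
    {X f : Matrix m n ℂ} {A D : Matrix m m ℂ} {A' D' V W : Matrix n n ℂ} {S : Matrix n m ℂ} {e a h : ℂ}
    (hWV : W * V = 1) :
    ((e - a) • X - ((-(A - e • 1) + h • -D) * X + X * (V * (A' - a • 1) * W + h • (V * D' * W))
      + -(f * W) + X * (h ^ 2 • (V * S)) * X)) * V =
    (A + h • D) * (X * V) + f - (X * V) * (A' + h • D' + h ^ 2 • (S * (X * V))) := by
  simp only [Matrix.mul_sub, Matrix.sub_mul, Matrix.mul_add, Matrix.add_mul, Matrix.smul_mul,
    Matrix.mul_smul, Matrix.neg_mul, Matrix.mul_assoc, hWV, Matrix.mul_one,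
    Matrix.one_mul, smul_neg]
  module

lemma riccati_conj_left {m n : Type*} [Fintype m] [DecidableEq m] [Fintype n] [DecidableEq n]
    {X f : Matrix m n ℂ} {A D V W : Matrix m m ℂ} {A' D' : Matrix n n ℂ} {S : Matrix n m ℂ} {e a h : ℂ}
    (hWV : W * V = 1) :
    W * ((a - e) • X - ((-(V * (A - a • 1) * W) + h • -(V * D * W)) * X + X * ((A' - e • 1) + h • D')
      + -(V * f) + X * (h ^ 2 • (S * W)) * X)) =
    (A + h • D) * (W * X) + f - (W * X) * (A' + h • D' + h ^ 2 • (S * (W * X))) := by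
  have hWV' : ∀ Z : Matrix m n ℂ, W * (V * Z) = Z := fun Z => by
    rw [← Matrix.mul_assoc, hWV, Matrix.one_mul]
  simp only [Matrix.mul_sub, Matrix.sub_mul, Matrix.mul_add, Matrix.add_mul, Matrix.smul_mul,
    Matrix.mul_smul, Matrix.neg_mul, Matrix.mul_neg, Matrix.mul_assoc, hWV', Matrix.mul_one,
    smul_neg]
  module

/-- Exact block-diagonalization: the off-diagonal blocks of the conjugator. -/
lemma exists_block_conjugators {μ : ℝ} (hμ : 0 < μ) {ζ₀ : ℂ}
    {A₁₁ d₁₁ : ℂ → ℂ → Matrix (Fin 2) (Fin 2) ℂ} {A₂₂ d₂₂ : ℂ → ℂ → Matrix (Fin 3) (Fin 3) ℂ}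
    {d₁₂ : ℂ → ℂ → Matrix (Fin 2) (Fin 3) ℂ} {d₂₁ : ℂ → ℂ → Matrix (Fin 3) (Fin 2) ℂ}
    {a e : ℂ → ℂ} (ha : AnalyticAt ℂ a ζ₀) (he : AnalyticAt ℂ e ζ₀) {B : ℝ} (hB : B ≠ 0)
    (hae : e ζ₀ - a ζ₀ = B * Complex.I) {b : ℂ}
    (hA₁₁ : ∀ i j, HasExpLimit μ ζ₀ (fun ζ x => A₁₁ ζ x i j) (!![a ζ₀, b; 0, a ζ₀] i j))
    (hA₂₂ : ∀ i j, HasExpLimit μ ζ₀ (fun ζ x => A₂₂ ζ x i j)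
      ((e ζ₀ • (1 : Matrix (Fin 3) (Fin 3) ℂ)) i j))
    (hd₁₁ : ∀ i j, ∃ c, HasExpLimit μ ζ₀ (fun ζ x => d₁₁ ζ x i j) c)
    (hd₁₂ : ∀ i j, ∃ c, HasExpLimit μ ζ₀ (fun ζ x => d₁₂ ζ x i j) c)
    (hd₂₁ : ∀ i j, ∃ c, HasExpLimit μ ζ₀ (fun ζ x => d₂₁ ζ x i j) c)
    (hd₂₂ : ∀ i j, ∃ c, HasExpLimit μ ζ₀ (fun ζ x => d₂₂ ζ x i j) c) :
    ∃ M h₀ K : ℝ, 0 < h₀ ∧ ∃ ω : Set ℂ, IsOpen ω ∧ ζ₀ ∈ ω ∧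
    ∃ (α₁₂ : ℂ → ℂ → ℂ → Matrix (Fin 2) (Fin 3) ℂ) (α₂₁ : ℂ → ℂ → ℂ → Matrix (Fin 3) (Fin 2) ℂ)
      (αInf : ℂ → ℂ → Matrix (Fin 3) (Fin 2) ℂ),
      ∀ ζ ∈ ω, ∀ h : ℝ, 0 < h → h < h₀ → ∀ x : ℂ, M < x.re →
        (∀ i j, AnalyticAt ℂ (fun q : ℂ × ℂ × ℂ => α₁₂ q.1 q.2.1 q.2.2 i j) (x, ζ, h) ∧
          ‖α₁₂ x ζ h i j‖ ≤ K ∧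
          (h : ℂ) * deriv (fun y => α₁₂ y ζ h i j) x =
            ((A₁₁ ζ x + (h : ℂ) • d₁₁ ζ x) * α₁₂ x ζ h + d₁₂ ζ x
              - α₁₂ x ζ h * (A₂₂ ζ x + (h : ℂ) • d₂₂ ζ x
                + (h : ℂ) ^ 2 • (d₂₁ ζ x * α₁₂ x ζ h))) i j) ∧
        (∀ i j, AnalyticAt ℂ (fun q : ℂ × ℂ × ℂ => α₂₁ q.1 q.2.1 q.2.2 i j) (x, ζ, h) ∧
          ‖α₂₁ x ζ h i j‖ ≤ K ∧
          ‖α₂₁ x ζ h i j - αInf ζ h i j‖ ≤ K * Real.exp (-μ * x.re) ∧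
          (h : ℂ) * deriv (fun y => α₂₁ y ζ h i j) x =
            ((A₂₂ ζ x + (h : ℂ) • d₂₂ ζ x) * α₂₁ x ζ h + d₂₁ ζ x
              - α₂₁ x ζ h * (A₁₁ ζ x + (h : ℂ) • d₁₁ ζ x
                + (h : ℂ) ^ 2 • (d₁₂ ζ x * α₂₁ x ζ h))) i j) := by
  choose c₁₁ hc₁₁ using hd₁₁
  choose c₁₂ hc₁₂ using hd₁₂
  choose c₂₁ hc₂₁ using hd₂₁
  choose c₂₂ hc₂₂ using hd₂₂
  have hB0 : 0 < |B| := abs_pos.2 hB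
  -- 80 = 16 · 5, where 5 = 2 + 3 is the sum of the block sizes.
  set ε : ℝ := |B| / 80 with hε
  have hε0 : 0 < ε := by positivity
  -- Conjugation by diag (1, δ) multiplies the nilpotent entry b by δ, and this δ makes |b| δ < ε;
  -- adding 1 to ‖b‖ covers b = 0.
  set δ : ℝ := ε / (2 * (‖b‖ + 1)) with hδ
  have hδ0 : 0 < δ := by positivity
  have hδb : ‖b‖ * δ < ε := by
    rw [hδ, mul_div_assoc', div_lt_iff₀ (by positivity)]
    nlinarith [norm_nonneg b]
  let w : Fin 2 → ℂ := ![1, (δ : ℂ)]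
  have hδC : (δ : ℂ) ≠ 0 := Complex.ofReal_ne_zero.2 hδ0.ne'
  have hw : ∀ i, w i ≠ 0 := fun i => by fin_cases i <;> simp [w, hδC]
  let W : Matrix (Fin 2) (Fin 2) ℂ := Matrix.diagonal w
  let V : Matrix (Fin 2) (Fin 2) ℂ := Matrix.diagonal fun i => (w i)⁻¹
  have hWV : W * V = 1 := by
    rw [Matrix.diagonal_mul_diagonal, ← Matrix.diagonal_one]
    congr 1; funext i; exact mul_inv_cancel₀ (hw i)
  have hQ₀ : ∀ i j, HasExpLimit μ ζ₀
      (fun ζ x => (V * (A₁₁ ζ x - a ζ • (1 : Matrix (Fin 2) (Fin 2) ℂ)) * W) i j)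
      ((w i)⁻¹ * (!![a ζ₀, b; 0, a ζ₀] i j - a ζ₀ * (1 : Matrix (Fin 2) (Fin 2) ℂ) i j) * w j) :=
    fun i j => by
    simp only [V, W, Matrix.mul_diagonal, Matrix.diagonal_mul, Matrix.sub_apply, Matrix.smul_apply,
      smul_eq_mul]
    exact ((HasExpLimit.const _).mul ((hA₁₁ i j).sub ((HasExpLimit.of_analyticAt ha).mul
      (HasExpLimit.const _)))).mul (HasExpLimit.const _)
  have hq₀ : ∀ i j,
      ‖(w i)⁻¹ * (!![a ζ₀, b; 0, a ζ₀] i j - a ζ₀ * (1 : Matrix (Fin 2) (Fin 2) ℂ) i j) * w j‖ < ε := by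
    intro i j
    fin_cases i <;> fin_cases j <;> simp [w, hε0, abs_of_pos hδ0, hδb]
  have hQ₁ : ∀ i j, HasExpLimit μ ζ₀ (fun ζ x => (V * d₁₁ ζ x * W) i j)
      ((w i)⁻¹ * c₁₁ i j * w j) := fun i j => by
    simp only [V, W, Matrix.mul_diagonal, Matrix.diagonal_mul]
    exact ((HasExpLimit.const _).mul (hc₁₁ i j)).mul (HasExpLimit.const _)
  have hP₀ : ∀ i j, HasExpLimit μ ζ₀
      (fun ζ x => (A₂₂ ζ x - e ζ • (1 : Matrix (Fin 3) (Fin 3) ℂ)) i j) 0 := fun i j => by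
    simp only [Matrix.sub_apply, Matrix.smul_apply, smul_eq_mul]
    refine ((hA₂₂ i j).sub ((HasExpLimit.of_analyticAt he).mul (HasExpLimit.const _))).congr_limit ?_
    simp
  have hcard3 : ((Fintype.card (Fin 3) : ℝ) + Fintype.card (Fin 2)) * ε ≤ |B| / 16 := by
    simp only [Fintype.card_fin, hε]; push_cast; linarith
  have hcard2 : ((Fintype.card (Fin 2) : ℝ) + Fintype.card (Fin 3)) * ε ≤ |-B| / 16 := by
    simp only [Fintype.card_fin, hε, abs_neg]; push_cast; linarith
  obtain ⟨M₁, h₁, K₁, hh₁, ω₁, hω₁, hζ₁, α, αI, hα⟩ :=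
    exists_bounded_riccati_solution (m := Fin 3) (n := Fin 2) hμ (l := fun ζ => e ζ - a ζ)
      (he.sub ha) hB hae (A₀ := fun ζ x => -(A₂₂ ζ x - e ζ • 1)) (A₁ := fun ζ x => -d₂₂ ζ x)
      (Q₀ := fun ζ x => V * (A₁₁ ζ x - a ζ • 1) * W) (Q₁ := fun ζ x => V * d₁₁ ζ x * W)
      (f := fun ζ x => -(d₂₁ ζ x * W)) (S := fun ζ x => V * d₁₂ ζ x)
      (cf := fun i j => -(c₂₁ i j * w j)) (cS := fun i j => (w i)⁻¹ * c₁₂ i j)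
      hε0.le hcard3 (fun i j => (hP₀ i j).neg) (fun i j => by simpa using hε0)
      (fun i j => (hc₂₂ i j).neg) hQ₀ hq₀ hQ₁
      (fun i j => by
        simp only [Matrix.neg_apply, W, Matrix.mul_diagonal]
        exact ((hc₂₁ i j).mul (HasExpLimit.const _)).neg)
      (fun i j => by
        simp only [V, Matrix.diagonal_mul]
        exact (HasExpLimit.const _).mul (hc₁₂ i j))
  -- The gap for α₁₂ is the opposite of the one for α₂₁. Being imaginary at ζ₀, it is equally
  -- harmless, so both blocks can be solved from infinity.
  obtain ⟨M₂, h₂, K₂, hh₂, ω₂, hω₂, hζ₂, β, βI, hβ⟩ :=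
    exists_bounded_riccati_solution (m := Fin 2) (n := Fin 3) hμ (l := fun ζ => a ζ - e ζ)
      (ha.sub he) (neg_ne_zero.2 hB) (by rw [← neg_sub, hae]; push_cast; ring)
      (A₀ := fun ζ x => -(V * (A₁₁ ζ x - a ζ • 1) * W)) (A₁ := fun ζ x => -(V * d₁₁ ζ x * W))
      (Q₀ := fun ζ x => A₂₂ ζ x - e ζ • 1) (Q₁ := fun ζ x => d₂₂ ζ x)
      (f := fun ζ x => -(V * d₁₂ ζ x)) (S := fun ζ x => d₂₁ ζ x * W)
      (cf := fun i j => -((w i)⁻¹ * c₁₂ i j)) (cS := fun i j => c₂₁ i j * w j)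
      hε0.le hcard2 (fun i j => (hQ₀ i j).neg) (fun i j => by rw [norm_neg]; exact hq₀ i j)
      (fun i j => (hQ₁ i j).neg) hP₀ (fun i j => by simpa using hε0) hc₂₂
      (fun i j => by
        simp only [Matrix.neg_apply, V, Matrix.diagonal_mul]
        exact ((HasExpLimit.const _).mul (hc₁₂ i j)).neg)
      (fun i j => by
        simp only [W, Matrix.mul_diagonal]
        exact (hc₂₁ i j).mul (HasExpLimit.const _))
  set N : ℝ := 1 + δ + δ⁻¹ with hN
  have hN0 : 0 < N := by positivity
  have hwN : ∀ i, ‖w i‖ ≤ N ∧ ‖(w i)⁻¹‖ ≤ N := fun i => by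
    have : 0 < δ⁻¹ := by positivity
    fin_cases i
    · simp [w, hN]; linarith
    · simp [w, hN, abs_of_pos hδ0]; constructor <;> linarith
  refine ⟨max M₁ M₂, min h₁ h₂, max (K₁ * N) (K₂ * N), lt_min hh₁ hh₂, ω₁ ∩ ω₂, hω₁.inter hω₂,
    ⟨hζ₁, hζ₂⟩, fun x ζ h => W * β x ζ h, fun x ζ h => α x ζ h * V, fun ζ h => αI ζ h * V, ?_⟩
  rintro ζ ⟨hζ1, hζ2⟩ h hh0 hh x hx
  have gα := hα ζ hζ1 h hh0 (hh.trans_le (min_le_left _ _)) x ((le_max_left _ _).trans_lt hx)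
  have gβ := hβ ζ hζ2 h hh0 (hh.trans_le (min_le_right _ _)) x ((le_max_right _ _).trans_lt hx)
  constructor
  · intro i j
    obtain ⟨g1, g2, -, -⟩ := gβ i j
    refine ⟨?_, ?_, ?_⟩
    · simp only [W, Matrix.diagonal_mul]
      exact analyticAt_const.mul g1
    · simp only [W, Matrix.diagonal_mul, norm_mul]
      calc ‖w i‖ * ‖β x ζ h i j‖ ≤ N * K₂ := by
            have := (hwN i).1; gcongr
        _ = K₂ * N := mul_comm _ _
        _ ≤ _ := le_max_right _ _
    · rw [← riccati_conj_left hWV (V := V)]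
      have hm : ∀ (Z : Matrix (Fin 2) (Fin 3) ℂ), (W * Z) i j = w i * Z i j := fun Z => by
        simp only [W, Matrix.diagonal_mul]
      simp only [hm]
      rw [deriv_const_mul_field, mul_left_comm, (gβ i j).2.2.2]
  · intro i j
    obtain ⟨g1, g2, g3, -⟩ := gα i j
    have hm : ∀ (Z : Matrix (Fin 3) (Fin 2) ℂ), (Z * V) i j = Z i j * (w j)⁻¹ := fun Z => by
      simp only [V, Matrix.mul_diagonal]
    refine ⟨?_, ?_, ?_, ?_⟩
    · simp only [hm]
      exact g1.mul analyticAt_const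
    · simp only [hm, norm_mul]
      calc ‖α x ζ h i j‖ * ‖(w j)⁻¹‖ ≤ K₁ * N := by
            have := (hwN j).2
            have h0 := (norm_nonneg _).trans g2
            gcongr
        _ ≤ _ := le_max_left _ _
    · simp only [hm, ← sub_mul, norm_mul]
      calc _ ≤ K₁ * Real.exp (-μ * x.re) * N := by
            have := (hwN j).2
            have h0 := (norm_nonneg _).trans g3
            gcongr
        _ = K₁ * N * Real.exp (-μ * x.re) := by ring
        _ ≤ _ := by gcongr; exact le_max_left _ _
    · rw [← riccati_conj_right hWV]
      simp only [hm]
      rw [deriv_mul_const_field, ← mul_assoc, (gα i j).2.2.2]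


/-! ### Conjugation of linear systems -/

lemma differentiableAt_det {n : Type*} [Fintype n] [DecidableEq n] {Y : ℂ → Matrix n n ℂ} {x : ℂ}
    (hY : ∀ i j, DifferentiableAt ℂ (fun y => Y y i j) x) :
    DifferentiableAt ℂ (fun y => (Y y).det) x := by
  simp only [Matrix.det_apply]
  exact DifferentiableAt.fun_sum fun σ _ =>
    (DifferentiableAt.fun_finsetProd fun i _ => hY _ _).const_smul _

lemma differentiableAt_inv_apply {n : Type*} [Fintype n] [DecidableEq n] {Y : ℂ → Matrix n n ℂ}
    {x : ℂ} (hY : ∀ i j, DifferentiableAt ℂ (fun y => Y y i j) x) (hdet : (Y x).det ≠ 0) (i j : n) :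
    DifferentiableAt ℂ (fun y => (Y y)⁻¹ i j) x := by
  simp only [Matrix.inv_def, Matrix.smul_apply, Matrix.adjugate_apply, Ring.inverse_eq_inv', smul_eq_mul]
  refine ((differentiableAt_det hY).inv hdet).mul (differentiableAt_det fun k l => ?_)
  by_cases hkj : k = j
  · subst hkj
    simp only [Matrix.updateRow_self]
    exact differentiableAt_const _
  · simp only [Matrix.updateRow_ne hkj]
    exact hY k l

lemma hasDerivAt_mulVec {n : Type*} [Fintype n] {Y : ℂ → Matrix n n ℂ}
    {φ : ℂ → n → ℂ} {x : ℂ} (hY : ∀ i j, DifferentiableAt ℂ (fun y => Y y i j) x)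
    (hφ : DifferentiableAt ℂ φ x) :
    HasDerivAt (fun y => Y y *ᵥ φ y)
      (Matrix.of (fun i j => deriv (fun y => Y y i j) x) *ᵥ φ x + Y x *ᵥ deriv φ x) x := by
  rw [hasDerivAt_pi]
  intro i
  have hφi : ∀ j, HasDerivAt (fun y => φ y j) (deriv φ x j) x := hasDerivAt_pi.1 hφ.hasDerivAt
  refine (HasDerivAt.fun_sum fun j _ => (hY i j).hasDerivAt.mul (hφi j)).congr_deriv ?_
  simp only [Pi.add_apply, Matrix.mulVec, dotProduct, Matrix.of_apply, Finset.sum_add_distrib]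

/-- By the product rule h (Y φ)' = h Y' φ + Y (h φ)', and the matrix identity rewrites A Y φ as h Y'
φ + Y B φ; injectivity of Y cancels it. Differentiability of φ is recovered from that of Y φ because
the entries of Y⁻¹ are differentiable, by Cramer's rule. -/
lemma conjugates_of_deriv {W : Set ℂ} (hW : IsOpen W) {h : ℝ} (hh : h ≠ 0)
    {Y A B : ℂ → Matrix (Fin 5) (Fin 5) ℂ}
    (hY : ∀ x ∈ W, ∀ i j, DifferentiableAt ℂ (fun y => Y y i j) x)
    (hdet : ∀ x ∈ W, IsUnit (Y x).det)
    (hYd : ∀ x ∈ W, (h : ℂ) • Matrix.of (fun i j => deriv (fun y => Y y i j) x) + Y x * B x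
      = A x * Y x) : Conjugates W h Y A B := by
  have hhC : (h : ℂ) ≠ 0 := Complex.ofReal_ne_zero.2 hh
  refine ⟨hdet, fun φ => forall₂_congr fun x hx => ?_⟩
  have hdiff : DifferentiableAt ℂ (fun y => Y y *ᵥ φ y) x ↔ DifferentiableAt ℂ φ x := by
    refine ⟨fun hd => ?_, fun hd => (hasDerivAt_mulVec (hY x hx) hd).differentiableAt⟩
    have h1 := (hasDerivAt_mulVec (Y := fun y => (Y y)⁻¹)
      (fun i j => differentiableAt_inv_apply (hY x hx) (hdet x hx).ne_zero i j) hd).differentiableAt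
    refine h1.congr_of_eventuallyEq ?_
    filter_upwards [hW.mem_nhds hx] with y hy
    rw [Matrix.mulVec_mulVec, Matrix.nonsing_inv_mul _ (hdet y hy), Matrix.one_mulVec]
  rw [hdiff]
  refine and_congr_right fun hd => ?_
  rw [(hasDerivAt_mulVec (hY x hx) hd).deriv, Matrix.mulVec_mulVec, ← hYd x hx, Matrix.add_mulVec,
    smul_add, Matrix.smul_mulVec, add_right_inj, ← Matrix.mulVec_mulVec, ← Matrix.mulVec_smul]
  have hinj : Function.Injective (Y x).mulVec :=
    Matrix.mulVec_injective_iff_isUnit.2 ((Matrix.isUnit_iff_isUnit_det _).2 (hdet x hx))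
  exact hinj.eq_iff

/-! ### Block matrices -/

lemma block5_mul (A A' : Matrix (Fin 2) (Fin 2) ℂ) (B B' : Matrix (Fin 2) (Fin 3) ℂ)
    (C C' : Matrix (Fin 3) (Fin 2) ℂ) (D D' : Matrix (Fin 3) (Fin 3) ℂ) :
    block5 A B C D * block5 A' B' C' D' =
      block5 (A * A' + B * C') (A * B' + B * D') (C * A' + D * C') (C * B' + D * D') := by
  simp only [block5, Matrix.submatrix_mul_equiv, Matrix.fromBlocks_multiply]

lemma block5_add (A A' : Matrix (Fin 2) (Fin 2) ℂ) (B B' : Matrix (Fin 2) (Fin 3) ℂ)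
    (C C' : Matrix (Fin 3) (Fin 2) ℂ) (D D' : Matrix (Fin 3) (Fin 3) ℂ) :
    block5 A B C D + block5 A' B' C' D' = block5 (A + A') (B + B') (C + C') (D + D') := by
  simp only [block5, ← Matrix.fromBlocks_add, Matrix.submatrix_add, Pi.add_apply]

lemma block5_smul (c : ℂ) (A : Matrix (Fin 2) (Fin 2) ℂ) (B : Matrix (Fin 2) (Fin 3) ℂ)
    (C : Matrix (Fin 3) (Fin 2) ℂ) (D : Matrix (Fin 3) (Fin 3) ℂ) :
    c • block5 A B C D = block5 (c • A) (c • B) (c • C) (c • D) := by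
  simp only [block5, ← Matrix.fromBlocks_smul, Matrix.submatrix_smul, Pi.smul_apply]

lemma forall_fin5 {p : Fin 5 → Fin 5 → Prop}
    (h11 : ∀ (i : Fin 2) (j : Fin 2), p (Fin.castAdd 3 i) (Fin.castAdd 3 j))
    (h12 : ∀ (i : Fin 2) (j : Fin 3), p (Fin.castAdd 3 i) (Fin.natAdd 2 j))
    (h21 : ∀ (i : Fin 3) (j : Fin 2), p (Fin.natAdd 2 i) (Fin.castAdd 3 j))
    (h22 : ∀ (i : Fin 3) (j : Fin 3), p (Fin.natAdd 2 i) (Fin.natAdd 2 j)) (i j : Fin 5) : p i j := by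
  have key : ∀ {q : Fin 5 → Prop}, (∀ i : Fin 2, q (Fin.castAdd 3 i)) →
      (∀ i : Fin 3, q (Fin.natAdd 2 i)) → ∀ i, q i := fun {q} h1 h2 i =>
    Fin.addCases (m := 2) (n := 3) (motive := q) h1 h2 i
  exact key (q := fun i => p i j) (fun i => key (q := p _) (h11 i) (h12 i) j)
    (fun i => key (q := p _) (h21 i) (h22 i) j) i

section Entries

variable (A : Matrix (Fin 2) (Fin 2) ℂ) (B : Matrix (Fin 2) (Fin 3) ℂ)
  (C : Matrix (Fin 3) (Fin 2) ℂ) (D : Matrix (Fin 3) (Fin 3) ℂ)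

lemma block5_11 (i j : Fin 2) : block5 A B C D (Fin.castAdd 3 i) (Fin.castAdd 3 j) = A i j := by
  fin_cases i <;> fin_cases j <;> rfl

lemma block5_12 (i : Fin 2) (j : Fin 3) :
    block5 A B C D (Fin.castAdd 3 i) (Fin.natAdd 2 j) = B i j := by
  fin_cases i <;> fin_cases j <;> rfl

lemma block5_21 (i : Fin 3) (j : Fin 2) :
    block5 A B C D (Fin.natAdd 2 i) (Fin.castAdd 3 j) = C i j := by
  fin_cases i <;> fin_cases j <;> rfl

lemma block5_22 (i j : Fin 3) : block5 A B C D (Fin.natAdd 2 i) (Fin.natAdd 2 j) = D i j := by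
  fin_cases i <;> fin_cases j <;> rfl

lemma block5_eq_of : block5 A B C D =
    !![A 0 0, A 0 1, B 0 0, B 0 1, B 0 2; A 1 0, A 1 1, B 1 0, B 1 1, B 1 2;
      C 0 0, C 0 1, D 0 0, D 0 1, D 0 2; C 1 0, C 1 1, D 1 0, D 1 1, D 1 2;
      C 2 0, C 2 1, D 2 0, D 2 1, D 2 2] := by
  ext i j
  fin_cases i <;> fin_cases j <;> rfl

end Entries

lemma block5_blocks (X : Matrix (Fin 5) (Fin 5) ℂ) : block5 (b11 X) (b12 X) (b21 X) (b22 X) = X :=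
  Matrix.ext (forall_fin5 (fun _ _ => block5_11 ..) (fun _ _ => block5_12 ..)
    (fun _ _ => block5_21 ..) (fun _ _ => block5_22 ..))

section Y2

variable (h : ℝ) (β : Matrix (Fin 2) (Fin 3) ℂ) (γ : Matrix (Fin 3) (Fin 2) ℂ)

lemma Y2_11 (i j : Fin 2) :
    Y2 h β γ (Fin.castAdd 3 i) (Fin.castAdd 3 j) = (1 : Matrix (Fin 2) (Fin 2) ℂ) i j :=
  block5_11 ..

lemma Y2_12 (i : Fin 2) (j : Fin 3) :
    Y2 h β γ (Fin.castAdd 3 i) (Fin.natAdd 2 j) = (h : ℂ) * β i j := block5_12 ..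

lemma Y2_21 (i : Fin 3) (j : Fin 2) :
    Y2 h β γ (Fin.natAdd 2 i) (Fin.castAdd 3 j) = (h : ℂ) * γ i j := block5_21 ..

lemma Y2_22 (i j : Fin 3) :
    Y2 h β γ (Fin.natAdd 2 i) (Fin.natAdd 2 j) = (1 : Matrix (Fin 3) (Fin 3) ℂ) i j :=
  block5_22 ..

end Y2

/-- Strict diagonal dominance: the diagonal is 1 and the other entries of a row, fewer than five,
are at most h K. -/
lemma isUnit_det_Y2 {h K : ℝ} (hh : 0 < h) (hK : 5 * (h * K) < 1)
    {β : Matrix (Fin 2) (Fin 3) ℂ} {γ : Matrix (Fin 3) (Fin 2) ℂ}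
    (hβ : ∀ i j, ‖β i j‖ ≤ K) (hγ : ∀ i j, ‖γ i j‖ ≤ K) : IsUnit (Y2 h β γ).det := by
  have hK0 : 0 ≤ K := (norm_nonneg _).trans (hβ 0 0)
  have hoff : ∀ i j, i ≠ j → ‖Y2 h β γ i j‖ ≤ h * K := by
    refine forall_fin5 (fun i j hij => ?_) (fun i j _ => ?_) (fun i j _ => ?_) (fun i j hij => ?_)
    · rw [Y2_11, Matrix.one_apply_ne (fun e => hij (by rw [e])), norm_zero]; positivity
    · rw [Y2_12, norm_mul, Complex.norm_real, Real.norm_of_nonneg hh.le]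
      have := hβ i j; gcongr
    · rw [Y2_21, norm_mul, Complex.norm_real, Real.norm_of_nonneg hh.le]
      have := hγ i j; gcongr
    · rw [Y2_22, Matrix.one_apply_ne (fun e => hij (by rw [e])), norm_zero]; positivity
  have hdiag : ∀ i j, i = j → Y2 h β γ i j = 1 := by
    refine forall_fin5 (fun i j hij => ?_) (fun i j hij => ?_) (fun i j hij => ?_) (fun i j hij => ?_)
    · rw [Y2_11, Fin.castAdd_injective _ _ hij, Matrix.one_apply_eq]
    · exact absurd hij (by intro e; have := congrArg Fin.val e; simp at this; omega)
    · exact absurd hij (by intro e; have := congrArg Fin.val e; simp at this; omega)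
    · rw [Y2_22, Fin.natAdd_injective _ _ hij, Matrix.one_apply_eq]
  refine isUnit_iff_ne_zero.2 (det_ne_zero_of_sum_row_lt_diag fun k => ?_)
  rw [hdiag k k rfl, norm_one]
  calc ∑ j ∈ Finset.univ.erase k, ‖Y2 h β γ k j‖ ≤ ∑ j ∈ Finset.univ.erase k, h * K :=
        Finset.sum_le_sum fun j hj => hoff k j (Finset.ne_of_mem_erase hj).symm
    _ ≤ ∑ j : Fin 5, h * K :=
        Finset.sum_le_sum_of_subset_of_nonneg (Finset.erase_subset _ _) fun _ _ _ => by positivity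
    _ = 5 * (h * K) := by simp
    _ < 1 := hK

/-! ### Algebra of the conjugations by `Y1` and `Y2` -/

namespace Coeffs

variable (F : Coeffs ℂ ℂ)

lemma preBlock_eq (ζ : ℂ) (h : ℝ) (x : ℂ) :
    F.preBlock ζ h x = block5 (F.A11 ζ x + (h : ℂ) • b11 (F.D ζ x)) ((h : ℂ) • b12 (F.D ζ x))
      ((h : ℂ) • b21 (F.D ζ x)) (F.A22 ζ x + (h : ℂ) • b22 (F.D ζ x)) := by
  rw [preBlock]
  conv_lhs => rw [← block5_blocks (F.D ζ x)]
  rw [block5_smul, block5_add, zero_add, zero_add]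

/-- If the off-diagonal blocks solve the Riccati equations, then `Y₂` block-diagonalizes. -/
lemma deriv_Y2_add {ζ : ℂ} {h : ℝ} {β : ℂ → Matrix (Fin 2) (Fin 3) ℂ}
    {γ : ℂ → Matrix (Fin 3) (Fin 2) ℂ} {x : ℂ}
    (hβ : ∀ i j, (h : ℂ) * deriv (fun y => β y i j) x =
      ((F.A11 ζ x + (h : ℂ) • b11 (F.D ζ x)) * β x + b12 (F.D ζ x)
        - β x * (F.A22 ζ x + (h : ℂ) • b22 (F.D ζ x) + (h : ℂ) ^ 2 • (b21 (F.D ζ x) * β x))) i j)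
    (hγ : ∀ i j, (h : ℂ) * deriv (fun y => γ y i j) x =
      ((F.A22 ζ x + (h : ℂ) • b22 (F.D ζ x)) * γ x + b21 (F.D ζ x)
        - γ x * (F.A11 ζ x + (h : ℂ) • b11 (F.D ζ x) + (h : ℂ) ^ 2 • (b12 (F.D ζ x) * γ x))) i j) :
    (h : ℂ) • Matrix.of (fun i j => deriv (fun y => Y2 h (β y) (γ y) i j) x)
      + Y2 h (β x) (γ x) * F.blockDiag (β x) (γ x) ζ h x
      = F.preBlock ζ h x * Y2 h (β x) (γ x) := by
  have hd : (h : ℂ) • Matrix.of (fun i j => deriv (fun y => Y2 h (β y) (γ y) i j) x) =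
      block5 0 ((h : ℂ) • Matrix.of fun i j => (h : ℂ) * deriv (fun y => β y i j) x)
        ((h : ℂ) • Matrix.of fun i j => (h : ℂ) * deriv (fun y => γ y i j) x) 0 := by
    ext i j
    rw [Matrix.smul_apply, Matrix.of_apply]
    revert i j
    refine forall_fin5 (fun i j => ?_) (fun i j => ?_) (fun i j => ?_) (fun i j => ?_)
    · simp only [Y2_11, block5_11]; simp
    · simp only [Y2_12, block5_12, deriv_const_mul_field]; simp
    · simp only [Y2_21, block5_21, deriv_const_mul_field]; simp
    · simp only [Y2_22, block5_22]; simp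
  have hβ' := Matrix.ext hβ (M := Matrix.of fun i j => (h : ℂ) * deriv (fun y => β y i j) x)
  have hγ' := Matrix.ext hγ (M := Matrix.of fun i j => (h : ℂ) * deriv (fun y => γ y i j) x)
  rw [hd, hβ', hγ', preBlock_eq, blockDiag, Y2, block5_mul, block5_mul, block5_add]
  congr 1
  · simp only [Matrix.mul_one, Matrix.one_mul, Matrix.mul_zero, Matrix.smul_mul, Matrix.mul_smul]
    module
  · simp only [Matrix.mul_one, Matrix.mul_zero, Matrix.smul_mul, Matrix.mul_smul,
      Matrix.add_mul, Matrix.mul_add]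
    module
  · simp only [Matrix.mul_one, Matrix.mul_zero, Matrix.smul_mul, Matrix.mul_smul,
      Matrix.add_mul, Matrix.mul_add]
    module
  · simp only [Matrix.mul_one, Matrix.one_mul, Matrix.mul_zero, Matrix.smul_mul, Matrix.mul_smul]
    module

/-- The algebraic nondegeneracy conditions and the definition of the sound speed at `x`. -/
structure Regular (x : ℂ) : Prop where
  u : F.u x ≠ 0
  v : F.v x ≠ 0
  c0 : F.c0 x ≠ 0
  sub : F.c0 x ^ 2 - F.u x ^ 2 ≠ 0
  pv : F.pv x = -(F.c0 x ^ 2 / F.v x ^ 2)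

variable {F} {x : ℂ}

/-- An explicit right inverse of `A_x`. -/
lemma Regular.Ax_mul (hF : F.Regular x) :
    F.Ax x * !![-F.u x / (F.c0 x ^ 2 - F.u x ^ 2), -F.v x / (F.c0 x ^ 2 - F.u x ^ 2), 0,
        F.v x ^ 2 * F.pS x / (F.u x * (F.c0 x ^ 2 - F.u x ^ 2)),
        F.v x ^ 2 * F.plam x / (F.u x * (F.c0 x ^ 2 - F.u x ^ 2));
      -F.c0 x ^ 2 / (F.v x * (F.c0 x ^ 2 - F.u x ^ 2)), -F.u x / (F.c0 x ^ 2 - F.u x ^ 2), 0,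
        F.v x * F.pS x / (F.c0 x ^ 2 - F.u x ^ 2), F.v x * F.plam x / (F.c0 x ^ 2 - F.u x ^ 2);
      0, 0, (F.u x)⁻¹, 0, 0; 0, 0, 0, (F.u x)⁻¹, 0; 0, 0, 0, 0, (F.u x)⁻¹] = 1 := by
  have hu := hF.u
  have hv := hF.v
  have hc := hF.c0
  have hs := hF.sub
  ext i j
  fin_cases i <;> fin_cases j <;>
    simp [Ax, Matrix.mul_apply, Fin.sum_univ_succ, hF.pv] <;> field_simp <;> ring

lemma Regular.isUnit_det_Ax (hF : F.Regular x) : IsUnit (F.Ax x).det :=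
  Matrix.isUnit_det_of_right_inverse hF.Ax_mul

/-- `Y₁` block-diagonalizes the principal part. -/
lemma Regular.Phi0_mul_Y1 (hF : F.Regular x) (ζ : ℂ) :
    F.Phi0 ζ x * F.Y1 ζ x = F.Y1 ζ x * block5 (F.A11 ζ x) 0 0 (F.A22 ζ x) := by
  have hu := hF.u
  have hv := hF.v
  have hc := hF.c0
  have hs := hF.sub
  have hb : block5 (F.A11 ζ x) 0 0 (F.A22 ζ x) =
      !![F.A11 ζ x 0 0, F.A11 ζ x 0 1, 0, 0, 0; F.A11 ζ x 1 0, F.A11 ζ x 1 1, 0, 0, 0;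
        0, 0, ζ / F.u x, 0, 0; 0, 0, 0, ζ / F.u x, 0; 0, 0, 0, 0, ζ / F.u x] := by
    rw [block5_eq_of]
    simp [A22]
  have hη : F.eta x = (F.c0 x ^ 2 - F.u x ^ 2) / F.c0 x ^ 2 := by
    rw [eta, kappa]; field_simp
  have hη1 : 1 - (F.c0 x ^ 2 - F.u x ^ 2) / F.c0 x ^ 2 = F.u x ^ 2 / F.c0 x ^ 2 := by
    field_simp; ring
  have hM : ζ • (1 : Matrix (Fin 5) (Fin 5) ℂ) + Complex.I • F.Ay x =
      !![ζ, 0, -(Complex.I * F.v x), 0, 0; 0, ζ, 0, 0, 0;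
        -(Complex.I * F.c0 x ^ 2 / F.v x), 0, ζ, Complex.I * (F.v x * F.pS x),
          Complex.I * (F.v x * F.plam x);
        0, 0, 0, ζ, 0; 0, 0, 0, 0, ζ] := by
    ext i j
    fin_cases i <;> fin_cases j <;> simp [Ay, hF.pv]
    field_simp
  rw [hb, Phi0, hM, Matrix.inv_eq_right_inv hF.Ax_mul]
  have hI : Complex.I ^ 2 = -1 := Complex.I_sq
  ext i j
  fin_cases i <;> fin_cases j <;>
    simp [Y1, A11, sSq, Matrix.mul_apply, Fin.sum_univ_succ, hη1, hη, kappa, m] <;>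
    field_simp <;> first | done | ring1 | (ring_nf; simp only [hI]; ring1)

end Coeffs

namespace Coeffs

variable {F : Coeffs ℂ ℂ}

/-- No regularity is needed, so the formula holds at every x and limits can be taken in it directly.
-/
lemma det_Y1 (F : Coeffs ℂ ℂ) (ζ x : ℂ) :
    (F.Y1 ζ x).det = F.m x / (F.kappa x * F.u x) * (1 - (ζ / F.u x) ^ 2) := by
  simp [Y1, Matrix.det_succ_row_zero, Fin.sum_univ_succ, Fin.succAbove]
  ring

/-- The definition of `D` is arranged so that Y₁ `preBlock` + h Y₁' = `G` Y₁. The conjugation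
identity for Y₁ Y then follows from the one for Y by the product rule. -/
lemma deriv_Y1_mul_add {ζ x : ℂ} {h : ℝ} (hF : F.Regular x)
    (hY1 : ∀ i j, DifferentiableAt ℂ (fun y => F.Y1 ζ y i j) x) (hdet : IsUnit (F.Y1 ζ x).det)
    {Y : ℂ → Matrix (Fin 5) (Fin 5) ℂ} {B : Matrix (Fin 5) (Fin 5) ℂ}
    (hYd : ∀ i j, DifferentiableAt ℂ (fun y => Y y i j) x)
    (hY : (h : ℂ) • Matrix.of (fun i j => deriv (fun y => Y y i j) x) + Y x * B
      = F.preBlock ζ h x * Y x) :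
    (h : ℂ) • Matrix.of (fun i j => deriv (fun y => (F.Y1 ζ y * Y y) i j) x) + F.Y1 ζ x * Y x * B
      = F.G ζ h x * (F.Y1 ζ x * Y x) := by
  have hd : Matrix.of (fun i j => deriv (fun y => (F.Y1 ζ y * Y y) i j) x) =
      F.dY1 ζ x * Y x + F.Y1 ζ x * Matrix.of (fun i j => deriv (fun y => Y y i j) x) := by
    ext i j
    simp only [Matrix.of_apply, Matrix.mul_apply, Matrix.add_apply, dY1]
    rw [deriv_fun_sum fun k _ => (hY1 i k).fun_mul (hYd k j), ← Finset.sum_add_distrib]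
    exact Finset.sum_congr rfl fun k _ => deriv_fun_mul (hY1 i k) (hYd k j)
  have hpre : F.Y1 ζ x * F.preBlock ζ h x + (h : ℂ) • F.dY1 ζ x = F.G ζ h x * F.Y1 ζ x := by
    have h1 : F.Y1 ζ x * F.D ζ x = F.Phi1 x * F.Y1 ζ x - F.dY1 ζ x := by
      rw [D, Matrix.mul_sub, ← Matrix.mul_assoc, ← Matrix.mul_assoc, ← Matrix.mul_assoc,
        Matrix.mul_nonsing_inv _ hdet, Matrix.one_mul, Matrix.one_mul]
    rw [preBlock, Matrix.mul_add, ← hF.Phi0_mul_Y1, Matrix.mul_smul, h1, G, Matrix.add_mul,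
      Matrix.smul_mul]
    module
  rw [hd, ← Matrix.mul_assoc, ← hpre, Matrix.add_mul, Matrix.mul_assoc, Matrix.mul_assoc, ← hY]
  simp only [smul_add, Matrix.mul_add, Matrix.smul_mul, Matrix.mul_smul]
  abel

end Coeffs

/-! ### Exponential limits of the coefficient matrices -/

/-- All entries have limits in the sense of `HasExpLimit`. -/
def HasExpLimits {m n : Type*} (μ : ℝ) (ζ₀ : ℂ) (A : ℂ → ℂ → Matrix m n ℂ) : Prop :=
  ∀ i j, ∃ c, HasExpLimit μ ζ₀ (fun ζ x => A ζ x i j) c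

namespace HasExpLimits

variable {l m n : Type*} {μ : ℝ} {ζ₀ : ℂ}

lemma mul [Fintype m] {A : ℂ → ℂ → Matrix l m ℂ} {B : ℂ → ℂ → Matrix m n ℂ}
    (hA : HasExpLimits μ ζ₀ A) (hB : HasExpLimits μ ζ₀ B) :
    HasExpLimits μ ζ₀ fun ζ x => A ζ x * B ζ x := fun i j => by
  choose a ha using hA
  choose b hb using hB
  exact ⟨_, HasExpLimit.sum fun k _ => (ha i k).mul (hb k j)⟩

lemma sub {A B : ℂ → ℂ → Matrix m n ℂ} (hA : HasExpLimits μ ζ₀ A) (hB : HasExpLimits μ ζ₀ B) :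
    HasExpLimits μ ζ₀ fun ζ x => A ζ x - B ζ x := fun i j =>
  ⟨_, (hA i j).choose_spec.sub (hB i j).choose_spec⟩

lemma transpose {A : ℂ → ℂ → Matrix m n ℂ} (hA : HasExpLimits μ ζ₀ A) :
    HasExpLimits μ ζ₀ fun ζ x => (A ζ x)ᵀ := fun i j => hA j i

lemma deriv {A : ℂ → ℂ → Matrix m n ℂ} (hA : HasExpLimits μ ζ₀ A) :
    HasExpLimits μ ζ₀ fun ζ x => Matrix.of fun i j => deriv (fun y => A ζ y i j) x :=
  fun i j => ⟨_, (hA i j).choose_spec.deriv⟩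

lemma det [Fintype n] [DecidableEq n] {A : ℂ → ℂ → Matrix n n ℂ} (hA : HasExpLimits μ ζ₀ A) :
    ∃ c, HasExpLimit μ ζ₀ (fun ζ x => (A ζ x).det) c := by
  choose a ha using hA
  refine ⟨_, (HasExpLimit.sum (s := Finset.univ) fun (σ : Equiv.Perm n) _ =>
    (HasExpLimit.const ((Equiv.Perm.sign σ : ℤ) : ℂ)).mul
      (HasExpLimit.prod (s := Finset.univ) fun (i : n) _ => ha (σ i) i)).congr_fun fun ζ x => ?_⟩
  rw [Matrix.det_apply']

lemma inv [Fintype n] [DecidableEq n] {A : ℂ → ℂ → Matrix n n ℂ} (hA : HasExpLimits μ ζ₀ A) {c : ℂ}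
    (hc : c ≠ 0) (hdet : HasExpLimit μ ζ₀ (fun ζ x => (A ζ x).det) c) :
    HasExpLimits μ ζ₀ fun ζ x => (A ζ x)⁻¹ := fun i j => by
  have hadj : HasExpLimits μ ζ₀ fun ζ x => (A ζ x).updateRow j (Pi.single i 1) := fun k l => by
    by_cases hk : k = j
    · subst hk
      simp only [Matrix.updateRow_self]
      exact ⟨_, HasExpLimit.const _⟩
    · simp only [Matrix.updateRow_ne hk]
      exact hA k l
  obtain ⟨d, hd⟩ := hadj.det
  simp only [Matrix.inv_def, Matrix.smul_apply, Matrix.adjugate_apply, Ring.inverse_eq_inv', smul_eq_mul]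
  exact ⟨_, (hdet.inv hc).mul hd⟩

end HasExpLimits

/-- The scalar functions converge exponentially at `+∞`, to the given nondegenerate limits. -/
structure Coeffs.Converges (F : Coeffs ℂ ℂ) (μ : ℝ) (uI vI cI : ℝ) : Prop where
  u_pos : 0 < uI
  v_pos : 0 < vI
  lt : uI < cI
  v : ∀ ζ₀, HasExpLimit μ ζ₀ (fun _ => F.v) vI
  u : ∀ ζ₀, HasExpLimit μ ζ₀ (fun _ => F.u) uI
  c0 : ∀ ζ₀, HasExpLimit μ ζ₀ (fun _ => F.c0) cI
  pv_eq : ∀ x, F.pv x = -(F.c0 x ^ 2 / F.v x ^ 2)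
  S : ∃ c, ∀ ζ₀, HasExpLimit μ ζ₀ (fun _ => F.S) c
  lam : ∃ c, ∀ ζ₀, HasExpLimit μ ζ₀ (fun _ => F.lam) c
  p : ∃ c, ∀ ζ₀, HasExpLimit μ ζ₀ (fun _ => F.p) c
  pv : ∃ c, ∀ ζ₀, HasExpLimit μ ζ₀ (fun _ => F.pv) c
  pS : ∃ c, ∀ ζ₀, HasExpLimit μ ζ₀ (fun _ => F.pS) c
  plam : ∃ c, ∀ ζ₀, HasExpLimit μ ζ₀ (fun _ => F.plam) c
  Phiv : ∃ c, ∀ ζ₀, HasExpLimit μ ζ₀ (fun _ => F.Phiv) c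
  PhiS : ∃ c, ∀ ζ₀, HasExpLimit μ ζ₀ (fun _ => F.PhiS) c
  Philam : ∃ c, ∀ ζ₀, HasExpLimit μ ζ₀ (fun _ => F.Philam) c
  rv : ∃ c, ∀ ζ₀, HasExpLimit μ ζ₀ (fun _ => F.rv) c
  rS : ∃ c, ∀ ζ₀, HasExpLimit μ ζ₀ (fun _ => F.rS) c
  rlam : ∃ c, ∀ ζ₀, HasExpLimit μ ζ₀ (fun _ => F.rlam) c

namespace Coeffs.Converges

variable {F : Coeffs ℂ ℂ} {μ uI vI cI : ℝ}

lemma u_ne (hF : F.Converges μ uI vI cI) : (uI : ℂ) ≠ 0 := Complex.ofReal_ne_zero.2 hF.u_pos.ne'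

lemma v_ne (hF : F.Converges μ uI vI cI) : (vI : ℂ) ≠ 0 := Complex.ofReal_ne_zero.2 hF.v_pos.ne'

lemma c_pos (hF : F.Converges μ uI vI cI) : 0 < cI := hF.u_pos.trans hF.lt

lemma c_ne (hF : F.Converges μ uI vI cI) : (cI : ℂ) ≠ 0 := Complex.ofReal_ne_zero.2 hF.c_pos.ne'

lemma sub_ne (hF : F.Converges μ uI vI cI) : (cI : ℂ) ^ 2 - (uI : ℂ) ^ 2 ≠ 0 := by
  have h1 := hF.lt
  have h2 := hF.u_pos
  exact_mod_cast (show cI ^ 2 - uI ^ 2 ≠ 0 by nlinarith)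

lemma eta_pos (hF : F.Converges μ uI vI cI) : 0 < 1 - (uI / cI) ^ 2 := by
  have h1 : uI / cI < 1 := (div_lt_one hF.c_pos).2 hF.lt
  have h2 : 0 < uI / cI := div_pos hF.u_pos hF.c_pos
  nlinarith

lemma eta_ne (hF : F.Converges μ uI vI cI) : 1 - ((uI : ℂ) / cI) ^ 2 ≠ 0 := by
  exact_mod_cast hF.eta_pos.ne'

lemma kappa (hF : F.Converges μ uI vI cI) (ζ₀ : ℂ) : HasExpLimit μ ζ₀ (fun _ => F.kappa) (uI / cI) :=
  (hF.u ζ₀).div (hF.c0 ζ₀) hF.c_ne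

lemma kappa_ne (hF : F.Converges μ uI vI cI) : (uI : ℂ) / cI ≠ 0 := div_ne_zero hF.u_ne hF.c_ne

lemma eta (hF : F.Converges μ uI vI cI) (ζ₀ : ℂ) : HasExpLimit μ ζ₀ (fun _ => F.eta) (1 - ((uI : ℂ) / cI) ^ 2) :=
  (HasExpLimit.const 1).sub ((hF.kappa ζ₀).pow 2)

lemma m (hF : F.Converges μ uI vI cI) (ζ₀ : ℂ) : HasExpLimit μ ζ₀ (fun _ => F.m) (uI / vI) := (hF.u ζ₀).div (hF.v ζ₀) hF.v_ne

lemma eventually_regular (hF : F.Converges μ uI vI cI) (hμ : 0 < μ) :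
    ∀ᶠ M in Filter.atTop, ∀ x : ℂ, M < x.re → F.Regular x := by
  filter_upwards [(hF.u 0).eventually_ne_zero hμ hF.u_ne, (hF.v 0).eventually_ne_zero hμ hF.v_ne,
    (hF.c0 0).eventually_ne_zero hμ hF.c_ne,
    (((hF.c0 0).pow 2).sub ((hF.u 0).pow 2)).eventually_ne_zero hμ hF.sub_ne] with M h1 h2 h3 h4 x hx
  exact ⟨h1.self_of_nhds x hx, h2.self_of_nhds x hx, h3.self_of_nhds x hx, h4.self_of_nhds x hx,
    hF.pv_eq x⟩

lemma Y1 (hF : F.Converges μ uI vI cI) (ζ₀ : ℂ) : HasExpLimits μ ζ₀ F.Y1 := by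
  obtain ⟨s, hs⟩ := hF.pS
  obtain ⟨l, hl⟩ := hF.plam
  have e12 := (hF.m ζ₀).div ((hF.kappa ζ₀).mul (hF.u ζ₀)) (mul_ne_zero hF.kappa_ne hF.u_ne)
  have e13 := (((HasExpLimit.const Complex.I).mul (hF.m ζ₀)).neg).div
    ((HasExpLimit.const 1).sub (hF.eta ζ₀)) (by
      rw [sub_sub_cancel]; exact pow_ne_zero _ hF.kappa_ne)
  have eζ := (HasExpLimit.param (ζ₀ := ζ₀)).div (hF.u ζ₀) hF.u_ne
  have eI := HasExpLimit.const (μ := μ) (ζ₀ := ζ₀) Complex.I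
  have eq := ((hF.kappa ζ₀).div ((hF.m ζ₀).mul (hF.u ζ₀))
    (mul_ne_zero (div_ne_zero hF.u_ne hF.v_ne) hF.u_ne)).neg
  have e0 := HasExpLimit.const (μ := μ) (ζ₀ := ζ₀) 0
  have e1 := HasExpLimit.const (μ := μ) (ζ₀ := ζ₀) 1
  intro i j
  fin_cases i <;> fin_cases j
  exacts [⟨_, e0⟩, ⟨_, e12⟩, ⟨_, e13⟩, ⟨_, e0⟩, ⟨_, e0⟩,
    ⟨_, eζ⟩, ⟨_, e0⟩, ⟨_, eI⟩, ⟨_, e0⟩, ⟨_, e0⟩,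
    ⟨_, eI.neg⟩, ⟨_, e0⟩, ⟨_, eζ⟩, ⟨_, e0⟩, ⟨_, e0⟩,
    ⟨_, e0⟩, ⟨_, eq.mul (hs ζ₀)⟩, ⟨_, e0⟩, ⟨_, e1⟩, ⟨_, e0⟩,
    ⟨_, e0⟩, ⟨_, eq.mul (hl ζ₀)⟩, ⟨_, e0⟩, ⟨_, e0⟩, ⟨_, e1⟩]

lemma Ax (hF : F.Converges μ uI vI cI) (ζ₀ : ℂ) : HasExpLimits μ ζ₀ (fun _ => F.Ax) := by
  obtain ⟨s, hs⟩ := hF.pS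
  obtain ⟨l, hl⟩ := hF.plam
  obtain ⟨p, hp⟩ := hF.pv
  have e0 := HasExpLimit.const (μ := μ) (ζ₀ := ζ₀) 0
  have eu := hF.u ζ₀
  have ev := hF.v ζ₀
  intro i j
  fin_cases i <;> fin_cases j
  exacts [⟨_, eu⟩, ⟨_, ev.neg⟩, ⟨_, e0⟩, ⟨_, e0⟩, ⟨_, e0⟩,
    ⟨_, ev.mul (hp ζ₀)⟩, ⟨_, eu⟩, ⟨_, e0⟩, ⟨_, ev.mul (hs ζ₀)⟩, ⟨_, ev.mul (hl ζ₀)⟩,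
    ⟨_, e0⟩, ⟨_, e0⟩, ⟨_, eu⟩, ⟨_, e0⟩, ⟨_, e0⟩,
    ⟨_, e0⟩, ⟨_, e0⟩, ⟨_, e0⟩, ⟨_, eu⟩, ⟨_, e0⟩,
    ⟨_, e0⟩, ⟨_, e0⟩, ⟨_, e0⟩, ⟨_, e0⟩, ⟨_, eu⟩]

lemma B (hF : F.Converges μ uI vI cI) (ζ₀ : ℂ) : HasExpLimits μ ζ₀ (fun _ => F.B) := by
  obtain ⟨_, hS⟩ := hF.S
  obtain ⟨_, hlam⟩ := hF.lam
  obtain ⟨_, hp⟩ := hF.p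
  obtain ⟨_, hs⟩ := hF.pS
  obtain ⟨_, hl⟩ := hF.plam
  obtain ⟨_, h1⟩ := hF.Phiv
  obtain ⟨_, h2⟩ := hF.PhiS
  obtain ⟨_, h3⟩ := hF.Philam
  obtain ⟨_, h4⟩ := hF.rv
  obtain ⟨_, h5⟩ := hF.rS
  obtain ⟨_, h6⟩ := hF.rlam
  have e0 := HasExpLimit.const (μ := μ) (ζ₀ := ζ₀) 0
  have eu := (hF.u ζ₀).deriv
  have ev := hF.v ζ₀
  have ec := ((((hF.c0 ζ₀).pow 2).div (ev.pow 2) (pow_ne_zero _ hF.v_ne))).deriv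
  intro i j
  fin_cases i <;> fin_cases j
  exacts [⟨_, eu.neg⟩, ⟨_, ev.deriv⟩, ⟨_, e0⟩, ⟨_, e0⟩, ⟨_, e0⟩,
    ⟨_, (hp ζ₀).deriv.sub (ev.mul ec)⟩, ⟨_, eu⟩, ⟨_, e0⟩, ⟨_, ev.mul (hs ζ₀).deriv⟩,
      ⟨_, ev.mul (hl ζ₀).deriv⟩,
    ⟨_, e0⟩, ⟨_, e0⟩, ⟨_, e0⟩, ⟨_, e0⟩, ⟨_, e0⟩,
    ⟨_, (h1 ζ₀).neg⟩, ⟨_, (hS ζ₀).deriv⟩, ⟨_, e0⟩, ⟨_, (h2 ζ₀).neg⟩, ⟨_, (h3 ζ₀).neg⟩,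
    ⟨_, (h4 ζ₀).neg⟩, ⟨_, (hlam ζ₀).deriv⟩, ⟨_, e0⟩, ⟨_, (h5 ζ₀).neg⟩, ⟨_, (h6 ζ₀).neg⟩]

/-- The quotient v² / v² is left unreduced because the function must agree with the determinant at
every x, including points where v might vanish; there both sides lose the corresponding term. -/
lemma det_Ax (hF : F.Converges μ uI vI cI) (ζ₀ : ℂ) : HasExpLimit μ ζ₀ (fun _ x => (F.Ax x).det)
    ((uI : ℂ) ^ 3 * ((uI : ℂ) ^ 2 - (cI : ℂ) ^ 2 * (vI ^ 2 / vI ^ 2))) := by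
  refine (((hF.u ζ₀).pow 3).mul (((hF.u ζ₀).pow 2).sub (((hF.c0 ζ₀).pow 2).mul
    (((hF.v ζ₀).pow 2).div ((hF.v ζ₀).pow 2) (pow_ne_zero _ hF.v_ne))))).congr_fun fun ζ x => ?_
  simp [Coeffs.Ax, Matrix.det_succ_row_zero, Fin.sum_univ_succ, Fin.succAbove, hF.pv_eq]
  ring

lemma Phi1 (hF : F.Converges μ uI vI cI) (ζ₀ : ℂ) : HasExpLimits μ ζ₀ (fun _ => F.Phi1) := by
  refine (((hF.Ax ζ₀).inv ?_ (hF.det_Ax ζ₀)).mul (hF.B ζ₀)).transpose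
  rw [div_self (pow_ne_zero _ hF.v_ne), mul_one]
  exact mul_ne_zero (pow_ne_zero _ hF.u_ne) (by rw [← neg_sub]; exact neg_ne_zero.2 hF.sub_ne)

lemma det_Y1 (hF : F.Converges μ uI vI cI) (ζ₀ : ℂ) : HasExpLimit μ ζ₀ (fun ζ x => (F.Y1 ζ x).det)
    ((uI / vI : ℂ) / (uI / cI * uI) * (1 - (ζ₀ / uI) ^ 2)) :=
  (((hF.m ζ₀).div ((hF.kappa ζ₀).mul (hF.u ζ₀)) (mul_ne_zero hF.kappa_ne hF.u_ne)).mul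
    ((HasExpLimit.const 1).sub ((HasExpLimit.param.div (hF.u ζ₀) hF.u_ne).pow 2))).congr_fun
    fun ζ x => (F.det_Y1 ζ x).symm

/-- `Y₁` is nondegenerate at infinity at the turning point frequency. -/
lemma det_Y1_ne (hF : F.Converges μ uI vI cI) {ζ₀ : ℂ} (hζ : ζ₀ ^ 2 = -((cI : ℂ) ^ 2 * (1 - ((uI : ℂ) / cI) ^ 2))) :
    (uI / vI : ℂ) / (uI / cI * uI) * (1 - (ζ₀ / uI) ^ 2) ≠ 0 := by
  refine mul_ne_zero (div_ne_zero (div_ne_zero hF.u_ne hF.v_ne) (mul_ne_zero hF.kappa_ne hF.u_ne)) ?_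
  rw [div_pow, hζ]
  have h1 := hF.u_ne
  have h2 := hF.c_ne
  have e : 1 - -((cI : ℂ) ^ 2 * (1 - ((uI : ℂ) / cI) ^ 2)) / (uI : ℂ) ^ 2 = (cI / uI : ℂ) ^ 2 := by
    field_simp
    ring
  rw [e]
  exact pow_ne_zero _ (div_ne_zero h2 h1)

lemma D (hF : F.Converges μ uI vI cI) {ζ₀ : ℂ} (hζ : ζ₀ ^ 2 = -((cI : ℂ) ^ 2 * (1 - ((uI : ℂ) / cI) ^ 2))) :
    HasExpLimits μ ζ₀ F.D := by
  have hinv := (hF.Y1 ζ₀).inv (hF.det_Y1_ne hζ) (hF.det_Y1 ζ₀)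
  exact ((hinv.mul (hF.Phi1 ζ₀)).mul (hF.Y1 ζ₀)).sub (hinv.mul (hF.Y1 ζ₀).deriv)

/-- The frequency is the turning point: s² = ζ² + c₀² η vanishes there at infinity, so the lower
left entry has limit 0 and the limit is a Jordan block. -/
lemma A11 (hF : F.Converges μ uI vI cI) {ζ₀ : ℂ} (hζ : ζ₀ ^ 2 = -((cI : ℂ) ^ 2 * (1 - ((uI : ℂ) / cI) ^ 2))) (i j : Fin 2) :
    HasExpLimit μ ζ₀ (fun ζ x => F.A11 ζ x i j)
      (!![-((uI / cI : ℂ) ^ 2 * ζ₀) / ((1 - ((uI : ℂ) / cI) ^ 2) * uI),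
          -(uI / cI : ℂ) / ((1 - ((uI : ℂ) / cI) ^ 2) * uI);
        0, -((uI / cI : ℂ) ^ 2 * ζ₀) / ((1 - ((uI : ℂ) / cI) ^ 2) * uI)] i j) := by
  have eu := (hF.eta ζ₀).mul (hF.u ζ₀)
  have hne := mul_ne_zero hF.eta_ne hF.u_ne
  have ea := ((((hF.kappa ζ₀).pow 2).mul HasExpLimit.param).neg).div eu hne
  have eb := ((hF.kappa ζ₀).neg).div eu hne
  have es := (((((HasExpLimit.param (ζ₀ := ζ₀)).pow 2).add (((hF.c0 ζ₀).pow 2).mul (hF.eta ζ₀))).mul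
    (hF.kappa ζ₀)).neg.div eu hne).congr_limit (d := 0) (by rw [hζ]; simp)
  fin_cases i <;> fin_cases j
  exacts [ea, eb, es, ea]

lemma A22 (hF : F.Converges μ uI vI cI) (ζ₀ : ℂ) (i j : Fin 3) : HasExpLimit μ ζ₀ (fun ζ x => F.A22 ζ x i j)
    (((ζ₀ / uI) • (1 : Matrix (Fin 3) (Fin 3) ℂ)) i j) :=
  (HasExpLimit.param.div (hF.u ζ₀) hF.u_ne).mul (HasExpLimit.const _)

end Coeffs.Converges


/-! ### Analytic extension of the coefficients along a profile -/

lemma HasExpLimit.eventually_isExtension {μ : ℝ} (hμ : 0 < μ) {G : ℂ → ℂ} {c : ℂ}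
    (hG : HasExpLimit μ 0 (fun _ => G) c) {f : ℝ → ℝ}
    (hf : ∀ᶠ x : ℝ in Filter.atTop, G x = (f x : ℂ)) :
    ∀ᶠ M in Filter.atTop, IsExtension M f G := by
  obtain ⟨M₀, hM₀⟩ := Filter.eventually_atTop.1 hf
  filter_upwards [hG.eventually_differentiableAt hμ, Filter.eventually_ge_atTop M₀] with M hM h
  exact ⟨fun x hx => (hM.self_of_nhds x hx).differentiableWithinAt,
    fun x hx => hM₀ x (h.trans hx.le)⟩

namespace Profile

variable {Θ : Thermo} (P : Profile Θ)

/-- Analytic functions of the state have extensions along a profile. -/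
lemma exists_extension {g : State → ℝ} (hg : AnalyticAt ℝ g P.stateInf) :
    ∃ G : ℂ → ℂ, (∀ᶠ M in Filter.atTop, IsExtension M (fun x => g (P.state x)) G) ∧
      ∀ ζ₀, HasExpLimit P.mu ζ₀ (fun _ => G) (g P.stateInf) := by
  obtain ⟨σ, hσ, hσ0, hσe⟩ := P.exists_state_eq_comp_exp
  obtain ⟨G, hG, hGl⟩ := exists_hasExpLimit_of_analyticAt (g := fun z => g (σ z))
    (AnalyticAt.comp (g := g) (by rwa [hσ0]) hσ) P.mu_pos
  simp only [hσ0] at hGl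
  refine ⟨G, (hGl 0).eventually_isExtension P.mu_pos ?_, hGl⟩
  filter_upwards [hG, hσe] with x h1 h2
  rw [h1, h2]

lemma analyticAt_soundSpeed : AnalyticAt ℝ Θ.soundSpeed P.stateInf := by
  have h : AnalyticAt ℝ Real.sqrt (-(P.stateInf.1 ^ 2 * dv Θ.p P.stateInf)) :=
    (Real.contDiffAt_sqrt (n := ⊤) (Real.sqrt_pos.1 P.soundSpeed_pos).ne').analyticAt
  exact AnalyticAt.comp (g := Real.sqrt) (f := fun w : State => -(w.1 ^ 2 * dv Θ.p w)) h
    (((analyticAt_fst.pow 2).mul (analyticAt_dv (Θ.analytic_p _ P.stateInf_mem_dom))).neg)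

lemma analyticAt_source : AnalyticAt ℝ Θ.source P.stateInf :=
  (((Θ.analytic_r _ P.stateInf_mem_dom).mul (Θ.analytic_dF _ P.stateInf_mem_dom)).neg).div
    (Θ.analytic_T _ P.stateInf_mem_dom) (Θ.T_pos _ P.stateInf_mem_dom).ne'

/-- The scalar functions extend analytically to a half-plane, with exponential convergence. -/
lemma exists_coeffs_extends : ∃ F : Coeffs ℂ ℂ,
    (∀ᶠ M in Filter.atTop, F.Extends P.coeffs M) ∧
    F.Converges P.mu P.uInf P.vInf (Θ.soundSpeed P.stateInf) := by
  obtain ⟨m, hm, hum, huInf⟩ := P.exists_massFlux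
  have hp := Θ.analytic_p _ P.stateInf_mem_dom
  have hr := Θ.analytic_r _ P.stateInf_mem_dom
  have hΦ := P.analyticAt_source
  obtain ⟨v, ev, lv⟩ := P.exists_extension (g := fun w => w.1) analyticAt_fst
  -- The velocity is not part of the state; mass conservation makes it m v for x > 0.
  obtain ⟨u, eu, lu⟩ := P.exists_extension (g := fun w => m * w.1)
    (analyticAt_const.mul analyticAt_fst)
  obtain ⟨S, eS, lS⟩ := P.exists_extension (g := fun w => w.2.1)
    (analyticAt_fst.comp analyticAt_snd)
  obtain ⟨lam, elam, llam⟩ := P.exists_extension (g := fun w => w.2.2)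
    (analyticAt_snd.comp analyticAt_snd)
  obtain ⟨p, ep, lp⟩ := P.exists_extension hp
  obtain ⟨pS, epS, lpS⟩ := P.exists_extension (analyticAt_dS hp)
  obtain ⟨plam, eplam, lplam⟩ := P.exists_extension (analyticAt_dlam hp)
  obtain ⟨c0, ec0, lc0⟩ := P.exists_extension P.analyticAt_soundSpeed
  obtain ⟨Phiv, ePhiv, lPhiv⟩ := P.exists_extension (analyticAt_dv hΦ)
  obtain ⟨PhiS, ePhiS, lPhiS⟩ := P.exists_extension (analyticAt_dS hΦ)
  obtain ⟨Philam, ePhilam, lPhilam⟩ := P.exists_extension (analyticAt_dlam hΦ)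
  obtain ⟨rv, erv, lrv⟩ := P.exists_extension (analyticAt_dv hr)
  obtain ⟨rS, erS, lrS⟩ := P.exists_extension (analyticAt_dS hr)
  obtain ⟨rlam, erlam, lrlam⟩ := P.exists_extension (analyticAt_dlam hr)
  have hu0 : m * P.stateInf.1 = P.uInf := huInf.symm
  simp only [hu0] at lu
  have hvne : (P.vInf : ℂ) ≠ 0 := Complex.ofReal_ne_zero.2 P.vInf_pos.ne'
  -- Instead of an independent extension, p_v is taken to be −c₀² / v² in the complex domain. The
  -- relation with the sound speed then holds at every x, and only agreement with p_v on the real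
  -- axis has to be checked.
  have lpv : ∀ ζ₀, HasExpLimit P.mu ζ₀ (fun _ x => -(c0 x ^ 2 / v x ^ 2))
      (-((Θ.soundSpeed P.stateInf : ℂ) ^ 2 / (P.vInf : ℂ) ^ 2)) := fun ζ₀ =>
    (((lc0 ζ₀).pow 2).div ((lv ζ₀).pow 2) (pow_ne_zero _ hvne)).neg
  have epv := (lpv 0).eventually_isExtension P.mu_pos (f := fun x => dv Θ.p (P.state x)) (by
    obtain ⟨M, h1, h2⟩ := (ev.and ec0).exists
    have hpos : ∀ᶠ x in Filter.atTop, 0 < Θ.soundSpeed (P.state x) :=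
      ((continuousAt_soundSpeed P.stateInf_mem_dom).tendsto.comp P.tendsto_state).eventually
        (lt_mem_nhds P.soundSpeed_pos)
    filter_upwards [hpos, Filter.eventually_gt_atTop M, Filter.eventually_ge_atTop 0] with x hx hxM hx0
    have hv : 0 < (P.state x).1 := P.v_pos x hx0
    rw [h1.2 x hxM, h2.2 x hxM]
    have := soundSpeed_sq hx
    rw [← Complex.ofReal_pow, this]
    push_cast
    have hvC : ((P.state x).1 : ℂ) ≠ 0 := Complex.ofReal_ne_zero.2 hv.ne'
    field_simp)
  refine ⟨⟨v, u, S, lam, p, fun x => -(c0 x ^ 2 / v x ^ 2), pS, plam, c0, Phiv, PhiS, Philam, rv, rS,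
    rlam⟩, ?_, P.uInf_pos, P.vInf_pos, P.uInf_lt_soundSpeed, lv, lu, lc0, fun _ => rfl, ⟨_, lS⟩,
    ⟨_, llam⟩, ⟨_, lp⟩, ⟨_, lpv⟩, ⟨_, lpS⟩, ⟨_, lplam⟩, ⟨_, lPhiv⟩, ⟨_, lPhiS⟩, ⟨_, lPhilam⟩,
    ⟨_, lrv⟩, ⟨_, lrS⟩, ⟨_, lrlam⟩⟩
  filter_upwards [ev, eu, eS, elam, ep, epv, epS, eplam, ec0, ePhiv, ePhiS, ePhilam, erv, erS, erlam,
    Filter.eventually_ge_atTop 0] with M ev eu eS elam ep epv epS eplam ec0 ePhiv ePhiS ePhilam erv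
    erS erlam hM
  refine ⟨ev, ⟨eu.1, fun x hx => ?_⟩, eS, elam, ep, epv, epS, eplam, ec0, ePhiv, ePhiS, ePhilam, erv,
    erS, erlam⟩
  change u x = (P.u x : ℂ)
  rw [eu.2 x hx, hum x (hM.trans_lt hx)]
  rfl

lemma zetaInf_sq : P.zetaInf ^ 2 = -((Θ.soundSpeed P.stateInf : ℂ) ^ 2 *
    (1 - ((P.uInf : ℂ) / Θ.soundSpeed P.stateInf) ^ 2)) := by
  have hη : 0 ≤ P.etaInf := by
    have h1 := (div_lt_one P.soundSpeed_pos).2 P.uInf_lt_soundSpeed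
    have h2 := div_pos P.uInf_pos P.soundSpeed_pos
    rw [etaInf]; nlinarith
  have h3 : ((Real.sqrt P.etaInf : ℝ) : ℂ) ^ 2 =
      1 - ((P.uInf : ℂ) / Θ.soundSpeed P.stateInf) ^ 2 := by
    rw [← Complex.ofReal_pow, Real.sq_sqrt hη, etaInf]; push_cast; ring
  rw [zetaInf, mul_pow, Complex.I_sq, Complex.ofReal_mul, mul_pow, h3]
  ring

end Profile

/-! ### Wedges -/

lemma wedge_subset_halfPlane {M θ : ℝ} (hθ : θ < Real.pi / 2) {x : ℂ} (hx : x ∈ wedge M θ) :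
    M < x.re := by
  rcases Complex.abs_arg_lt_pi_div_two_iff.1 (hx.2.trans hθ) with h | h
  · simpa using h
  · exact absurd (sub_eq_zero.1 h) hx.1

lemma isOpen_wedge {M θ : ℝ} (hθ : θ < Real.pi / 2) : IsOpen (wedge M θ) := by
  rw [isOpen_iff_mem_nhds]
  intro x hx
  have hre := wedge_subset_halfPlane hθ hx
  have hs : x - (M : ℂ) ∈ Complex.slitPlane := Or.inl (by simpa using hre)
  have hc : ContinuousAt (fun y : ℂ => |Complex.arg (y - M)|) x :=
    (ContinuousAt.comp (g := Complex.arg) (f := fun y : ℂ => y - M) (Complex.continuousAt_arg hs)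
      (continuousAt_id.sub continuousAt_const)).abs
  exact (continuousAt_id.eventually_ne hx.1).and (hc.eventually (gt_mem_nhds hx.2))

/-- Cauchy estimates for exponentially decaying functions on a half-plane. -/
lemma norm_iteratedDeriv_le_of_exp {f : ℂ → ℂ} {M K μ : ℝ} (hμ : 0 < μ)
    (hf : ∀ x : ℂ, M < x.re → DifferentiableAt ℂ f x)
    (hK : ∀ x : ℂ, M < x.re → ‖f x‖ ≤ K * Real.exp (-μ * x.re)) {x : ℂ} (hx : M + 1 < x.re) (k : ℕ) :
    ‖iteratedDeriv k f x‖ ≤ k.factorial * (K * Real.exp μ) * Real.exp (-μ * x.re) := by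
  have hre : ∀ z ∈ Metric.closedBall x 1, x.re - 1 ≤ z.re := fun z hz => by
    rw [mem_closedBall_iff_norm] at hz
    have := (Complex.abs_re_le_norm (z - x)).trans hz
    rw [Complex.sub_re, abs_le] at this
    linarith [this.1]
  have hK0 : 0 ≤ K := by
    have := (norm_nonneg _).trans (hK x (by linarith))
    exact nonneg_of_mul_nonneg_left this (Real.exp_pos _)
  have h := Complex.norm_iteratedDeriv_le_of_forall_mem_sphere_norm_le k one_pos
    (f := f) (c := x) (C := K * Real.exp μ * Real.exp (-μ * x.re))
    (DifferentiableOn.diffContOnCl_ball (U := Metric.closedBall x 1) (fun z hz =>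
      (hf z (by have := hre z hz; linarith)).differentiableWithinAt) subset_rfl)
    (fun z hz => by
      have h1 := hre z (Metric.sphere_subset_closedBall hz)
      refine (hK z (by linarith)).trans ?_
      rw [mul_assoc, ← Real.exp_add]
      gcongr
      nlinarith)
  simpa [mul_assoc] using h


/-! ### The conjugators of the linearized system -/

lemma differentiableAt_Y2 {h : ℝ} {β : ℂ → Matrix (Fin 2) (Fin 3) ℂ}
    {γ : ℂ → Matrix (Fin 3) (Fin 2) ℂ} {x : ℂ}
    (hβ : ∀ i j, DifferentiableAt ℂ (fun y => β y i j) x)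
    (hγ : ∀ i j, DifferentiableAt ℂ (fun y => γ y i j) x) :
    ∀ i j, DifferentiableAt ℂ (fun y => Y2 h (β y) (γ y) i j) x := by
  refine forall_fin5 (fun i j => ?_) (fun i j => ?_) (fun i j => ?_) (fun i j => ?_)
  · simp only [Y2_11]; exact differentiableAt_const _
  · simp only [Y2_12]; exact (hβ i j).const_mul _
  · simp only [Y2_21]; exact (hγ i j).const_mul _
  · simp only [Y2_22]; exact differentiableAt_const _

lemma Profile.exists_conjugators {Θ : Thermo} (P : Profile Θ) {F : Coeffs ℂ ℂ}
    (hF : F.Converges P.mu P.uInf P.vInf (Θ.soundSpeed P.stateInf)) :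
    ∃ M h₀ K : ℝ, 0 < h₀ ∧ ∃ ω : Set ℂ, IsOpen ω ∧ P.zetaInf ∈ ω ∧
    ∃ (α₁₂ : ℂ → ℂ → ℂ → Matrix (Fin 2) (Fin 3) ℂ) (α₂₁ : ℂ → ℂ → ℂ → Matrix (Fin 3) (Fin 2) ℂ)
      (αInf : ℂ → ℂ → Matrix (Fin 3) (Fin 2) ℂ),
      ∀ ζ ∈ ω, ∀ h : ℝ, 0 < h → h < h₀ → ∀ x : ℂ, M < x.re →
        (∀ i j, AnalyticAt ℂ (fun q : ℂ × ℂ × ℂ => α₁₂ q.1 q.2.1 q.2.2 i j) (x, ζ, h) ∧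
          ‖α₁₂ x ζ h i j‖ ≤ K ∧
          (h : ℂ) * deriv (fun y => α₁₂ y ζ h i j) x =
            ((F.A11 ζ x + (h : ℂ) • b11 (F.D ζ x)) * α₁₂ x ζ h + b12 (F.D ζ x)
              - α₁₂ x ζ h * (F.A22 ζ x + (h : ℂ) • b22 (F.D ζ x)
                + (h : ℂ) ^ 2 • (b21 (F.D ζ x) * α₁₂ x ζ h))) i j) ∧
        (∀ i j, AnalyticAt ℂ (fun q : ℂ × ℂ × ℂ => α₂₁ q.1 q.2.1 q.2.2 i j) (x, ζ, h) ∧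
          ‖α₂₁ x ζ h i j‖ ≤ K ∧
          ‖α₂₁ x ζ h i j - αInf ζ h i j‖ ≤ K * Real.exp (-P.mu * x.re) ∧
          (h : ℂ) * deriv (fun y => α₂₁ y ζ h i j) x =
            ((F.A22 ζ x + (h : ℂ) • b22 (F.D ζ x)) * α₂₁ x ζ h + b21 (F.D ζ x)
              - α₂₁ x ζ h * (F.A11 ζ x + (h : ℂ) • b11 (F.D ζ x)
                + (h : ℂ) ^ 2 • (b12 (F.D ζ x) * α₂₁ x ζ h))) i j) := by
  set c : ℝ := Θ.soundSpeed P.stateInf with hc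
  have hζ := P.zetaInf_sq
  have hD := hF.D hζ
  have hη : 0 < P.etaInf := hF.eta_pos
  have hηC : 1 - ((P.uInf : ℂ) / c) ^ 2 = (P.etaInf : ℂ) := by
    rw [Profile.etaInf]; push_cast; rfl
  have hu := hF.u_ne
  have hηne : (P.etaInf : ℂ) ≠ 0 := Complex.ofReal_ne_zero.2 hη.ne'
  -- The eigenvalues at infinity are a = −κ² ζ / (η u) and e = ζ / u. As κ² + η = 1, their gap is e
  -- − a = ζ / (η u), which at ζ_∞ = i c₀ η^{1/2} equals i B.
  refine exists_block_conjugators (ζ₀ := P.zetaInf) P.mu_pos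
    (a := fun ζ => -((P.uInf / c : ℂ) ^ 2 * ζ) / ((1 - ((P.uInf : ℂ) / c) ^ 2) * P.uInf))
    (e := fun ζ => ζ / P.uInf) ((analyticAt_const.mul analyticAt_id).neg.div_const)
    analyticAt_id.div_const (B := c * Real.sqrt P.etaInf / (P.uInf * P.etaInf)) ?_ ?_
    (hF.A11 hζ) (hF.A22 _) (fun i j => hD _ _) (fun i j => hD _ _) (fun i j => hD _ _)
    (fun i j => hD _ _)
  · have h1 := hF.c_pos
    have h2 := Real.sqrt_pos.2 hη
    have h3 := hF.u_pos
    positivity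
  · have h1 : ((P.uInf : ℂ) / c) ^ 2 = 1 - P.etaInf := by rw [← hηC]; ring
    rw [h1, sub_sub_cancel, zetaInf, ← hc]
    push_cast
    field_simp
    ring

end ZND

end

theorem mainTheorem9 (Θ : ZND.Thermo) (P : ZND.Profile Θ) (θ : ℝ)
    (hθ₀ : 0 < θ) (hθ₁ : θ < Real.pi / 2) :
    0 < P.mu ∧
    ∃ M₀ h₀ : ℝ, 0 < M₀ ∧ 0 < h₀ ∧
    ∃ ω : Set ℂ, IsOpen ω ∧ P.zetaInf ∈ ω ∧
    ∃ F : ZND.Coeffs ℂ ℂ, F.Extends P.coeffs M₀ ∧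
    (∀ x ∈ ZND.wedge M₀ θ, IsUnit (F.Ax x).det ∧ ∀ ζ ∈ ω, IsUnit (F.Y1 ζ x).det) ∧
    ∃ (α₁₂ : ℂ → ℂ → ℂ → Matrix (Fin 2) (Fin 3) ℂ)
      (α₂₁ : ℂ → ℂ → ℂ → Matrix (Fin 3) (Fin 2) ℂ),
      -- analytic in `(x, ζ, h)`
      (∀ i j, AnalyticOnNhd ℂ (fun q : ℂ × ℂ × ℂ => α₁₂ q.1 q.2.1 q.2.2 i j)
        (ZND.wedge M₀ θ ×ˢ ω ×ˢ (Complex.ofReal '' Set.Ioo 0 h₀))) ∧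
      (∀ i j, AnalyticOnNhd ℂ (fun q : ℂ × ℂ × ℂ => α₂₁ q.1 q.2.1 q.2.2 i j)
        (ZND.wedge M₀ θ ×ˢ ω ×ˢ (Complex.ofReal '' Set.Ioo 0 h₀))) ∧
      -- bounded
      (∃ K : ℝ, ∀ x ∈ ZND.wedge M₀ θ, ∀ ζ ∈ ω, ∀ h : ℝ, 0 < h → h < h₀ →
        (∀ i j, ‖α₁₂ x ζ h i j‖ ≤ K) ∧ ∀ i j, ‖α₂₁ x ζ h i j‖ ≤ K) ∧
      -- exact conjugation to block form
      (∀ ζ ∈ ω, ∀ h : ℝ, 0 < h → h < h₀ →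
        ZND.Conjugates (ZND.wedge M₀ θ) h
          (fun x => ZND.Y2 h (α₁₂ x ζ h) (α₂₁ x ζ h))
          (F.preBlock ζ h)
          (fun x => F.blockDiag (α₁₂ x ζ h) (α₂₁ x ζ h) ζ h x) ∧
        ZND.Conjugates (ZND.wedge M₀ θ) h
          (fun x => F.Y1 ζ x * ZND.Y2 h (α₁₂ x ζ h) (α₂₁ x ζ h))
          (F.G ζ h)
          (fun x => F.blockDiag (α₁₂ x ζ h) (α₂₁ x ζ h) ζ h x)) ∧
      -- endstate of `α₂₁` and derivative estimates
      ∃ αInf : ℂ → ℝ → Matrix (Fin 3) (Fin 2) ℂ,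
        (∀ ζ ∈ ω, ∀ h : ℝ, 0 < h → h < h₀ →
          Filter.Tendsto (fun x => α₂₁ x ζ h)
            (Filter.comap Complex.re Filter.atTop ⊓ Filter.principal (ZND.wedge M₀ θ))
            (nhds (αInf ζ h))) ∧
        ∀ k : ℕ, ∃ C : ℝ, ∀ x ∈ ZND.wedge M₀ θ, ∀ ζ ∈ ω, ∀ h : ℝ, 0 < h → h < h₀ →
          ∀ i j, ‖iteratedDeriv k (fun y => α₂₁ y ζ h i j - αInf ζ h i j) x‖ ≤
            C * h⁻¹ ^ k * Real.exp (-P.mu * x.re) := by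
  obtain ⟨F, hFe, hF⟩ := P.exists_coeffs_extends
  obtain ⟨M, h₁, K, hh₁, ω₁, hω₁, hζ₁, α₁₂, α₂₁, αI, hα⟩ := P.exists_conjugators hF
  have hμ := P.mu_pos
  have hY1d : ∀ᶠ M in Filter.atTop, ∀ i j, ∀ᶠ ζ in 𝓝 P.zetaInf, ∀ x : ℂ, M < x.re →
      DifferentiableAt ℂ (fun y => F.Y1 ζ y i j) x :=
    Filter.eventually_all.2 fun i => Filter.eventually_all.2 fun j =>
      (hF.Y1 P.zetaInf i j).choose_spec.eventually_differentiableAt hμ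
  -- M₀ ≥ M + 1 leaves room for the unit discs of the Cauchy estimates around the points of the
  -- wedge.
  obtain ⟨M₀, hM₀e, hM₀r, hM₀Y, hM₀d, hM₀M, hM₀0⟩ := (hFe.and ((hF.eventually_regular hμ).and
    (((hF.det_Y1 P.zetaInf).eventually_ne_zero hμ (hF.det_Y1_ne P.zetaInf_sq)).and
    (hY1d.and ((Filter.eventually_ge_atTop (M + 1)).and (Filter.eventually_gt_atTop 0)))))).exists
  obtain ⟨ω₂, hω₂, hω₂o, hζ₂⟩ := mem_nhds_iff.1 (hM₀Y.and
    (Filter.eventually_all.2 fun i => Filter.eventually_all.2 fun j => hM₀d i j))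
  -- The bound 1 gives h⁻¹ ≥ 1 for the derivative estimates; the last term gives 5 h K < 1, the
  -- diagonal dominance of `Y2`.
  set h₀ : ℝ := min (min h₁ 1) (1 / (5 * (|K| + 1))) with hh₀
  have hh₀p : 0 < h₀ := lt_min (lt_min hh₁ one_pos) (by positivity)
  have hlt₁ : ∀ {h : ℝ}, h < h₀ → h < h₁ := fun hh =>
    hh.trans_le ((min_le_left _ _).trans (min_le_left _ _))
  have hlt1 : ∀ {h : ℝ}, h < h₀ → h < 1 := fun hh =>
    hh.trans_le ((min_le_left _ _).trans (min_le_right _ _))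
  have hltK : ∀ {h : ℝ}, 0 < h → h < h₀ → 5 * (h * K) < 1 := fun {h} h0 hh => by
    have h1 := (lt_div_iff₀ (by positivity)).1 (hh.trans_le (min_le_right _ _))
    nlinarith [le_abs_self K]
  have hwre : ∀ {x : ℂ}, x ∈ ZND.wedge M₀ θ → M₀ < x.re := ZND.wedge_subset_halfPlane hθ₁
  have hwM : ∀ {x : ℂ}, x ∈ ZND.wedge M₀ θ → M + 1 < x.re := fun hx => hM₀M.trans_lt (hwre hx)
  have hwM' : ∀ {x : ℂ}, x ∈ ZND.wedge M₀ θ → M < x.re := fun hx => by linarith [hwM hx]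
  have hdx : ∀ {f : ℂ × ℂ × ℂ → ℂ} {x ζ h : ℂ}, AnalyticAt ℂ f (x, ζ, h) →
      DifferentiableAt ℂ (fun y => f (y, ζ, h)) x := fun {f x ζ h} hf =>
    DifferentiableAt.comp (g := f) (f := fun y : ℂ => (y, ζ, h)) x hf.differentiableAt
      (differentiableAt_id.prodMk (differentiableAt_const _))
  have hdec : ∀ ζ ∈ ω₁ ∩ ω₂, ∀ h : ℝ, 0 < h → h < h₀ → ∀ i j (x : ℂ), M < x.re →
      ‖α₂₁ x ζ h i j - αI ζ h i j‖ ≤ K * Real.exp (-P.mu * x.re) := fun ζ hζ h h0 hh i j x hx =>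
    ((hα ζ hζ.1 h h0 (hlt₁ hh) x hx).2 i j).2.2.1
  refine ⟨hμ, M₀, h₀, hM₀0, hh₀p, ω₁ ∩ ω₂, hω₁.inter hω₂o, ⟨hζ₁, hζ₂⟩, F, hM₀e,
    fun x hx => ⟨(hM₀r x (hwre hx)).isUnit_det_Ax,
      fun ζ hζ => isUnit_iff_ne_zero.2 ((hω₂ hζ.2).1 x (hwre hx))⟩, α₁₂, α₂₁, ?_, ?_, ?_, ?_,
    fun ζ h => αI ζ h, ?_, ?_⟩
  · rintro i j ⟨x, ζ, _⟩ ⟨hx, hζ, h, hh, rfl⟩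
    exact ((hα ζ hζ.1 h hh.1 (hlt₁ hh.2) x (hwM' hx)).1 i j).1
  · rintro i j ⟨x, ζ, _⟩ ⟨hx, hζ, h, hh, rfl⟩
    exact ((hα ζ hζ.1 h hh.1 (hlt₁ hh.2) x (hwM' hx)).2 i j).1
  · exact ⟨K, fun x hx ζ hζ h h0 hh =>
      ⟨fun i j => ((hα ζ hζ.1 h h0 (hlt₁ hh) x (hwM' hx)).1 i j).2.1,
        fun i j => ((hα ζ hζ.1 h h0 (hlt₁ hh) x (hwM' hx)).2 i j).2.1⟩⟩
  · intro ζ hζ h h0 hh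
    have hαx := fun x (hx : x ∈ ZND.wedge M₀ θ) => hα ζ hζ.1 h h0 (hlt₁ hh) x (hwM' hx)
    have hY2 : ∀ x ∈ ZND.wedge M₀ θ, ∀ i j,
        DifferentiableAt ℂ (fun y => ZND.Y2 h (α₁₂ y ζ h) (α₂₁ y ζ h) i j) x := fun x hx =>
      ZND.differentiableAt_Y2 (fun i j => hdx ((hαx x hx).1 i j).1)
        (fun i j => hdx ((hαx x hx).2 i j).1)
    have hdet2 : ∀ x ∈ ZND.wedge M₀ θ, IsUnit (ZND.Y2 h (α₁₂ x ζ h) (α₂₁ x ζ h)).det :=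
      fun x hx => ZND.isUnit_det_Y2 h0 (hltK h0 hh) (fun i j => ((hαx x hx).1 i j).2.1)
        (fun i j => ((hαx x hx).2 i j).2.1)
    have hY1 : ∀ x ∈ ZND.wedge M₀ θ, ∀ i j, DifferentiableAt ℂ (fun y => F.Y1 ζ y i j) x :=
      fun x hx i j => (hω₂ hζ.2).2 i j x (hwre hx)
    have hdet1 : ∀ x ∈ ZND.wedge M₀ θ, IsUnit (F.Y1 ζ x).det := fun x hx =>
      isUnit_iff_ne_zero.2 ((hω₂ hζ.2).1 x (hwre hx))
    have hode := fun x (hx : x ∈ ZND.wedge M₀ θ) => F.deriv_Y2_add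
      (β := fun y => α₁₂ y ζ h) (γ := fun y => α₂₁ y ζ h)
      (fun i j => ((hαx x hx).1 i j).2.2) (fun i j => ((hαx x hx).2 i j).2.2.2)
    refine ⟨ZND.conjugates_of_deriv (ZND.isOpen_wedge hθ₁) h0.ne' hY2 hdet2 hode,
      ZND.conjugates_of_deriv (ZND.isOpen_wedge hθ₁) h0.ne' (fun x hx i j => ?_) (fun x hx => ?_)
        fun x hx => ZND.Coeffs.deriv_Y1_mul_add (hM₀r x (hwre hx)) (hY1 x hx) (hdet1 x hx)
          (Y := fun y => ZND.Y2 h (α₁₂ y ζ h) (α₂₁ y ζ h)) (hY2 x hx) (hode x hx)⟩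
    · simp only [Matrix.mul_apply]
      exact DifferentiableAt.fun_sum fun k _ => (hY1 x hx i k).fun_mul (hY2 x hx k j)
    · rw [Matrix.det_mul]
      exact (hdet1 x hx).mul (hdet2 x hx)
  · intro ζ hζ h h0 hh
    refine tendsto_pi_nhds.2 fun i => tendsto_pi_nhds.2 fun j => ?_
    rw [tendsto_iff_norm_sub_tendsto_zero]
    have hexp : Filter.Tendsto (fun x : ℂ => K * Real.exp (-P.mu * x.re))
        (Filter.comap Complex.re Filter.atTop ⊓ Filter.principal (ZND.wedge M₀ θ)) (𝓝 0) := by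
      have h1 := ((ZND.HasExpLimit.tendsto_exp hμ).mono_right nhdsWithin_le_nhds).const_mul K
      rw [mul_zero] at h1
      exact (h1.comp Filter.tendsto_comap).mono_left inf_le_left
    refine squeeze_zero' (Filter.Eventually.of_forall fun _ => norm_nonneg _) ?_ hexp
    filter_upwards [Filter.mem_inf_of_right (Filter.mem_principal_self _)] with x hx
    exact hdec ζ hζ h h0 hh i j x (hwM' hx)
  · intro k
    refine ⟨k.factorial * (|K| * Real.exp P.mu), fun x hx ζ hζ h h0 hh i j => ?_⟩
    have hb := ZND.norm_iteratedDeriv_le_of_exp (M := M) (K := |K|) hμ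
      (f := fun y => α₂₁ y ζ h i j - αI ζ h i j)
      (fun z hz => (hdx ((hα ζ hζ.1 h h0 (hlt₁ hh) z hz).2 i j).1).sub_const _)
      (fun z hz => (hdec ζ hζ h h0 hh i j z hz).trans (by
        have := le_abs_self K
        gcongr)) (hwM hx) k
    refine hb.trans ?_
    -- The Cauchy bound is already uniform in h, since the decay holds on a whole half-plane; for h
    -- < 1 the factor h⁻ᵏ only weakens it.
    have h1 : 1 ≤ h⁻¹ ^ k := one_le_pow₀ ((one_le_inv₀ h0).2 (hlt1 hh).le)
    exact mul_le_mul_of_nonneg_right (le_mul_of_one_le_right (by positivity) h1) (Real.exp_pos _).le
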